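/- **Model.** For a distribution $F$ on $\mathbb R^D$ carried by a set on which all inner products lie in $[0,1]$, $(X,A)\sim\mathrm{RDPG}(F)$ means that $X_1,\dots,X_n$ are i.i.d. with law $F$ and that, given $X$, the simple graph $A$ on $[n]$ has independent edges, $ij$ being an edge with probability $\langle X_i,X_j\rangle$. A 1-level HSBM (a stochastic blockmodel) is a finite mixture of point masses with positive weights, and for $\ell\ge2$ an $\ell$-level HSBM is a finite mixture $F=\sum_{i=1}^{R}\pi(i)F_i$ with $\pi(i)\in(0,1)$, $\sum_i\pi(i)=1$, each $F_i$ being an $h$-level HSBM with $h\le\ell-1$ and at least one of them an $(\ell-1)$-level one. The distributions occurring in this recursive decomposition are the sub-HSBMs $G$; those of level at least 2 are mixtures, of $R^G$ components $F^G_1,\dots,F^G_{R^G}$. The dimension $D^G$ of $G$ is the rank of the second moment matrix $\mathbb E[YY^\top]$, where $Y$ has the law $G$; $F^G_r$ has the dimension $D^G_r$. The vertex set of the subgraph belonging to $G$ is the set of the vertices drawn from $G$, and $H^G_1,\dots,H^G_{R^G}$ are the subgraphs belonging to the components. $H^G_i$ and $H^G_j$ are of the same motif if $F^G_i$ is the image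 of $F^G_j$ under an orthogonal transformation. Events $E_n$ occur asymptotically almost surely (a.a.s.) if for every $c>0$ there is $n_0$ such that $\mathbb P(E_n)\ge1-\eta$ whenever $n>n_0$ and $n^{-c}<\eta<1/2$. **Procedure.** The adjacency spectral embedding of a graph with adjacency matrix $A$ into $\mathbb R^d$ is $\widehat X=US^{1/2}$, where $S$ holds the $d$ largest eigenvalues of $|A|=(A^\top A)^{1/2}$ and $U$ corresponding orthonormal eigenvectors. Its rows are clustered into $R$ clusters as follows. Start with any $R$ rows as seeds. Run through all rows; at each row $x$ take a pair $\tilde y,\tilde z$ of different seeds with the largest inner product and replace $\tilde z$ by $x$ if $\max_{s}\langle x,s\rangle<\langle\tilde y,\tilde z\rangle$, keep the seeds if $\max_{s}\langle x,s\rangle>\langle\tilde y,\tilde z\rangle$, and do either in case of equality. Finally put every row into the cluster of a seed with which it has the largest inner product. The recursive procedure embeds the graph into $\mathbb R^{D}$, $D$ being its dimension, clusters it into as many clusters $\widehat H_r$ as the mixture has components, embeds each $\widehat H_r$ into $\mathbb R^{D_r}$, computes the dissimilarities below, and recurses on each $\widehat H_r$ whose model has level at least 2; the numbers $R^G$ and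 $D^G$ are known to it. With the Gaussian kernel $\kappa(x,y)=e^{-\|x-y\|^2/\sigma^2}$, $\sigma>0$ fixed, let, for point clouds $x_1,\dots,x_n$ and $y_1,\dots,y_m$, $$T(x,y)=\frac1{n(n-1)}\sum_{i\ne j}\kappa(x_i,x_j)-\frac2{mn}\sum_{i,k}\kappa(x_i,y_k)+\frac1{m(m-1)}\sum_{k\ne l}\kappa(y_k,y_l),$$ and $\overline T(x,y)=\inf_W T(x,Wy)$ over all orthogonal $W$ (clouds of lower dimension are padded with zeros to $\mathbb R^{D}$, the space that contains the latent positions of the whole model). **Theorem.** Let $\ell\ge2$ and let $(X,A)\sim\mathrm{RDPG}(F)$ on $n$ vertices, where $F$ is an $\ell$-level HSBM that does not depend on $n$. Assume that for every sub-HSBM $G$ of level at least 2, every inner product of latent positions from two different components of $G$ is smaller than every inner product of two (possibly equal) latent positions from one component of $G$. Then: 1. A.a.s., simultaneously for all sub-HSBMs $G$ of level at least 2, for all choices of initial seeds, of the order of the vertices, of eigenvectors and at ties, the procedure recovers the subgraphs exactly: after renumbering, $\widehat H^G_r=H^G_r$ for $r=1,\dots,R^G$. 2. For every $\varepsilon>0$,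 a.a.s., simultaneously for all such $G$ and all such choices, in addition there are orthogonal matrices $O_1,\dots,O_{R^G}$ with $|T(\widehat X_{\widehat H^G_i},\widehat X_{\widehat H^G_j})-T(O_iX_{H^G_i},O_jX_{H^G_j})|\le\varepsilon$ for all $i,j$, and $|\overline T(\widehat X_{\widehat H^G_i},\widehat X_{\widehat H^G_j})-\overline T(X_{H^G_i},X_{H^G_j})|\le\varepsilon$ for all $i,j$. 3. There is $t_0>0$ such that for every $t\in(0,t_0)$, a.a.s., simultaneously for all such $G$ and all such choices, in addition, for all $i,j$: $\overline T(\widehat X_{\widehat H^G_i},\widehat X_{\widehat H^G_j})<t$ if and only if $H^G_i$ and $H^G_j$ are of the same motif. -/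

import Mathlib

open MeasureTheory ProbabilityTheory

open scoped Classical

noncomputable section

/-- Euclidean space `ℝ^d`. -/
abbrev Euc (d : ℕ) : Type := EuclideanSpace ℝ (Fin d)

/-! ### Random dot product graphs -/

/-- `(X, A) ∼ RDPG(F)` on `n` vertices: `F` lives on a set all of whose inner products are in
`[0,1]`, the rows `X 0, …, X (n-1)` are i.i.d. with law `F`, and the conditional law of the simple
graph `A` (a symmetric hollow `0/1` matrix) given `X` is
`ℙ[A = a ∣ X] = ∏_{i > j} ⟪X i, X j⟫ ^ a i j * (1 - ⟪X i, X j⟫) ^ (1 - a i j)`. -/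
structure IsRDPG {Ω : Type*} [MeasurableSpace Ω] (μ : Measure Ω) {D : ℕ} (F : Measure (Euc D))
    {n : ℕ} (X : Ω → Fin n → Euc D) (A : Ω → SimpleGraph (Fin n)) : Prop where
  inner_mem : ∃ S : Set (Euc D), F Sᶜ = 0 ∧ ∀ x ∈ S, ∀ y ∈ S, inner ℝ x y ∈ Set.Icc (0 : ℝ) 1
  measurable_pos : Measurable X
  measurable_graph : ∀ a : SimpleGraph (Fin n), MeasurableSet {ω | A ω = a}
  indep : iIndepFun (fun i ω => X ω i) μ
  law : ∀ i, μ.map (fun ω => X ω i) = F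
  cond : ∀ (a : SimpleGraph (Fin n)) (B : Set (Fin n → Euc D)), MeasurableSet B →
    μ {ω | X ω ∈ B ∧ A ω = a} =
      ∫⁻ ω in {ω | X ω ∈ B}, ENNReal.ofReal (∏ i : Fin n, ∏ j ∈ Finset.Iio i,
        if a.Adj i j then inner ℝ (X ω i) (X ω j) else 1 - inner ℝ (X ω i) (X ω j)) ∂μ

/-- Two latent position distributions give the same motif when they agree up to an orthogonal
transformation. -/
def SameMotif {D : ℕ} (F G : Measure (Euc D)) : Prop :=
  ∃ U : Euc D ≃ₗᵢ[ℝ] Euc D, F = G.map U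

/-- The events `E n` occur asymptotically almost surely: for every `c > 0` there is `n₀` such that
`ℙ(E n) ≥ 1 - η` whenever `n > n₀` and `n ^ (-c) < η < 1/2`. -/
def AAS {Ω : ℕ → Type*} [∀ n, MeasurableSpace (Ω n)] (μ : ∀ n, Measure (Ω n))
    (E : ∀ n, Set (Ω n)) : Prop :=
  ∀ c : ℝ, 0 < c → ∃ n₀ : ℕ, ∀ n : ℕ, n₀ < n → ∀ η : ℝ, (n : ℝ) ^ (-c) < η → η < 1 / 2 →
    ENNReal.ofReal (1 - η) ≤ μ n (E n)

/-! ### Hierarchical stochastic blockmodels -/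

/-- Parameters of a hierarchical stochastic blockmodel with latent positions in `ℝ^D`: either a
mixture of point masses (a stochastic blockmodel), or a mixture of hierarchical blockmodels. -/
inductive HSBM (D : ℕ) : Type
  | sbm (K : ℕ) (w : Fin K → ℝ) (ξ : Fin K → Euc D) : HSBM D
  | mix (R : ℕ) (w : Fin R → ℝ) (H : Fin R → HSBM D) : HSBM D

namespace HSBM

variable {D : ℕ}

/-- The latent position distribution. -/
def law : HSBM D → Measure (Euc D)
  | sbm _ w ξ => ∑ k, ENNReal.ofReal (w k) • Measure.dirac (ξ k)
  | mix _ w H => ∑ i, ENNReal.ofReal (w i) • (H i).law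

/-- The set of all latent positions, i.e. of the atoms of the distribution. -/
def positions : HSBM D → Set (Euc D)
  | sbm _ _ ξ => Set.range ξ
  | mix _ _ H => ⋃ i, (H i).positions

/-- `G.IsLevel ℓ`: the parameters are those of an `ℓ`-level HSBM. Level `1` is a stochastic
blockmodel; for `ℓ ≥ 2` the distribution is a mixture with weights in `(0,1)` whose components are
HSBMs of level at most `ℓ - 1`, at least one of them of level `ℓ - 1`. -/
def IsLevel : HSBM D → ℕ → Prop
  | sbm _ w _, ℓ => ℓ = 1 ∧ (∀ k, 0 < w k) ∧ ∑ k, w k = 1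
  | mix _ w H, ℓ => 2 ≤ ℓ ∧ (∀ i, 0 < w i ∧ w i < 1) ∧ ∑ i, w i = 1 ∧
      (∀ i, ∃ h, h ≤ ℓ - 1 ∧ (H i).IsLevel h) ∧ ∃ i, (H i).IsLevel (ℓ - 1)

/-- Multilevel affinity: in every mixture occurring in the hierarchy, every inner product between
latent positions of two different components is smaller than every inner product between latent
positions of one component (`p < q`, all sets being finite). -/
def Affinity : HSBM D → Prop
  | sbm _ _ _ => True
  | mix _ _ H =>
      (∀ j k, j ≠ k → ∀ u ∈ (H j).positions, ∀ v ∈ (H k).positions,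
        ∀ i, ∀ x ∈ (H i).positions, ∀ y ∈ (H i).positions, inner ℝ u v < inner ℝ x y) ∧
      ∀ i, (H i).Affinity

/-- The second moment matrix `Δ = 𝔼[X₁ X₁ᵀ]`. -/
def secondMoment (G : HSBM D) : Matrix (Fin D) (Fin D) ℝ :=
  fun a b => ∫ x, x a * x b ∂G.law

/-- The dimension of the model as a random dot product graph: the rank of `Δ`. -/
def dim (G : HSBM D) : ℕ := G.secondMoment.rank

/-- The vertices of `V` that belong to the subgraph with parameters `G`. -/
def members (G : HSBM D) {n : ℕ} (X : Fin n → Euc D) (V : Finset (Fin n)) : Finset (Fin n) :=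
  V.filter fun v => X v ∈ G.positions

end HSBM

/-! ### Adjacency spectral embedding -/

/-- The adjacency matrix of the subgraph of `a` induced on `V`. -/
def adjOn {n : ℕ} (a : SimpleGraph (Fin n)) (V : Finset (Fin n)) : Matrix V V ℝ :=
  fun u v => if a.Adj u v then 1 else 0

/-- `Xh` (with rows `Xh v`) is an adjacency spectral embedding of `A` into `ℝ^d`. Here
`M = |A| = (Aᵀ A)^{1/2}`, the vectors `b k` are an orthonormal eigenbasis of `M` with eigenvalues
`s 0 ≥ s 1 ≥ …`, and `Xh = U S^{1/2}` for the first `d` of them (with zero columns if there are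
fewer than `d` vertices). -/
def IsASE {V : Type*} [Fintype V] (A : Matrix V V ℝ) {d : ℕ} (Xh : V → Euc d) : Prop :=
  ∃ M : Matrix V V ℝ, M.PosSemidef ∧ M * M = A.transpose * A ∧
  ∃ (b : OrthonormalBasis (Fin (Fintype.card V)) ℝ (EuclideanSpace ℝ V))
    (s : Fin (Fintype.card V) → ℝ), Antitone s ∧
    (∀ k v, M.mulVec (fun u => b k u) v = s k * b k v) ∧
    ∀ v (j : Fin d), Xh v j =
      if h : (j : ℕ) < Fintype.card V then Real.sqrt (s ⟨j, h⟩) * b ⟨j, h⟩ v else 0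

/-! ### Seeded nearest neighbour subspace clustering -/

section Clustering

variable {V : Type*} {d R : ℕ}

/-- One step of the seed selection, at the vertex `v`. The current seeds are the rows
`Xh (s 0), …, Xh (s (R-1))`; `y ≠ z` is a pair of seeds with the largest inner product. If all
inner products of `Xh v` with seeds are below that value, `v` replaces `z`; if one of them is above
it, nothing changes; if the largest one equals it, both are allowed. -/
def SeedStep (Xh : V → Euc d) (v : V) (s s' : Fin R → V) : Prop :=
  ∃ y z : Fin R, y ≠ z ∧
    (∀ y' z' : Fin R, y' ≠ z' →
      inner ℝ (Xh (s y')) (Xh (s z')) ≤ inner ℝ (Xh (s y)) (Xh (s z))) ∧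
    (((∀ x, inner ℝ (Xh v) (Xh (s x)) ≤ inner ℝ (Xh (s y)) (Xh (s z))) ∧
        s' = Function.update s z v) ∨
      ((∃ x, inner ℝ (Xh (s y)) (Xh (s z)) ≤ inner ℝ (Xh v) (Xh (s x))) ∧ s' = s))

/-- The seed selection along a list of vertices, from the seeds `s` to the final seeds. -/
inductive SeedRun (Xh : V → Euc d) : List V → (Fin R → V) → (Fin R → V) → Prop
  | nil (s : Fin R → V) : SeedRun Xh [] s s
  | cons {v : V} {l : List V} {s s' s'' : Fin R → V} :
      SeedStep Xh v s s' → SeedRun Xh l s' s'' → SeedRun Xh (v :: l) s s''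

/-- `C 0, …, C (R-1)` is a possible output of the clustering of the rows of `Xh` into `R` clusters,
for some initial sample `s₀` of seeds, some order of the vertices and some choice at ties: `s` are
the final seeds, the cluster `C j` is initialized to `{s j}` and every vertex `v` is then added to a
cluster `τ v` whose seed has the largest inner product with `Xh v`. -/
def SeededClustering [Fintype V] (Xh : V → Euc d) (C : Fin R → Finset V) : Prop :=
  ∃ l : List V, l.Nodup ∧ (∀ v, v ∈ l) ∧ ∃ s₀ s : Fin R → V, SeedRun Xh l s₀ s ∧
    ∃ τ : V → Fin R,
      (∀ v j, inner ℝ (Xh v) (Xh (s j)) ≤ inner ℝ (Xh v) (Xh (s (τ v)))) ∧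
      ∀ j, C j = insert (s j) (Finset.univ.filter fun v => τ v = j)

end Clustering

/-- Embed the subgraph of `a` on `V` into `ℝ^d` and cluster it into `R` subgraphs `Hh r`. -/
def EmbedAndCluster {n : ℕ} (a : SimpleGraph (Fin n)) (V : Finset (Fin n)) (d : ℕ) {R : ℕ}
    (Hh : Fin R → Finset (Fin n)) : Prop :=
  ∃ (Xh : V → Euc d) (C : Fin R → Finset V), IsASE (adjOn a V) Xh ∧ SeededClustering Xh C ∧
    ∀ r, Hh r = (C r).map (Function.Embedding.subtype _)

/-! ### The test statistic -/

/-- Gaussian radial basis kernel with bandwidth `σ`. -/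
def rbf {D : ℕ} (σ : ℝ) (x y : Euc D) : ℝ := Real.exp (-‖x - y‖ ^ 2 / σ ^ 2)

/-- The statistic `T_{n,m}(X, Y)`. -/
def testT {D : ℕ} (σ : ℝ) {U V : Type*} [Fintype U] [Fintype V]
    (X : U → Euc D) (Y : V → Euc D) : ℝ :=
  let n : ℝ := Fintype.card U
  let m : ℝ := Fintype.card V
  1 / (n * (n - 1)) * (∑ i, ∑ j, if j ≠ i then rbf σ (X i) (X j) else 0)
    - 2 / (m * n) * (∑ i, ∑ k, rbf σ (X i) (Y k))
    + 1 / (m * (m - 1)) * (∑ k, ∑ l, if l ≠ k then rbf σ (Y k) (Y l) else 0)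

/-- The statistic after optimal orthogonal alignment of the two point clouds, which are determined
by the graphs only up to orthogonal transformations. -/
def alignedT {D : ℕ} (σ : ℝ) {U V : Type*} [Fintype U] [Fintype V]
    (X : U → Euc D) (Y : V → Euc D) : ℝ :=
  ⨅ W : Euc D ≃ₗᵢ[ℝ] Euc D, testT σ X (fun k => W (Y k))

/-- Zero padding `ℝ^d → ℝ^D`, used with `d ≤ D`, so that embeddings of different dimensions can be
compared. -/
def pad {d : ℕ} (D : ℕ) (x : Euc d) : Euc D :=
  WithLp.toLp 2 fun j : Fin D => if h : (j : ℕ) < d then x ⟨j, h⟩ else 0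

/-! ### The recursive procedure -/

namespace HSBM

variable {D n : ℕ}

/-- A property of one round of the procedure: `H r` are the parameters of the components of the
current mixture and `Hh r` the estimated subgraphs. -/
abbrev RoundProp (D n : ℕ) : Type :=
  (R : ℕ) → (H : Fin R → HSBM D) → (Hh : Fin R → Finset (Fin n)) → Prop

/-- Run the recursive procedure on the subgraph of `a` on `V`, whose model is `G`. In each round,
for every possible output of the embedding (into the dimension of the current model) and clustering
(into the number of components of the current mixture), the clusters are, after numbering them
suitably, exactly the true subgraphs; the round has the property `Q`; and the same is true of the
recursion on each of the clusters. -/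
def PerfectRun (Q : RoundProp D n) (X : Fin n → Euc D) (a : SimpleGraph (Fin n)) :
    HSBM D → Finset (Fin n) → Prop
  | sbm _ _ _, _ => True
  | mix R w H, V => ∀ C : Fin R → Finset (Fin n), EmbedAndCluster a V (mix R w H).dim C →
      ∃ e : Equiv.Perm (Fin R), (∀ r, C (e r) = (H r).members X V) ∧
        Q R H (fun r => C (e r)) ∧ ∀ r, PerfectRun Q X a (H r) (C (e r))

/-- `Xh r` is an adjacency spectral embedding of the estimated subgraph `Hh r` into the dimension of
its model `H r`. -/
def Embeddings (a : SimpleGraph (Fin n)) {R : ℕ} (H : Fin R → HSBM D)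
    (Hh : Fin R → Finset (Fin n)) (Xh : ∀ r, Hh r → Euc (H r).dim) : Prop :=
  ∀ r, IsASE (adjOn a (Hh r)) (Xh r)

/-- The dissimilarities `T` of the embedded estimated subgraphs are within `ε` of those of the true
latent positions, the latter being represented by suitable orthogonal images; and the aligned
dissimilarities are within `ε` of those of the true latent positions. -/
def Consistent (σ ε : ℝ) (X : Fin n → Euc D) (a : SimpleGraph (Fin n)) : RoundProp D n :=
  fun R H Hh => ∀ Xh : ∀ r, Hh r → Euc (H r).dim, Embeddings a H Hh Xh →
    (∃ O : Fin R → (Euc D ≃ₗᵢ[ℝ] Euc D), ∀ i j,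
      |testT σ (fun v => pad D (Xh i v)) (fun v => pad D (Xh j v))
        - testT σ (fun v : Hh i => O i (X v)) (fun v : Hh j => O j (X v))| ≤ ε) ∧
    ∀ i j,
      |alignedT σ (fun v => pad D (Xh i v)) (fun v => pad D (Xh j v))
        - alignedT σ (fun v : Hh i => X v) (fun v : Hh j => X v)| ≤ ε

/-- Thresholding the aligned dissimilarities at `t` gives exactly the partition of the subgraphs
into motifs. -/
def MotifsDetected (σ t : ℝ) (a : SimpleGraph (Fin n)) : RoundProp D n :=
  fun R H Hh => ∀ Xh : ∀ r, Hh r → Euc (H r).dim, Embeddings a H Hh Xh →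
    ∀ i j : Fin R,
      alignedT σ (fun v => pad D (Xh i v)) (fun v => pad D (Xh j v)) < t ↔
        SameMotif (H i).law (H j).law

end HSBM

end

/-!
All statements reduce to deterministic ones about typical samples, in which every latent position
occurs with almost its expected frequency and, for each latent position `x` and all `u ≠ v`, the
number of common neighbours of `u` and `v` with position `x` is almost its conditional expectation.
By Hoeffding's inequality a sample is typical up to `ε` with probability `1 - O(n² e^{-2ε²n})`, and
this single event controls the subgraphs of all levels at once.

In a typical sample, the square of the adjacency matrix of a subgraph is entrywise close, off the
diagonal, to the square of its matrix of edge probabilities, which has rank at most the dimension of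
the submodel and a spectral gap of order `n`. The inner products of the embedding are entries of
`|A| = (A²)^{1/2}` cut off at that rank; across the gap this truncated square root is approximated
by polynomials in `A²`, so the embedding recovers all inner products of latent positions up to
`o(1)`. Affinity provides a threshold between the inner products within and between components,
which survives this error, and seeded clustering is exact whenever there is such a threshold.

As the latent positions take finitely many values, close inner products make the embedding uniformly
close to an orthogonal image of the positions; the test statistic, being Lipschitz in the points, is
then consistent. Its population version is the squared maximum mean discrepancy of the Gaussian
kernel, which vanishes only for equal laws. The orthogonal group being compact, it is bounded away
from zero for submodels with different motifs, so every small threshold separates the motifs.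
-/

/-! ### Perturbation of truncated square roots -/

section PolynomialCalculus

open Polynomial

variable {A : Type*} [NormedRing A] [NormOneClass A] {x y : A}

theorem norm_pow_sub_pow_le_of_norm_le_one (hx : ‖x‖ ≤ 1) (hy : ‖y‖ ≤ 1) (k : ℕ) :
    ‖x ^ k - y ^ k‖ ≤ k * ‖x - y‖ := by
  induction k with
  | zero => simp
  | succ k ih =>
    have hyk : ‖y ^ k‖ ≤ 1 := (norm_pow_le y k).trans (pow_le_one₀ (norm_nonneg y) hy)
    calc ‖x ^ (k + 1) - y ^ (k + 1)‖ = ‖(x ^ k - y ^ k) * x + y ^ k * (x - y)‖ := by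
          rw [pow_succ, pow_succ]; noncomm_ring
      _ ≤ ‖x ^ k - y ^ k‖ * ‖x‖ + ‖y ^ k‖ * ‖x - y‖ :=
          (norm_add_le _ _).trans (add_le_add (norm_mul_le _ _) (norm_mul_le _ _))
      _ ≤ k * ‖x - y‖ * 1 + 1 * ‖x - y‖ := by gcongr
      _ = (k + 1 : ℕ) * ‖x - y‖ := by push_cast; ring

variable [NormedAlgebra ℝ A]

theorem norm_aeval_le (p : ℝ[X]) (hx : ‖x‖ ≤ 1) :
    ‖aeval x p‖ ≤ ∑ i ∈ Finset.range (p.natDegree + 1), |p.coeff i| := by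
  rw [aeval_eq_sum_range]
  refine norm_sum_le_of_le _ fun i _ => ?_
  rw [norm_smul, Real.norm_eq_abs]
  exact mul_le_of_le_one_right (abs_nonneg _)
    ((norm_pow_le x i).trans (pow_le_one₀ (norm_nonneg x) hx))

theorem norm_aeval_sub_aeval_le (p : ℝ[X]) (hx : ‖x‖ ≤ 1) (hy : ‖y‖ ≤ 1) :
    ‖aeval x p - aeval y p‖
      ≤ (∑ i ∈ Finset.range (p.natDegree + 1), |p.coeff i| * i) * ‖x - y‖ := by
  rw [aeval_eq_sum_range, aeval_eq_sum_range, ← Finset.sum_sub_distrib, Finset.sum_mul]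
  refine norm_sum_le_of_le _ fun i _ => ?_
  rw [← smul_sub, norm_smul, Real.norm_eq_abs, mul_assoc]
  exact mul_le_mul_of_nonneg_left (norm_pow_sub_pow_le_of_norm_le_one hx hy i) (abs_nonneg _)

theorem exists_polynomial_sqrt_near_sq_mul {a ε : ℝ} (ha : 0 < a) (hε : 0 < ε) :
    ∃ (q : ℝ[X]) (ρ : ℝ), 0 < ρ ∧ (∀ x ∈ Set.Icc a 1, |√x - x ^ 2 * q.eval x| ≤ ε * x ^ 2) ∧
      ∀ x ∈ Set.Icc 0 ρ, |q.eval x| ≤ ε := by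
  have hmax : ∀ x : ℝ, 0 < max x a := fun x => ha.trans_le (le_max_right x a)
  have hcont : Continuous fun x : ℝ => √x / max x a ^ 2 :=
    Real.continuous_sqrt.div ((continuous_id.max continuous_const).pow 2)
      fun x => (pow_pos (hmax x) 2).ne'
  obtain ⟨q, hq⟩ := exists_polynomial_near_of_continuousOn 0 1 _ hcont.continuousOn (ε / 2)
    (by positivity)
  refine ⟨q, min 1 ((ε / 2 * a ^ 2) ^ 2), by positivity, fun x hx => ?_, fun x hx => ?_⟩
  · have hx0 : 0 < x := ha.trans_le hx.1
    have hqx := hq x ⟨hx0.le, hx.2⟩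
    rw [max_eq_left hx.1, abs_sub_comm] at hqx
    have hfactor : √x - x ^ 2 * q.eval x = (√x / x ^ 2 - q.eval x) * x ^ 2 := by field_simp
    rw [hfactor, abs_mul, abs_of_nonneg (sq_nonneg x)]
    gcongr
    linarith
  · have hqx := hq x ⟨hx.1, hx.2.trans (min_le_left _ _)⟩
    have hsqrt : √x ≤ ε / 2 * a ^ 2 :=
      Real.sqrt_le_iff.2 ⟨by positivity, hx.2.trans (min_le_right _ _)⟩
    have hsmall : √x / max x a ^ 2 ≤ ε / 2 := by
      rw [div_le_iff₀ (pow_pos (hmax x) 2)]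
      exact hsqrt.trans (by gcongr; exact le_max_right x a)
    have hnonneg : 0 ≤ √x / max x a ^ 2 := by positivity
    rw [abs_lt] at hqx
    rw [abs_le]
    constructor <;> linarith

end PolynomialCalculus

section SpectralPerturbation

open Polynomial

variable {E : Type*} [NormedAddCommGroup E] [InnerProductSpace ℝ E]

section Diagonal

variable {ι : Type*} [Fintype ι] (b : OrthonormalBasis ι ℝ E) {s : ι → ℝ} {S : E →L[ℝ] E}

theorem inner_map_of_diagonal (hS : ∀ k, S (b k) = s k • b k) (k : ι) (x : E) :
    inner ℝ (b k) (S x) = s k * inner ℝ (b k) x := by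
  conv_lhs => rw [← b.sum_repr' x]
  simp only [map_sum, map_smul, hS, inner_sum, inner_smul_right]
  rw [Finset.sum_eq_single k (fun j _ hj => by simp [b.orthonormal.2 hj.symm]) (by simp)]
  simp [b.orthonormal.1 k, mul_comm]

theorem inner_map_eq_sum_of_diagonal (hS : ∀ k, S (b k) = s k • b k) (x y : E) :
    inner ℝ x (S y) = ∑ k, s k * (inner ℝ x (b k) * inner ℝ (b k) y) := by
  rw [← b.sum_inner_mul_inner]
  exact Finset.sum_congr rfl fun k _ => by rw [inner_map_of_diagonal b hS]; ring

theorem aeval_apply_of_diagonal (hS : ∀ k, S (b k) = s k • b k) (q : ℝ[X]) (k : ι) :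
    aeval S q (b k) = q.eval (s k) • b k := by
  have hpow : ∀ i : ℕ, (S ^ i) (b k) = s k ^ i • b k := by
    intro i
    induction i with
    | zero => simp
    | succ i ih => rw [pow_succ', mul_apply_eq_comp, ih, map_smul, hS, smul_smul,
        pow_succ]
  simp only [aeval_eq_sum_range, eval_eq_sum_range, sum_apply, smul_apply, hpow, smul_smul,
    Finset.sum_smul]

/-- Sandwiching between two applications of `S` is what makes this useful for vectors `x` and `y`
of large norm. -/
theorem abs_sum_weights_sub_inner_aeval_le (hS : ∀ k, S (b k) = s k • b k) {w : ι → ℝ}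
    {q : ℝ[X]} {ε : ℝ} (hw : ∀ k, |w k - s k ^ 2 * q.eval (s k)| ≤ ε * s k ^ 2)
    {x y : E} (hx : ‖S x‖ ≤ 1) (hy : ‖S y‖ ≤ 1) (hε : 0 ≤ ε) :
    |∑ k, w k * (inner ℝ x (b k) * inner ℝ (b k) y) - inner ℝ (S x) (aeval S q (S y))| ≤ ε := by
  have hSl : ∀ k z, inner ℝ (S z) (b k) = s k * inner ℝ z (b k) := fun k z => by
    rw [real_inner_comm, inner_map_of_diagonal b hS, real_inner_comm]
  rw [inner_map_eq_sum_of_diagonal b (aeval_apply_of_diagonal b hS q), ← Finset.sum_sub_distrib]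
  calc |∑ k, (w k * (inner ℝ x (b k) * inner ℝ (b k) y)
          - q.eval (s k) * (inner ℝ (S x) (b k) * inner ℝ (b k) (S y)))|
      ≤ ∑ k, ε * (|inner ℝ (S x) (b k)| * |inner ℝ (b k) (S y)|) := by
        refine (Finset.abs_sum_le_sum_abs _ _).trans (Finset.sum_le_sum fun k _ => ?_)
        rw [hSl, inner_map_of_diagonal b hS]
        calc _ = |w k - s k ^ 2 * q.eval (s k)| * |inner ℝ x (b k) * inner ℝ (b k) y| := by
              rw [← abs_mul]; ring_nf
          _ ≤ ε * s k ^ 2 * |inner ℝ x (b k) * inner ℝ (b k) y| := by gcongr; exact hw k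
          _ = _ := by rw [← sq_abs (s k), abs_mul, abs_mul, abs_mul]; ring
    _ = ε * ∑ k, |inner ℝ (S x) (b k)| * |inner ℝ (b k) (S y)| := by rw [Finset.mul_sum]
    _ ≤ ε * 1 := by
        gcongr
        refine (Real.sum_mul_le_sqrt_mul_sqrt _ _ _).trans ?_
        simp only [sq_abs]
        rw [b.sum_sq_inner_right, b.sum_sq_inner_left, Real.sqrt_sq (norm_nonneg _),
          Real.sqrt_sq (norm_nonneg _)]
        exact mul_le_one₀ hx (norm_nonneg _) hy
    _ = ε := mul_one ε

end Diagonal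

theorem exists_ne_zero_mem_forall_inner_eq_zero {ι : Type*} [Fintype ι] (W : Submodule ℝ E)
    [FiniteDimensional ℝ W] (v : ι → E) (h : Fintype.card ι < Module.finrank ℝ W) :
    ∃ y ∈ W, y ≠ 0 ∧ ∀ i, inner ℝ (v i) y = 0 := by
  let φ : W →ₗ[ℝ] (ι → ℝ) := LinearMap.pi fun i => (innerₛₗ ℝ (v i)).comp W.subtype
  obtain ⟨y, hy, hy0⟩ := Submodule.exists_mem_ne_zero_of_ne_bot
    (LinearMap.ker_ne_bot_of_finrank_lt (f := φ) (by simpa using h))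
  exact ⟨y, y.2, by simpa using hy0, fun i => congrFun (LinearMap.mem_ker.1 hy) i⟩

theorem abs_inner_map_self_sub_le {S T : E →L[ℝ] E} {η : ℝ} (h : ‖S - T‖ ≤ η) (y : E) :
    |inner ℝ y (S y) - inner ℝ y (T y)| ≤ η * ‖y‖ ^ 2 := by
  rw [← inner_sub_right]
  calc |inner ℝ y (S y - T y)| ≤ ‖y‖ * ‖(S - T) y‖ := abs_real_inner_le_norm _ _
    _ ≤ ‖y‖ * (η * ‖y‖) := by gcongr; exact (S - T).le_of_opNorm_le h y
    _ = η * ‖y‖ ^ 2 := by ring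

section Weyl

variable [FiniteDimensional ℝ E] {m : ℕ} (b : OrthonormalBasis (Fin m) ℝ E) {s : Fin m → ℝ}
  {S T : E →L[ℝ] E} {η c : ℝ} {W : Submodule ℝ E}

theorem sub_le_eigenvalue_of_norm_sub_le (hS : ∀ k, S (b k) = s k • b k) (hs : Antitone s)
    (hST : ‖S - T‖ ≤ η) (hW : ∀ y ∈ W, c * ‖y‖ ^ 2 ≤ inner ℝ y (T y)) {k : Fin m}
    (hk : (k : ℕ) < Module.finrank ℝ W) : c - η ≤ s k := by
  obtain ⟨y, hyW, hy0, hyb⟩ := exists_ne_zero_mem_forall_inner_eq_zero W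
    (fun i : Finset.Iio k => b i) (by rw [Fintype.card_coe, Fin.card_Iio]; exact hk)
  have hupper : inner ℝ y (S y) ≤ s k * ‖y‖ ^ 2 := by
    rw [inner_map_eq_sum_of_diagonal b hS, ← b.sum_sq_inner_right y, Finset.mul_sum]
    refine Finset.sum_le_sum fun i _ => ?_
    rw [real_inner_comm (b i), ← sq]
    rcases lt_or_ge i k with hi | hi
    · simp [hyb ⟨i, Finset.mem_Iio.2 hi⟩]
    · exact mul_le_mul_of_nonneg_right (hs hi) (sq_nonneg _)
  have hclose := abs_le.1 (abs_inner_map_self_sub_le hST y)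
  have hpos : 0 < ‖y‖ ^ 2 := by positivity
  exact le_of_mul_le_mul_right (by linarith [hW y hyW]) hpos

theorem eigenvalue_le_add_of_norm_sub_le (hS : ∀ k, S (b k) = s k • b k) (hs : Antitone s)
    (hST : ‖S - T‖ ≤ η) (hW : ∀ y ∈ W, inner ℝ y (T y) ≤ c * ‖y‖ ^ 2) {k : Fin m}
    (hk : m ≤ Module.finrank ℝ W + k) : s k ≤ c + η := by
  obtain ⟨y, hyW, hy0, hyb⟩ := exists_ne_zero_mem_forall_inner_eq_zero W
    (fun i : Finset.Ioi k => b i) (by rw [Fintype.card_coe, Fin.card_Ioi]; omega)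
  have hlower : s k * ‖y‖ ^ 2 ≤ inner ℝ y (S y) := by
    rw [inner_map_eq_sum_of_diagonal b hS, ← b.sum_sq_inner_right y, Finset.mul_sum]
    refine Finset.sum_le_sum fun i _ => ?_
    rw [real_inner_comm (b i), ← sq]
    rcases lt_or_ge k i with hi | hi
    · simp [hyb ⟨i, Finset.mem_Ioi.2 hi⟩]
    · exact mul_le_mul_of_nonneg_right (hs hi) (sq_nonneg _)
  have hclose := abs_le.1 (abs_inner_map_self_sub_le hST y)
  have hpos : 0 < ‖y‖ ^ 2 := by positivity
  exact le_of_mul_le_mul_right (by linarith [hW y hyW]) hpos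

end Weyl

theorem abs_inner_aeval_sub_le [Nontrivial E] (q : ℝ[X]) {S T : E →L[ℝ] E} (hS : ‖S‖ ≤ 1)
    (hT : ‖T‖ ≤ 1) {x y x' y' : E} (hy : ‖y‖ ≤ 1) (hx' : ‖x'‖ ≤ 1) {η : ℝ}
    (hST : ‖S - T‖ ≤ η) (hxx' : ‖x - x'‖ ≤ η) (hyy' : ‖y - y'‖ ≤ η) :
    |inner ℝ x (aeval S q y) - inner ℝ x' (aeval T q y')|
      ≤ (∑ i ∈ Finset.range (q.natDegree + 1), |q.coeff i| * (i + 2)) * η := by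
  have hqS := norm_aeval_le q hS
  have hqT := norm_aeval_le q hT
  have hqST := norm_aeval_sub_aeval_le q hS hT
  set K := ∑ i ∈ Finset.range (q.natDegree + 1), |q.coeff i|
  set L := ∑ i ∈ Finset.range (q.natDegree + 1), |q.coeff i| * i
  have _ : 0 ≤ K := Finset.sum_nonneg fun i _ => abs_nonneg _
  have _ : 0 ≤ L := Finset.sum_nonneg fun i _ => by positivity
  have hη : 0 ≤ η := (norm_nonneg _).trans hST
  have hsplit : inner ℝ x (aeval S q y) - inner ℝ x' (aeval T q y')
      = inner ℝ (x - x') (aeval S q y) + inner ℝ x' ((aeval S q - aeval T q) y)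
        + inner ℝ x' (aeval T q (y - y')) := by
    simp only [inner_sub_left, sub_apply, inner_sub_right, map_sub]
    ring
  have hconst : (∑ i ∈ Finset.range (q.natDegree + 1), |q.coeff i| * (i + 2)) * η
      = η * (K * 1) + 1 * (L * η * 1) + 1 * (K * η) := by
    simp only [mul_add, Finset.sum_add_distrib, ← Finset.sum_mul, K, L]
    ring
  rw [hsplit, hconst]
  refine (abs_add_three _ _ _).trans (add_le_add (add_le_add ?_ ?_) ?_) <;>
    refine (abs_real_inner_le_norm _ _).trans ?_
  · exact mul_le_mul hxx' (((aeval S q).le_of_opNorm_le hqS y).trans (by gcongr))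
      (norm_nonneg _) hη
  · exact mul_le_mul hx' (((aeval S q - aeval T q).le_of_opNorm_le
      (hqST.trans (by gcongr)) y).trans (by gcongr)) (norm_nonneg _) zero_le_one
  · exact mul_le_mul hx' (((aeval T q).le_of_opNorm_le hqT _).trans (by gcongr))
      (norm_nonneg _) zero_le_one

theorem abs_eigenvalue_le_opNorm {S : E →L[ℝ] E} {e : E} {r : ℝ} (he : ‖e‖ = 1)
    (hSe : S e = r • e) : |r| ≤ ‖S‖ := by
  have h := S.le_opNorm e
  rwa [hSe, norm_smul, he, mul_one, mul_one] at h

theorem mul_norm_sq_le_inner_map_of_mem_range {ι : Type*} [Fintype ι]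
    {b : OrthonormalBasis ι ℝ E} {p : ι → ℝ} {T : E →L[ℝ] E} {c : ℝ} (hc : 0 ≤ c)
    (hT : ∀ k, T (b k) = p k ^ 2 • b k) (hp : ∀ k, p k = 0 ∨ c ≤ p k) {y : E}
    (hy : y ∈ LinearMap.range T.toLinearMap) : c ^ 2 * ‖y‖ ^ 2 ≤ inner ℝ y (T y) := by
  obtain ⟨z, rfl⟩ := hy
  rw [inner_map_eq_sum_of_diagonal b hT, ← b.sum_sq_inner_right, Finset.mul_sum]
  refine Finset.sum_le_sum fun k _ => ?_
  rw [real_inner_comm (b k), ← sq]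
  rcases hp k with hzero | hck
  · have : inner ℝ (b k) (T z) = 0 := by rw [inner_map_of_diagonal b hT, hzero]; ring
    simp [this]
  · gcongr

theorem abs_sub_sq_mul_eval_le {ι : Type*} [Fintype ι] {b : OrthonormalBasis ι ℝ E} {p : ι → ℝ}
    {T : E →L[ℝ] E} {c : ℝ} {q : ℝ[X]} {ε : ℝ}
    (hlarge : ∀ x ∈ Set.Icc (c ^ 2 / 2) 1, |√x - x ^ 2 * q.eval x| ≤ ε * x ^ 2)
    (hT : ∀ k, T (b k) = p k ^ 2 • b k) (hc : 0 ≤ c) (hp : ∀ k, p k = 0 ∨ c ≤ p k)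
    (hT1 : ‖T‖ ≤ 1) (k : ι) :
    |p k - (p k ^ 2) ^ 2 * q.eval (p k ^ 2)| ≤ ε * (p k ^ 2) ^ 2 := by
  rcases hp k with hzero | hck
  · simp [hzero]
  · have hbelow := pow_le_pow_left₀ hc hck 2
    have habove := abs_le.1 ((abs_eigenvalue_le_opNorm (b.orthonormal.1 k) (hT k)).trans hT1)
    simpa [Real.sqrt_sq (hc.trans hck)] using
      hlarge _ ⟨by linarith [sq_nonneg c], habove.2⟩

section Truncation

variable [FiniteDimensional ℝ E] {m : ℕ} {b : OrthonormalBasis (Fin m) ℝ E} {s : Fin m → ℝ}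
  {ι : Type*} [Fintype ι] {b' : OrthonormalBasis ι ℝ E} {p : ι → ℝ} {S T : E →L[ℝ] E}
  {c η : ℝ}

theorem sub_le_eigenvalue_of_lt_finrank_range (hS : ∀ k, S (b k) = s k • b k) (hs : Antitone s)
    (hT : ∀ k, T (b' k) = p k ^ 2 • b' k) (hc : 0 ≤ c) (hp : ∀ k, p k = 0 ∨ c ≤ p k)
    (hST : ‖S - T‖ ≤ η) {k : Fin m}
    (hk : (k : ℕ) < Module.finrank ℝ (LinearMap.range T.toLinearMap)) : c ^ 2 - η ≤ s k :=
  sub_le_eigenvalue_of_norm_sub_le b hS hs hST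
    (fun _ hy => mul_norm_sq_le_inner_map_of_mem_range hc hT hp hy) hk

theorem eigenvalue_le_of_finrank_range_le (hS : ∀ k, S (b k) = s k • b k) (hs : Antitone s)
    (hST : ‖S - T‖ ≤ η) {k : Fin m}
    (hk : Module.finrank ℝ (LinearMap.range T.toLinearMap) ≤ k) : s k ≤ η := by
  have hrank := T.toLinearMap.finrank_range_add_finrank_ker
  rw [Module.finrank_eq_card_basis b.toBasis, Fintype.card_fin] at hrank
  have hker : ∀ y ∈ LinearMap.ker T.toLinearMap, inner ℝ y (T y) ≤ 0 * ‖y‖ ^ 2 := fun y hy => by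
    simp [show T y = 0 from hy]
  simpa using eigenvalue_le_add_of_norm_sub_le b hS hs hST hker (k := k) (by omega)

theorem abs_truncation_sub_sq_mul_eval_le {q : ℝ[X]} {ρ ε : ℝ}
    (hlarge : ∀ x ∈ Set.Icc (c ^ 2 / 2) 1, |√x - x ^ 2 * q.eval x| ≤ ε * x ^ 2)
    (hsmall : ∀ x ∈ Set.Icc 0 ρ, |q.eval x| ≤ ε) (hηρ : η ≤ ρ) (hηc : η ≤ c ^ 2 / 2)
    (hs0 : ∀ k, 0 ≤ s k) (hs : Antitone s) (hS : ∀ k, S (b k) = s k ^ 2 • b k)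
    (hT : ∀ k, T (b' k) = p k ^ 2 • b' k) (hc : 0 ≤ c) (hp : ∀ k, p k = 0 ∨ c ≤ p k)
    (hS1 : ‖S‖ ≤ 1) (hST : ‖S - T‖ ≤ η) (k : Fin m) :
    |(if (k : ℕ) < Module.finrank ℝ (LinearMap.range T.toLinearMap) then s k else 0)
      - (s k ^ 2) ^ 2 * q.eval (s k ^ 2)| ≤ ε * (s k ^ 2) ^ 2 := by
  have hs2 : Antitone fun k => s k ^ 2 := fun i j hij => pow_le_pow_left₀ (hs0 j) (hs hij) 2
  split_ifs with hk
  · have hbelow := sub_le_eigenvalue_of_lt_finrank_range hS hs2 hT hc hp hST hk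
    have habove := abs_le.1 ((abs_eigenvalue_le_opNorm (b.orthonormal.1 k) (hS k)).trans hS1)
    simpa [Real.sqrt_sq (hs0 k)] using hlarge _ ⟨by linarith, habove.2⟩
  · have hnear := eigenvalue_le_of_finrank_range_le hS hs2 hST (not_lt.1 hk)
    rw [zero_sub, abs_neg, abs_mul, abs_of_nonneg (sq_nonneg _), mul_comm]
    gcongr
    exact hsmall _ ⟨sq_nonneg _, hnear.trans hηρ⟩

end Truncation

/-- The factor `x ^ (3/2)` of the functional calculus is moved onto the vectors, so that only `S x`
and not `x` has to be bounded; what remains, `x ^ (-3/2)` away from zero, is replaced by a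
polynomial `q`. -/
theorem exists_abs_sum_truncation_sub_sum_le {c δ : ℝ} (hc : 0 < c) (hδ : 0 < δ) :
    ∃ η : ℝ, 0 < η ∧ ∀ {E : Type*} [NormedAddCommGroup E] [InnerProductSpace ℝ E]
      [FiniteDimensional ℝ E] [Nontrivial E] {m : ℕ} {ι : Type*} [Fintype ι]
      (b : OrthonormalBasis (Fin m) ℝ E) (b' : OrthonormalBasis ι ℝ E)
      {s : Fin m → ℝ} {p : ι → ℝ} {S T : E →L[ℝ] E}, Antitone s → (∀ k, 0 ≤ s k) →
      (∀ k, S (b k) = s k ^ 2 • b k) → (∀ k, T (b' k) = p k ^ 2 • b' k) →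
      (∀ k, p k = 0 ∨ c ≤ p k) → ‖S‖ ≤ 1 → ‖T‖ ≤ 1 → ‖S - T‖ ≤ η →
      ∀ {x y : E}, ‖S x‖ ≤ 1 → ‖T x‖ ≤ 1 → ‖S y‖ ≤ 1 → ‖T y‖ ≤ 1 →
      ‖S x - T x‖ ≤ η → ‖S y - T y‖ ≤ η →
      |∑ k : Fin m, (if (k : ℕ) < Module.finrank ℝ (LinearMap.range T.toLinearMap) then s k else 0)
          * (inner ℝ x (b k) * inner ℝ (b k) y)
        - ∑ k, p k * (inner ℝ x (b' k) * inner ℝ (b' k) y)| ≤ δ := by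
  have hε : 0 < δ / 4 := by positivity
  obtain ⟨q, ρ, hρ, hlarge, hsmall⟩ :=
    exists_polynomial_sqrt_near_sq_mul (a := c ^ 2 / 2) (by positivity) hε
  set K := ∑ i ∈ Finset.range (q.natDegree + 1), |q.coeff i| * ((i : ℝ) + 2)
  have hK : 0 ≤ K := Finset.sum_nonneg fun i _ => by positivity
  refine ⟨min (min ρ (c ^ 2 / 2)) (δ / (2 * (K + 1))), by positivity, ?_⟩
  intro E _ _ _ _ m ι _ b b' s p S T hs hs0 hS hT hp hS1 hT1 hST x y hSx hTx hSy hTy hx hy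
  set η := min (min ρ (c ^ 2 / 2)) (δ / (2 * (K + 1)))
  have hηρ : η ≤ ρ := (min_le_left _ _).trans (min_le_left _ _)
  have hηc : η ≤ c ^ 2 / 2 := (min_le_left _ _).trans (min_le_right _ _)
  have hKη : K * η ≤ δ / 2 :=
    calc K * η ≤ (K + 1) * (δ / (2 * (K + 1))) :=
          mul_le_mul (by linarith) (min_le_right _ _) ((norm_nonneg _).trans hST) (by linarith)
      _ = δ / 2 := by field_simp
  have hfirst := abs_sum_weights_sub_inner_aeval_le b hS
    (abs_truncation_sub_sq_mul_eval_le hlarge hsmall hηρ hηc hs0 hs hS hT hc.le hp hS1 hST)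
    hSx hSy hε.le
  have hsecond := abs_sum_weights_sub_inner_aeval_le b' hT
    (abs_sub_sq_mul_eval_le hlarge hT hc.le hp hT1) hTx hTy hε.le
  have hmiddle := (abs_inner_aeval_sub_le q hS1 hT1 hSy hTx hST hx hy).trans hKη
  rw [abs_le] at *
  constructor <;> linarith

end SpectralPerturbation

/-! ### Gram matrices and adjacency spectral embeddings -/

section ScaledUnitVectors

variable {V : Type*} [Fintype V] {n : ℕ}

theorem opNorm_le_of_norm_single_sqrt_le {F : Type*} [NormedAddCommGroup F] [NormedSpace ℝ F]
    (hn : 0 < n) (hV : Fintype.card V ≤ n) {L : EuclideanSpace ℝ V →L[ℝ] F} {r : ℝ} (hr : 0 ≤ r)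
    (hL : ∀ v, ‖L (EuclideanSpace.single v √n)‖ ≤ r) : ‖L‖ ≤ r := by
  have hsqrt : 0 < √(n : ℝ) := by positivity
  refine L.opNorm_le_bound hr fun x => ?_
  have hdecomp : L x = ∑ v, (x v / √n) • L (EuclideanSpace.single v √n) := by
    simp only [← map_smul, ← map_sum]
    congr 1
    ext u
    simp [Pi.single_apply, hsqrt.ne']
  have hsum : ∑ v, |x v| ≤ √n * ‖x‖ := by
    have := Real.sum_mul_le_sqrt_mul_sqrt Finset.univ (fun _ : V => (1 : ℝ)) fun v => |x v|
    simp only [one_mul, one_pow, Finset.sum_const, Finset.card_univ, nsmul_eq_mul, mul_one,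
      ← Real.norm_eq_abs, ← EuclideanSpace.norm_eq] at this
    exact this.trans (by gcongr)
  calc ‖L x‖ ≤ ∑ v, |x v| / √n * r := by
        rw [hdecomp]
        refine norm_sum_le_of_le _ fun v _ => ?_
        rw [norm_smul, Real.norm_eq_abs, abs_div, abs_of_pos hsqrt]
        gcongr
        exact hL v
    _ = r / √n * ∑ v, |x v| := by rw [Finset.mul_sum]; exact Finset.sum_congr rfl fun _ _ => by ring
    _ ≤ r / √n * (√n * ‖x‖) := by gcongr
    _ = r * ‖x‖ := by field_simp

theorem toEuclideanCLM_single_apply (Q : Matrix V V ℝ) (r : ℝ) (u v : V) :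
    Matrix.toEuclideanCLM (𝕜 := ℝ) Q (EuclideanSpace.single v r) u = r * Q u v := by
  rw [Matrix.ofLp_toEuclideanCLM, PiLp.ofLp_single, Matrix.mulVec_single]
  simp [mul_comm]

theorem norm_sq_toEuclideanCLM_single_sqrt (Q : Matrix V V ℝ) (v : V) :
    ‖Matrix.toEuclideanCLM (𝕜 := ℝ) Q (EuclideanSpace.single v √n)‖ ^ 2 = n * ∑ u, Q u v ^ 2 := by
  simp [EuclideanSpace.norm_sq_eq, toEuclideanCLM_single_apply, mul_pow, Finset.mul_sum]

theorem norm_toEuclideanCLM_single_sqrt_le_one (hV : Fintype.card V ≤ n) {Q : Matrix V V ℝ} {v : V}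
    (hQ : ∀ u, |Q u v| ≤ 1 / n) :
    ‖Matrix.toEuclideanCLM (𝕜 := ℝ) Q (EuclideanSpace.single v √n)‖ ≤ 1 := by
  rw [← sq_le_one_iff₀ (norm_nonneg _), norm_sq_toEuclideanCLM_single_sqrt]
  rcases n.eq_zero_or_pos with rfl | hn
  · simp
  calc (n : ℝ) * ∑ u, Q u v ^ 2 ≤ n * ∑ _u : V, (1 / n : ℝ) ^ 2 := by
        refine mul_le_mul_of_nonneg_left (Finset.sum_le_sum fun u _ => ?_) n.cast_nonneg
        exact sq_le_sq' (abs_le.1 (hQ u)).1 (abs_le.1 (hQ u)).2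
    _ = Fintype.card V / n := by
        rw [Finset.sum_const, Finset.card_univ, nsmul_eq_mul]; field_simp
    _ ≤ 1 := div_le_one_of_le₀ (by exact_mod_cast hV) n.cast_nonneg

theorem norm_sq_toEuclideanCLM_single_sqrt_le (hn : 0 < n) (hV : Fintype.card V ≤ n)
    {Q : Matrix V V ℝ} {v : V} {η : ℝ} (hdiag : |Q v v| ≤ 1 / n)
    (hoff : ∀ u, u ≠ v → |Q u v| ≤ η / n) :
    ‖Matrix.toEuclideanCLM (𝕜 := ℝ) Q (EuclideanSpace.single v √n)‖ ^ 2 ≤ η ^ 2 + 1 / n := by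
  have hentry : ∀ u, Q u v ^ 2 ≤ (η / n) ^ 2 + if u = v then (1 / n : ℝ) ^ 2 else 0 := fun u => by
    split_ifs with huv
    · rw [huv, ← sq_abs]
      linarith [pow_le_pow_left₀ (abs_nonneg _) hdiag 2, sq_nonneg (η / n)]
    · rw [add_zero, ← sq_abs]
      exact pow_le_pow_left₀ (abs_nonneg _) (hoff u huv) 2
  rw [norm_sq_toEuclideanCLM_single_sqrt]
  calc (n : ℝ) * ∑ u, Q u v ^ 2
      ≤ n * ∑ u, ((η / n) ^ 2 + if u = v then (1 / n : ℝ) ^ 2 else 0) := by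
        gcongr with u
        exact hentry u
    _ = Fintype.card V * η ^ 2 / n + 1 / n := by
        rw [Finset.sum_add_distrib, Finset.sum_const, Finset.card_univ, Finset.sum_ite_eq',
          if_pos (Finset.mem_univ v), nsmul_eq_mul]
        field_simp
    _ ≤ n * η ^ 2 / n + 1 / n := by gcongr
    _ = η ^ 2 + 1 / n := by field_simp

end ScaledUnitVectors

section Gram

open Matrix

theorem gram_eq_mul_transpose {V : Type*} {D : ℕ} (X : V → Euc D) :
    gram ℝ X = (of fun v j => X v j) * (of fun v j => X v j)ᵀ := by
  ext u v
  simp [gram, mul_apply, PiLp.inner_apply, mul_comm]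

variable {V : Type*} [Fintype V] {D : ℕ} (X : V → Euc D)

theorem rank_gram_mul_gram :
    (gram ℝ X * gram ℝ X).rank = Module.finrank ℝ (Submodule.span ℝ (Set.range X)) := by
  have htranspose : (gram ℝ X)ᵀ = gram ℝ X := isHermitian_gram ℝ X
  have hrow : Submodule.span ℝ (Set.range (of fun v j => X v j).row)
      = (Submodule.span ℝ (Set.range X)).map (WithLp.linearEquiv 2 ℝ (Fin D → ℝ)).toLinearMap := by
    rw [Submodule.map_span, ← Set.range_comp]
    rfl
  have hsquare : gram ℝ X * gram ℝ X = (gram ℝ X)ᵀ * gram ℝ X := by rw [htranspose]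
  rw [hsquare, rank_transpose_mul_self, gram_eq_mul_transpose, rank_self_mul_transpose,
    rank_eq_finrank_span_row, hrow]
  exact LinearEquiv.finrank_map_eq _ _

theorem le_eigenvalue_gram {c r : ℝ}
    (hcoer : ∀ x ∈ Submodule.span ℝ (Set.range X), c * ‖x‖ ^ 2 ≤ ∑ v, inner ℝ (X v) x ^ 2)
    {z : V → ℝ} (hz : z ≠ 0) (hr : 0 < r) (heig : gram ℝ X *ᵥ z = r • z) : c ≤ r := by
  set x := ∑ v, z v • X v
  have hinner : ∀ v, inner ℝ (X v) x = r * z v := fun v => by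
    rw [← smul_eq_mul, ← Pi.smul_apply, ← heig]
    simp [x, inner_sum, inner_smul_right, mulVec, dotProduct, mul_comm]
  have hnorm : ‖x‖ ^ 2 = r * ∑ v, z v ^ 2 := by
    rw [← real_inner_self_eq_norm_sq]
    nth_rw 1 [show x = ∑ v, z v • X v from rfl]
    simp only [sum_inner, real_inner_smul_left, hinner, Finset.mul_sum]
    exact Finset.sum_congr rfl fun v _ => by ring
  have hx := hcoer x (Submodule.sum_mem _ fun v _ =>
    Submodule.smul_mem _ _ (Submodule.subset_span ⟨v, rfl⟩))
  simp only [hinner, mul_pow, ← Finset.mul_sum, hnorm] at hx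
  obtain ⟨v, hv⟩ := Function.ne_iff.1 hz
  have hpos : 0 < ∑ v, z v ^ 2 :=
    Finset.sum_pos' (fun _ _ => sq_nonneg _) ⟨v, Finset.mem_univ v, sq_pos_of_ne_zero hv⟩
  refine le_of_mul_le_mul_right (a := r * ∑ v, z v ^ 2) ?_ (by positivity)
  linarith

theorem gram_mul_gram_apply_mem_Icc {n : ℕ} (hV : Fintype.card V ≤ n)
    (h01 : ∀ u v, inner ℝ (X u) (X v) ∈ Set.Icc (0 : ℝ) 1) (u v : V) :
    (gram ℝ X * gram ℝ X) u v ∈ Set.Icc (0 : ℝ) n := by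
  rw [mul_apply]
  refine ⟨Finset.sum_nonneg fun w _ => mul_nonneg (h01 u w).1 (h01 w v).1, ?_⟩
  calc ∑ w, gram ℝ X u w * gram ℝ X w v ≤ ∑ _w : V, (1 : ℝ) :=
        Finset.sum_le_sum fun w _ => mul_le_one₀ (h01 u w).2 (h01 w v).1 (h01 w v).2
    _ ≤ n := by simpa using hV

end Gram

section Embedding

open Matrix

theorem abs_inv_sq_smul_apply_le {V : Type*} {n : ℕ} {Q : Matrix V V ℝ} {r : ℝ} {u v : V}
    (hQ : |Q u v| ≤ r * n) :
    |(((n : ℝ) ^ 2)⁻¹ • Q) u v| ≤ r / n := by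
  rw [Matrix.smul_apply, smul_eq_mul, abs_mul, abs_of_nonneg (by positivity)]
  rcases n.eq_zero_or_pos with rfl | hn
  · simp
  · calc ((n : ℝ) ^ 2)⁻¹ * |Q u v| ≤ ((n : ℝ) ^ 2)⁻¹ * (r * n) := by gcongr
      _ = r / n := by field_simp

variable {V : Type*} [Fintype V] {n d : ℕ} {A : Matrix V V ℝ} {Xh : V → Euc d}

theorem sum_fin_dite_eq_sum_fin_ite {m d : ℕ} (f : Fin m → ℝ) :
    ∑ j : Fin d, (if h : (j : ℕ) < m then f ⟨j, h⟩ else 0)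
      = ∑ k : Fin m, if (k : ℕ) < d then f k else 0 := by
  set g : ℕ → ℝ := fun i => if h : i < m then f ⟨i, h⟩ else 0
  have hright : ∀ k : Fin m, (if (k : ℕ) < d then f k else 0) = if (k : ℕ) < d then g k else 0 :=
    fun k => by simp [g]
  simp only [hright]
  rw [Fin.sum_univ_eq_sum_range g, Fin.sum_univ_eq_sum_range fun i => if i < d then g i else 0,
    ← Finset.sum_filter]
  refine (Finset.sum_subset (fun i hi => ?_) fun i hid hi => ?_).symm
  · exact Finset.mem_range.2 (Finset.mem_filter.1 hi).2
  · simp only [Finset.mem_filter, Finset.mem_range, not_and] at hi hid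
    exact dif_neg fun him => hi him hid

theorem IsASE.exists_inner_eq_sum (hA : IsASE A Xh) (hn : 0 < n) :
    ∃ (b : OrthonormalBasis (Fin (Fintype.card V)) ℝ (EuclideanSpace ℝ V))
      (s : Fin (Fintype.card V) → ℝ), Antitone s ∧ (∀ k, 0 ≤ s k) ∧
      (∀ k, toEuclideanCLM (𝕜 := ℝ) (((n : ℝ) ^ 2)⁻¹ • (Aᵀ * A)) (b k) = s k ^ 2 • b k) ∧
      ∀ u v, inner ℝ (Xh u) (Xh v) = ∑ k : Fin (Fintype.card V), (if (k : ℕ) < d then s k else 0)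
        * (inner ℝ (EuclideanSpace.single u √n) (b k)
          * inner ℝ (b k) (EuclideanSpace.single v √n)) := by
  obtain ⟨M, hM, hMM, b, s, hs, hb, hXh⟩ := hA
  have hMb : ∀ k, toEuclideanCLM (𝕜 := ℝ) M (b k) = s k • b k := fun k => by
    ext v
    exact hb k v
  have hs0 : ∀ k, 0 ≤ s k := fun k => by
    have hnonneg := hM.dotProduct_mulVec_nonneg (b k)
    have hinner := inner_toEuclideanCLM M (b k) (b k)
    rw [hMb, real_inner_smul_right, real_inner_self_eq_norm_sq, b.orthonormal.1 k, one_pow,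
      mul_one] at hinner
    rwa [hinner]
  refine ⟨b, fun k => (n : ℝ)⁻¹ * s k, fun i j hij => mul_le_mul_of_nonneg_left (hs hij) (by simp),
    fun k => mul_nonneg (by simp) (hs0 k), fun k => ?_, fun u v => ?_⟩
  · rw [← hMM, map_smul, map_mul, _root_.smul_apply, mul_apply_eq_comp, hMb, map_smul, hMb,
      smul_smul, smul_smul]
    congr 1
    ring
  · have hterm : ∀ k, √(s k) * b k u * (√(s k) * b k v) = s k * (b k u * b k v) := fun k => by
      calc _ = √(s k) * √(s k) * (b k u * b k v) := by ring
        _ = _ := by rw [Real.mul_self_sqrt (hs0 k)]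
    have hrows : inner ℝ (Xh u) (Xh v) = ∑ j : Fin d, if h : (j : ℕ) < Fintype.card V then
        s ⟨j, h⟩ * (b ⟨j, h⟩ u * b ⟨j, h⟩ v) else 0 := by
      rw [PiLp.inner_apply]
      refine Finset.sum_congr rfl fun j _ => ?_
      rw [hXh, hXh]
      split_ifs with h
      · rw [← hterm, RCLike.inner_apply, conj_trivial, mul_comm]
      · simp
    rw [hrows, sum_fin_dite_eq_sum_fin_ite fun k => s k * (b k u * b k v)]
    refine Finset.sum_congr rfl fun k _ => ?_
    have hsqrt : √(n : ℝ) * √(n : ℝ) = n := Real.mul_self_sqrt n.cast_nonneg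
    split_ifs
    · simp only [EuclideanSpace.inner_single_left, EuclideanSpace.inner_single_right, conj_trivial]
      calc s k * (b k u * b k v)
          = √(n : ℝ) * √(n : ℝ) * (n : ℝ)⁻¹ * s k * (b k u * b k v) := by rw [hsqrt]; field_simp
        _ = _ := by ring
    · simp

theorem exists_diagonal_gram {D : ℕ} {X : V → Euc D} {c : ℝ} (hn : 0 < n)
    (hcoer : ∀ x ∈ Submodule.span ℝ (Set.range X), c * n * ‖x‖ ^ 2 ≤ ∑ v, inner ℝ (X v) x ^ 2) :
    ∃ (b : OrthonormalBasis V ℝ (EuclideanSpace ℝ V)) (p : V → ℝ), (∀ k, p k = 0 ∨ c ≤ p k) ∧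
      (∀ k, toEuclideanCLM (𝕜 := ℝ) (((n : ℝ) ^ 2)⁻¹ • (gram ℝ X * gram ℝ X)) (b k)
        = p k ^ 2 • b k) ∧
      ∀ u v, ∑ k, p k * (inner ℝ (EuclideanSpace.single u √n) (b k)
        * inner ℝ (b k) (EuclideanSpace.single v √n)) = inner ℝ (X u) (X v) := by
  have hpos : (0 : ℝ) < n := by exact_mod_cast hn
  have hG := isHermitian_gram ℝ X
  set b := hG.eigenvectorBasis
  have hGb : ∀ k, toEuclideanCLM (𝕜 := ℝ) (gram ℝ X) (b k) = hG.eigenvalues k • b k := fun k =>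
    WithLp.ofLp_injective 2 (hG.mulVec_eigenvectorBasis k)
  refine ⟨b, fun k => (n : ℝ)⁻¹ * hG.eigenvalues k, fun k => ?_, fun k => ?_, fun u v => ?_⟩
  · rcases ((posSemidef_gram ℝ X).eigenvalues_nonneg k).eq_or_lt with hzero | hk
    · exact Or.inl (mul_eq_zero_of_right _ hzero.symm)
    · right
      have hb0 : (b k).ofLp ≠ 0 := fun h =>
        b.orthonormal.ne_zero k (WithLp.ofLp_injective 2 (by simpa using h))
      rw [le_inv_mul_iff₀ hpos, mul_comm]
      exact le_eigenvalue_gram X hcoer hb0 hk (hG.mulVec_eigenvectorBasis k)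
  · rw [map_smul, map_mul, _root_.smul_apply, mul_apply_eq_comp, hGb, map_smul, hGb, smul_smul,
      smul_smul]
    congr 1
    ring
  · have hscaled : ∀ k, ((n : ℝ)⁻¹ • toEuclideanCLM (𝕜 := ℝ) (gram ℝ X)) (b k)
        = ((n : ℝ)⁻¹ * hG.eigenvalues k) • b k := fun k => by
      rw [_root_.smul_apply, hGb, smul_smul]
    have hsqrt : √(n : ℝ) * √(n : ℝ) = n := Real.mul_self_sqrt n.cast_nonneg
    rw [← inner_map_eq_sum_of_diagonal b hscaled, _root_.smul_apply, real_inner_smul_right,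
      EuclideanSpace.inner_single_left, toEuclideanCLM_single_apply, conj_trivial, gram_apply]
    calc (n : ℝ)⁻¹ * (√n * (√n * inner ℝ (X u) (X v)))
        = (n : ℝ)⁻¹ * (√n * √n) * inner ℝ (X u) (X v) := by ring
      _ = inner ℝ (X u) (X v) := by rw [hsqrt]; field_simp

theorem finrank_range_toEuclideanCLM_smul {Q : Matrix V V ℝ} {r : ℝ} (hr : r ≠ 0) :
    Module.finrank ℝ (LinearMap.range (toEuclideanCLM (𝕜 := ℝ) (r • Q)).toLinearMap)
      = Q.rank := by
  rw [← rank_smul_of_mem_nonZeroDivisors Q (mem_nonZeroDivisors_of_ne_zero hr),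
    coe_toEuclideanCLM_eq_toEuclideanLin, toEuclideanLin_eq_toLin_orthonormal,
    ← rank_eq_finrank_range_toLin]

theorem norm_normalized_single_le_one (hV : Fintype.card V ≤ n) {Q : Matrix V V ℝ}
    (hQ : ∀ u v, Q u v ∈ Set.Icc (0 : ℝ) n) (v : V) :
    ‖toEuclideanCLM (𝕜 := ℝ) (((n : ℝ) ^ 2)⁻¹ • Q) (EuclideanSpace.single v √n)‖ ≤ 1 :=
  norm_toEuclideanCLM_single_sqrt_le_one hV fun u =>
    abs_inv_sq_smul_apply_le (by rw [one_mul, abs_of_nonneg (hQ u v).1]; exact (hQ u v).2)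

theorem norm_normalized_sub_single_le (hn : 0 < n) (hV : Fintype.card V ≤ n)
    {Q P : Matrix V V ℝ} {η ε : ℝ} (hε : 0 ≤ ε) (hη : η ^ 2 + 1 / n ≤ ε ^ 2)
    (hQ : ∀ u v, Q u v ∈ Set.Icc (0 : ℝ) n) (hP : ∀ u v, P u v ∈ Set.Icc (0 : ℝ) n)
    (hoff : ∀ u v, u ≠ v → |Q u v - P u v| ≤ η * n) (v : V) :
    ‖(toEuclideanCLM (𝕜 := ℝ) (((n : ℝ) ^ 2)⁻¹ • Q) - toEuclideanCLM (𝕜 := ℝ)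
      (((n : ℝ) ^ 2)⁻¹ • P)) (EuclideanSpace.single v √n)‖ ≤ ε := by
  rw [← map_sub, ← smul_sub, ← pow_le_pow_iff_left₀ (norm_nonneg _) hε two_ne_zero]
  refine (norm_sq_toEuclideanCLM_single_sqrt_le hn hV (abs_inv_sq_smul_apply_le ?_)
    fun u huv => abs_inv_sq_smul_apply_le (hoff u v huv)).trans hη
  rw [Matrix.sub_apply, one_mul, abs_le]
  constructor <;> linarith [(hQ v v).1, (hQ v v).2, (hP v v).1, (hP v v).2]

/-- The codegrees of the graph and of the latent Gram matrix, normalised by `n ^ 2`, are close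
as operators, and on the vectors `√n • e_v` as well. The truncated square root of the former is
`|A| / n` cut off at rank `d`, that of the latter is the Gram matrix over `n`. -/
theorem exists_abs_inner_ase_sub_le {c δ : ℝ} (hc : 0 < c) (hδ : 0 < δ) :
    ∃ η : ℝ, 0 < η ∧ ∀ {V : Type*} [Fintype V] {n D d : ℕ} {A : Matrix V V ℝ} {X : V → Euc D}
      {Xh : V → Euc d}, IsASE A Xh → Fintype.card V ≤ n → 1 ≤ η * n →
      (∀ u v, inner ℝ (X u) (X v) ∈ Set.Icc (0 : ℝ) 1) →
      d = Module.finrank ℝ (Submodule.span ℝ (Set.range X)) →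
      (∀ x ∈ Submodule.span ℝ (Set.range X), c * n * ‖x‖ ^ 2 ≤ ∑ v, inner ℝ (X v) x ^ 2) →
      (∀ u v, (Aᵀ * A) u v ∈ Set.Icc (0 : ℝ) n) →
      (∀ u v, u ≠ v →
        |(Aᵀ * A) u v - ∑ w, inner ℝ (X u) (X w) * inner ℝ (X w) (X v)| ≤ η * n) →
      ∀ u v, |inner ℝ (Xh u) (Xh v) - inner ℝ (X u) (X v)| ≤ δ := by
  obtain ⟨ε, hε, hclose⟩ := exists_abs_sum_truncation_sub_sum_le hc hδ
  refine ⟨min 1 (ε ^ 2 / 2), by positivity, ?_⟩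
  intro V _ n D d A X Xh hA hV hηn h01 hd hcoer hAA hoff u v
  set η := min 1 (ε ^ 2 / 2)
  have hn : 0 < n := Nat.pos_of_ne_zero fun h => by norm_num [h] at hηn
  have hpos : (0 : ℝ) < n := by exact_mod_cast hn
  have hη : η ^ 2 + 1 / n ≤ ε ^ 2 := by
    have hη0 : 0 ≤ η := by positivity
    have hη1 : η ^ 2 ≤ η := pow_le_of_le_one hη0 (min_le_left _ _) two_ne_zero
    have hinv : 1 / (n : ℝ) ≤ η := (div_le_iff₀ hpos).2 hηn
    linarith [min_le_right 1 (ε ^ 2 / 2)]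
  have : Nonempty V := ⟨u⟩
  have hGG := gram_mul_gram_apply_mem_Icc X hV h01
  have hScol := norm_normalized_single_le_one hV hAA
  have hTcol := norm_normalized_single_le_one hV hGG
  have hSTcol := norm_normalized_sub_single_le hn hV hε.le hη hAA hGG hoff
  have hopNorm := @opNorm_le_of_norm_single_sqrt_le V _ n (EuclideanSpace ℝ V) _ _ hn hV
  obtain ⟨b, s, hs, hs0, hSb, hXh⟩ := hA.exists_inner_eq_sum hn
  obtain ⟨b', p, hp, hTb', hX⟩ := exists_diagonal_gram hn hcoer
  have hrank := (finrank_range_toEuclideanCLM_smul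
    (inv_ne_zero (pow_ne_zero 2 hpos.ne'))).trans (rank_gram_mul_gram X)
  have hbound := hclose b b' hs hs0 hSb hTb' hp (hopNorm zero_le_one hScol)
    (hopNorm zero_le_one hTcol) (hopNorm hε.le hSTcol) (hScol u) (hTcol u) (hScol v) (hTcol v)
    (hSTcol u) (hSTcol v)
  rwa [hrank, ← hd, ← hXh, hX] at hbound

end Embedding

/-! ### Seeded clustering -/

section Clustering

variable {V : Type*} {d R : ℕ} {Xh : V → Euc d} {comp : V → Fin R} {θ : ℝ}

/-- The threshold `θ` separates the inner products of rows `Xh u`, `Xh v` from one component from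
those of rows from different components, `comp v` being the component of `v`. -/
def IsAffinityThreshold (Xh : V → Euc d) (comp : V → Fin R) (θ : ℝ) : Prop :=
  ∀ u v, (comp u = comp v → θ < inner ℝ (Xh u) (Xh v)) ∧
    (comp u ≠ comp v → inner ℝ (Xh u) (Xh v) < θ)

theorem IsAffinityThreshold.comp_eq_of_inner_le (hθ : IsAffinityThreshold Xh comp θ)
    {u v u' v' : V} (huv : comp u = comp v)
    (hle : inner ℝ (Xh u) (Xh v) ≤ inner ℝ (Xh u') (Xh v')) : comp u' = comp v' := by
  by_contra hne
  exact absurd (((hθ u v).1 huv).trans_le hle) ((hθ u' v').2 hne).le.not_gt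

theorem IsAffinityThreshold.surjective_comp_seeds (hθ : IsAffinityThreshold Xh comp θ)
    {s : Fin R → V} {y z : Fin R} (hne : comp (s y) ≠ comp (s z))
    (hmax : ∀ y' z' : Fin R, y' ≠ z' →
      inner ℝ (Xh (s y')) (Xh (s z')) ≤ inner ℝ (Xh (s y)) (Xh (s z))) :
    Function.Surjective fun i => comp (s i) :=
  Finite.surjective_of_injective fun i j hij => by
    by_contra hij'
    exact hne (hθ.comp_eq_of_inner_le hij (hmax i j hij'))

theorem SeedStep.insert_range_comp_subset (hθ : IsAffinityThreshold Xh comp θ) {v : V}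
    {s s' : Fin R → V} (hstep : SeedStep Xh v s s') :
    insert (comp v) (Set.range fun i => comp (s i)) ⊆ Set.range fun i => comp (s' i) := by
  obtain ⟨y, z, hyz, hmax, ⟨hle, rfl⟩ | ⟨⟨x, hx⟩, rfl⟩⟩ := hstep
  · have hsame : comp (s y) = comp (s z) := by
      by_contra hne
      obtain ⟨x, hx⟩ := hθ.surjective_comp_seeds hne hmax (comp v)
      exact hne (hθ.comp_eq_of_inner_le hx.symm (hle x))
    refine Set.insert_subset ⟨z, by simp⟩ (Set.range_subset_iff.2 fun i => ?_)
    rcases eq_or_ne i z with rfl | hi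
    · exact ⟨y, by simp [hyz, hsame]⟩
    · exact ⟨i, by simp [hi]⟩
  · refine Set.insert_subset ?_ le_rfl
    by_cases hsame : comp (s' y) = comp (s' z)
    · exact ⟨x, (hθ.comp_eq_of_inner_le hsame hx).symm⟩
    · exact hθ.surjective_comp_seeds hsame hmax (comp v)

theorem SeedRun.range_comp_subset (hθ : IsAffinityThreshold Xh comp θ) {l : List V}
    {s s' : Fin R → V} (hrun : SeedRun Xh l s s') :
    (Set.range fun i => comp (s i)) ⊆ Set.range fun i => comp (s' i) := by
  induction hrun with
  | nil => exact le_rfl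
  | cons hstep _ ih =>
    exact (Set.subset_insert _ _).trans ((hstep.insert_range_comp_subset hθ).trans ih)

theorem SeedRun.comp_mem_range (hθ : IsAffinityThreshold Xh comp θ) {l : List V}
    {s s' : Fin R → V} (hrun : SeedRun Xh l s s') {v : V} (hv : v ∈ l) :
    comp v ∈ Set.range fun i => comp (s' i) := by
  induction hrun with
  | nil => simp at hv
  | cons hstep hrun ih =>
    rcases List.mem_cons.1 hv with rfl | hv
    · exact hrun.range_comp_subset hθ (hstep.insert_range_comp_subset hθ (Set.mem_insert _ _))
    · exact ih hv

theorem SeededClustering.exact_recovery [Fintype V] (hθ : IsAffinityThreshold Xh comp θ)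
    (hcomp : Function.Surjective comp) {C : Fin R → Finset V} (hC : SeededClustering Xh C) :
    ∃ e : Equiv.Perm (Fin R), ∀ r, C (e r) = Finset.univ.filter fun v => comp v = r := by
  obtain ⟨l, -, hl, s₀, s, hrun, τ, hτ, hCs⟩ := hC
  have hsurj : Function.Surjective fun j => comp (s j) := fun r => by
    obtain ⟨v, rfl⟩ := hcomp r
    exact hrun.comp_mem_range hθ (hl v)
  have hbij : Function.Bijective fun j => comp (s j) :=
    ⟨Finite.injective_iff_surjective.2 hsurj, hsurj⟩
  have hcompτ : ∀ v, comp (s (τ v)) = comp v := fun v => by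
    obtain ⟨j, hj⟩ := hsurj (comp v)
    exact (hθ.comp_eq_of_inner_le hj.symm (hτ v j)).symm
  set e := (Equiv.ofBijective _ hbij).symm
  have he : ∀ r, comp (s (e r)) = r := (Equiv.ofBijective _ hbij).apply_symm_apply
  refine ⟨e, fun r => Finset.ext fun v => ?_⟩
  simp only [hCs, Finset.mem_insert, Finset.mem_filter, Finset.mem_univ, true_and]
  constructor
  · rintro (rfl | hv)
    · exact he r
    · rw [← hcompτ, hv, he]
  · intro hv
    refine Or.inr (hbij.1 ?_)
    simp only [hcompτ, he, hv]

end Clustering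

/-! ### Reconstruction from Gram matrices -/

section Procrustes

variable {K E : Type*} [NormedAddCommGroup E] [InnerProductSpace ℝ E]

theorem norm_linearCombination_eq_of_inner_eq {x y : K → E}
    (h : ∀ i j, inner ℝ (y i) (y j) = inner ℝ (x i) (x j)) (a : K →₀ ℝ) :
    ‖Finsupp.linearCombination ℝ y a‖ = ‖Finsupp.linearCombination ℝ x a‖ := by
  rw [← sq_eq_sq₀ (norm_nonneg _) (norm_nonneg _), ← real_inner_self_eq_norm_sq,
    ← real_inner_self_eq_norm_sq]
  simp only [Finsupp.linearCombination_apply, Finsupp.sum, sum_inner, inner_sum, inner_smul_left,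
    inner_smul_right, h]

theorem exists_linearIsometryEquiv_of_inner_eq [FiniteDimensional ℝ E] {x y : K → E}
    (h : ∀ i j, inner ℝ (y i) (y j) = inner ℝ (x i) (x j)) :
    ∃ O : E ≃ₗᵢ[ℝ] E, ∀ i, O (x i) = y i := by
  set Tx := Finsupp.linearCombination ℝ x
  set Ty := Finsupp.linearCombination ℝ y
  have hnorm : ∀ a, ‖Ty a‖ = ‖Tx a‖ := norm_linearCombination_eq_of_inner_eq h
  obtain ⟨g, hg⟩ :=
    Tx.rangeRestrict.exists_rightInverse_of_surjective (LinearMap.range_rangeRestrict _)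
  have hTxg : ∀ z, Tx (g z) = z := fun z => congrArg Subtype.val (LinearMap.congr_fun hg z)
  let L : LinearMap.range Tx →ₗᵢ[ℝ] E :=
    { toLinearMap := Ty.comp g
      norm_map' := fun z => by rw [LinearMap.comp_apply, hnorm, hTxg, Submodule.coe_norm] }
  have hL : ∀ a, L ⟨Tx a, a, rfl⟩ = Ty a := fun a => by
    change Ty (g _) = Ty a
    rw [← sub_eq_zero, ← map_sub, ← norm_eq_zero, hnorm, map_sub, hTxg, sub_self, norm_zero]
  refine ⟨L.extend.toLinearIsometryEquiv rfl, fun i => ?_⟩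
  have hsingle : ∀ z : K → E, Finsupp.linearCombination ℝ z (Finsupp.single i 1) = z i :=
    fun z => by rw [Finsupp.linearCombination_single, one_smul]
  calc L.extend.toLinearIsometryEquiv rfl (x i) = L.extend (Tx (Finsupp.single i 1)) := by
        rw [hsingle, LinearIsometry.coe_toLinearIsometryEquiv]
    _ = Ty (Finsupp.single i 1) := (L.extend_apply ⟨_, _, rfl⟩).trans (hL _)
    _ = y i := hsingle y

theorem exists_linearIsometryEquiv_tendsto_of_tendsto_inner [Finite K] [FiniteDimensional ℝ E]
    {x : K → E} {y : ℕ → K → E}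
    (h : ∀ i j, Filter.Tendsto (fun m => inner ℝ (y m i) (y m j)) Filter.atTop
      (nhds (inner ℝ (x i) (x j)))) :
    ∃ (O : E ≃ₗᵢ[ℝ] E) (φ : ℕ → ℕ), StrictMono φ ∧
      ∀ i, Filter.Tendsto (fun m => y (φ m) i) Filter.atTop (nhds (O (x i))) := by
  have := Fintype.ofFinite K
  have hnorm : ∀ i, Filter.Tendsto (fun m => ‖y m i‖) Filter.atTop (nhds ‖x i‖) := fun i => by
    simpa only [← norm_eq_sqrt_real_inner] using (h i i).sqrt
  choose B hB using fun i => (hnorm i).bddAbove_range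
  have hbounded : Bornology.IsBounded (Set.pi Set.univ fun i => Metric.closedBall (0 : E) (B i)) :=
    Bornology.IsBounded.pi fun i => Metric.isBounded_closedBall
  obtain ⟨z, -, φ, hφ, hz⟩ := tendsto_subseq_of_bounded hbounded (x := y) fun m i _ =>
    mem_closedBall_zero_iff.2 (hB i ⟨m, rfl⟩)
  have hzi : ∀ i, Filter.Tendsto (fun m => y (φ m) i) Filter.atTop (nhds (z i)) :=
    tendsto_pi_nhds.1 hz
  obtain ⟨O, hO⟩ := exists_linearIsometryEquiv_of_inner_eq fun i j =>
    tendsto_nhds_unique ((hzi i).inner (hzi j)) ((h i j).comp hφ.tendsto_atTop)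
  exact ⟨O, φ, hφ, fun i => (hO i).symm ▸ hzi i⟩

theorem exists_linearIsometryEquiv_norm_sub_le [Finite K] [FiniteDimensional ℝ E] (x : K → E)
    {ε : ℝ} (hε : 0 < ε) :
    ∃ δ : ℝ, 0 < δ ∧ ∀ y : K → E,
      (∀ i j, |inner ℝ (y i) (y j) - inner ℝ (x i) (x j)| ≤ δ) →
      ∃ O : E ≃ₗᵢ[ℝ] E, ∀ i, ‖y i - O (x i)‖ ≤ ε := by
  by_contra! hcon
  choose y hy hfar using fun m : ℕ => hcon (1 / ((m : ℝ) + 1)) (by positivity)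
  obtain ⟨O, φ, -, hφ⟩ := exists_linearIsometryEquiv_tendsto_of_tendsto_inner fun i j =>
    tendsto_iff_norm_sub_tendsto_zero.2 <| squeeze_zero (fun _ => norm_nonneg _)
      (fun m => hy m i j) tendsto_one_div_add_atTop_nhds_zero_nat
  have hclose : ∀ᶠ m in Filter.atTop, ∀ i, ‖y (φ m) i - O (x i)‖ < ε :=
    Filter.eventually_all.2 fun i =>
      (tendsto_iff_norm_sub_tendsto_zero.1 (hφ i)).eventually (gt_mem_nhds hε)
  obtain ⟨m, hm⟩ := hclose.exists
  obtain ⟨i, hi⟩ := hfar (φ m) O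
  exact (hm i).not_gt hi

theorem norm_sub_sq_le_of_abs_inner_sub_le {u v w : E} {δ : ℝ}
    (huu : |inner ℝ u u - inner ℝ w w| ≤ δ) (huv : |inner ℝ u v - inner ℝ w w| ≤ δ)
    (hvv : |inner ℝ v v - inner ℝ w w| ≤ δ) : ‖u - v‖ ^ 2 ≤ 4 * δ := by
  rw [norm_sub_sq_real, ← real_inner_self_eq_norm_sq, ← real_inner_self_eq_norm_sq]
  linarith [(abs_le.1 huu).2, (abs_le.1 huv).1, (abs_le.1 hvv).2]

theorem exists_linearIsometryEquiv_norm_sub_comp_le [Finite K] [FiniteDimensional ℝ E]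
    (x : K → E) {ε : ℝ} (hε : 0 < ε) :
    ∃ δ : ℝ, 0 < δ ∧ ∀ {V : Type*} {k : V → K}, Function.Surjective k → ∀ {y : V → E},
      (∀ u v, |inner ℝ (y u) (y v) - inner ℝ (x (k u)) (x (k v))| ≤ δ) →
      ∃ O : E ≃ₗᵢ[ℝ] E, ∀ v, ‖y v - O (x (k v))‖ ≤ ε := by
  obtain ⟨δ, hδ, h⟩ := exists_linearIsometryEquiv_norm_sub_le x (half_pos hε)
  refine ⟨min δ (ε ^ 2 / 16), by positivity, fun {V k} hk {y} hy => ?_⟩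
  obtain ⟨r, hr⟩ := hk.hasRightInverse
  obtain ⟨O, hO⟩ := h (fun i => y (r i)) fun i j => by
    simpa only [hr _] using (hy (r i) (r j)).trans (min_le_left _ _)
  refine ⟨O, fun v => ?_⟩
  have hsame : ‖y v - y (r (k v))‖ ≤ ε / 2 := by
    rw [← pow_le_pow_iff_left₀ (norm_nonneg _) (by positivity) two_ne_zero]
    have hle := fun u w => (hy u w).trans (min_le_right δ (ε ^ 2 / 16))
    refine (norm_sub_sq_le_of_abs_inner_sub_le (hle v v) ?_ ?_).trans_eq (by ring)
    · simpa only [hr _] using hle v (r (k v))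
    · simpa only [hr _] using hle (r (k v)) (r (k v))
  calc ‖y v - O (x (k v))‖ ≤ ‖y v - y (r (k v))‖ + ‖y (r (k v)) - O (x (k v))‖ :=
        norm_sub_le_norm_sub_add_norm_sub _ _ _
    _ ≤ ε / 2 + ε / 2 := add_le_add hsame (hO (k v))
    _ = ε := add_halves ε

theorem inner_pad {d D : ℕ} (hd : d ≤ D) (x y : Euc d) :
    inner ℝ (pad D x) (pad D y) = inner ℝ x y := by
  calc inner ℝ (pad D x) (pad D y)
      = ∑ j : Fin D, if h : (j : ℕ) < d then inner ℝ (x ⟨j, h⟩) (y ⟨j, h⟩) else 0 := by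
        rw [PiLp.inner_apply]
        refine Finset.sum_congr rfl fun j _ => ?_
        by_cases h : (j : ℕ) < d <;> simp [pad, h]
    _ = ∑ k : Fin d, if (k : ℕ) < D then inner ℝ (x k) (y k) else 0 :=
        sum_fin_dite_eq_sum_fin_ite fun k => inner ℝ (x k) (y k)
    _ = inner ℝ x y := by
        rw [PiLp.inner_apply]
        exact Finset.sum_congr rfl fun k _ => if_pos (k.isLt.trans_le hd)

end Procrustes

/-! ### The test statistic -/

section TestStatistic

theorem lipschitzWith_exp_neg_sq : LipschitzWith 1 fun t : ℝ => Real.exp (-t ^ 2) := by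
  have hderiv : ∀ t : ℝ, HasDerivAt (fun t : ℝ => Real.exp (-t ^ 2))
      (Real.exp (-t ^ 2) * -(2 * t)) t := fun t => by
    simpa using ((hasDerivAt_pow 2 t).neg).exp
  refine lipschitzWith_of_nnnorm_deriv_le (fun t => (hderiv t).differentiableAt) fun t => ?_
  have hamgm : |2 * t| ≤ t ^ 2 + 1 := by
    rw [abs_le]
    constructor <;> nlinarith [sq_nonneg (t - 1), sq_nonneg (t + 1)]
  rw [← NNReal.coe_le_coe, coe_nnnorm, NNReal.coe_one, (hderiv t).deriv, Real.norm_eq_abs, abs_mul,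
    abs_neg, Real.abs_exp, Real.exp_neg, inv_mul_le_one₀ (Real.exp_pos _)]
  exact hamgm.trans (Real.add_one_le_exp _)

variable {D : ℕ} {σ : ℝ}

theorem rbf_nonneg (x y : Euc D) : 0 ≤ rbf σ x y := (Real.exp_pos _).le

theorem rbf_le_one (x y : Euc D) : rbf σ x y ≤ 1 := by
  rw [rbf, Real.exp_le_one_iff, neg_div, neg_nonpos]
  positivity

theorem rbf_map (W : Euc D ≃ₗᵢ[ℝ] Euc D) (x y : Euc D) : rbf σ (W x) (W y) = rbf σ x y := by
  rw [rbf, rbf, ← map_sub, W.norm_map]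

theorem abs_rbf_sub_rbf_le (hσ : 0 < σ) {x y x' y' : Euc D} {ε : ℝ} (hx : ‖x - x'‖ ≤ ε)
    (hy : ‖y - y'‖ ≤ ε) : |rbf σ x y - rbf σ x' y'| ≤ 2 / σ * ε := by
  have hexp : ∀ u v : Euc D, rbf σ u v = Real.exp (-(‖u - v‖ / σ) ^ 2) := fun u v => by
    rw [rbf, div_pow, neg_div]
  have hlip := lipschitzWith_exp_neg_sq.dist_le_mul (‖x - y‖ / σ) (‖x' - y'‖ / σ)
  rw [Real.dist_eq, Real.dist_eq, ← hexp, ← hexp, NNReal.coe_one, one_mul, ← sub_div, abs_div,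
    abs_of_pos hσ] at hlip
  have hnorm : |‖x - y‖ - ‖x' - y'‖| ≤ 2 * ε :=
    calc |‖x - y‖ - ‖x' - y'‖| ≤ ‖x - y - (x' - y')‖ := abs_norm_sub_norm_le _ _
      _ = ‖x - x' - (y - y')‖ := by rw [sub_sub_sub_comm]
      _ ≤ ‖x - x'‖ + ‖y - y'‖ := norm_sub_le _ _
      _ ≤ 2 * ε := by linarith
  calc |rbf σ x y - rbf σ x' y'| ≤ |‖x - y‖ - ‖x' - y'‖| / σ := hlip
    _ ≤ 2 * ε / σ := by gcongr
    _ = 2 / σ * ε := by ring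

variable {U V : Type*} [Fintype U] [Fintype V]

theorem card_mul_card_sub_one_nonneg : (0 : ℝ) ≤ (Fintype.card U : ℝ) * (Fintype.card U - 1) := by
  rcases (Fintype.card U).eq_zero_or_pos with h | h
  · simp [h]
  · have : (1 : ℝ) ≤ Fintype.card U := by exact_mod_cast h
    exact mul_nonneg (by linarith) (by linarith)

theorem sum_sum_ne_const (ρ : ℝ) :
    ∑ i : U, ∑ j : U, (if j ≠ i then ρ else 0)
      = (Fintype.card U : ℝ) * (Fintype.card U - 1) * ρ := by
  have hrow : ∀ i : U, ∑ j : U, (if j ≠ i then ρ else 0) = (Fintype.card U - 1) * ρ := fun i => by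
    have hcompl : ∀ j : U, (if j ≠ i then ρ else 0) = ρ - if j = i then ρ else 0 := fun j => by
      split_ifs <;> simp_all
    simp only [hcompl, Finset.sum_sub_distrib, Finset.sum_ite_eq', Finset.mem_univ, if_true,
      Finset.sum_const, Finset.card_univ, nsmul_eq_mul]
    ring
  simp only [hrow, Finset.sum_const, Finset.card_univ, nsmul_eq_mul, mul_assoc]

theorem abs_offDiag_average_sub_le {a a' : U → U → ℝ} {ρ : ℝ} (hρ : 0 ≤ ρ)
    (h : ∀ i j, |a i j - a' i j| ≤ ρ) :
    |1 / ((Fintype.card U : ℝ) * (Fintype.card U - 1)) * (∑ i, ∑ j, if j ≠ i then a i j else 0)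
      - 1 / ((Fintype.card U : ℝ) * (Fintype.card U - 1))
        * ∑ i, ∑ j, if j ≠ i then a' i j else 0| ≤ ρ := by
  have hcard := card_mul_card_sub_one_nonneg (U := U)
  have hsum : |∑ i, ∑ j, (if j ≠ i then a i j else 0) - ∑ i, ∑ j, if j ≠ i then a' i j else 0|
      ≤ (Fintype.card U : ℝ) * (Fintype.card U - 1) * ρ := by
    simp only [← Finset.sum_sub_distrib, ← sum_sum_ne_const]
    refine (Finset.abs_sum_le_sum_abs _ _).trans (Finset.sum_le_sum fun i _ =>
      (Finset.abs_sum_le_sum_abs _ _).trans (Finset.sum_le_sum fun j _ => ?_))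
    split_ifs
    · exact h i j
    · simp
  rw [← mul_sub, abs_mul, abs_of_nonneg (one_div_nonneg.2 hcard), one_div_mul_eq_div]
  exact div_le_of_le_mul₀ hcard hρ (hsum.trans_eq (mul_comm _ _))

theorem abs_prod_average_sub_le {a a' : U → V → ℝ} {ρ : ℝ} (hρ : 0 ≤ ρ)
    (h : ∀ i k, |a i k - a' i k| ≤ ρ) :
    |2 / ((Fintype.card V : ℝ) * Fintype.card U) * (∑ i, ∑ k, a i k)
      - 2 / ((Fintype.card V : ℝ) * Fintype.card U) * ∑ i, ∑ k, a' i k| ≤ 2 * ρ := by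
  have hsum : |∑ i, ∑ k, a i k - ∑ i, ∑ k, a' i k|
      ≤ ρ * ((Fintype.card V : ℝ) * Fintype.card U) := by
    calc |∑ i, ∑ k, a i k - ∑ i, ∑ k, a' i k| ≤ ∑ _i : U, ∑ _k : V, ρ := by
          simp only [← Finset.sum_sub_distrib]
          exact (Finset.abs_sum_le_sum_abs _ _).trans (Finset.sum_le_sum fun i _ =>
            (Finset.abs_sum_le_sum_abs _ _).trans (Finset.sum_le_sum fun k _ => h i k))
      _ = ρ * ((Fintype.card V : ℝ) * Fintype.card U) := by simp; ring
  rw [← mul_sub, abs_mul, abs_of_nonneg (by positivity), div_mul_eq_mul_div, mul_div_assoc]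
  exact mul_le_mul_of_nonneg_left (div_le_of_le_mul₀ (by positivity) hρ hsum) zero_le_two

theorem abs_testT_sub_testT_le {D' : ℕ} {X : U → Euc D} {Y : V → Euc D} {X' : U → Euc D'}
    {Y' : V → Euc D'} {ρ : ℝ} (hρ : 0 ≤ ρ)
    (hXX : ∀ i j, |rbf σ (X i) (X j) - rbf σ (X' i) (X' j)| ≤ ρ)
    (hXY : ∀ i j, |rbf σ (X i) (Y j) - rbf σ (X' i) (Y' j)| ≤ ρ)
    (hYY : ∀ i j, |rbf σ (Y i) (Y j) - rbf σ (Y' i) (Y' j)| ≤ ρ) :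
    |testT σ X Y - testT σ X' Y'| ≤ 4 * ρ := by
  have hX := abs_le.1 (abs_offDiag_average_sub_le hρ hXX)
  have hcross := abs_le.1 (abs_prod_average_sub_le hρ hXY)
  have hY := abs_le.1 (abs_offDiag_average_sub_le hρ hYY)
  simp only [testT]
  rw [abs_le]
  constructor <;> linarith [hX.1, hX.2, hcross.1, hcross.2, hY.1, hY.2]

theorem testT_map (W : Euc D ≃ₗᵢ[ℝ] Euc D) (X : U → Euc D) (Y : V → Euc D) :
    testT σ (fun u => W (X u)) (fun v => W (Y v)) = testT σ X Y := by
  simp only [testT, rbf_map]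

theorem offDiag_average_rbf_nonneg (X : U → Euc D) :
    0 ≤ 1 / ((Fintype.card U : ℝ) * (Fintype.card U - 1)) *
      ∑ i, ∑ j, if j ≠ i then rbf σ (X i) (X j) else 0 :=
  mul_nonneg (one_div_nonneg.2 card_mul_card_sub_one_nonneg) <| Finset.sum_nonneg fun _ _ =>
    Finset.sum_nonneg fun _ _ => ite_nonneg (rbf_nonneg _ _) le_rfl

theorem neg_two_le_testT (X : U → Euc D) (Y : V → Euc D) : -2 ≤ testT σ X Y := by
  have hcross := abs_prod_average_sub_le (a := fun i k => rbf σ (X i) (Y k)) (a' := 0) zero_le_one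
    fun i k => by simpa [abs_of_nonneg (rbf_nonneg _ _)] using rbf_le_one (σ := σ) (X i) (Y k)
  simp only [Pi.zero_apply, Finset.sum_const_zero, mul_zero, sub_zero] at hcross
  simp only [testT]
  linarith [(abs_le.1 hcross).2, offDiag_average_rbf_nonneg (σ := σ) X,
    offDiag_average_rbf_nonneg (σ := σ) Y]

theorem bddBelow_range_testT (X : U → Euc D) (Y : V → Euc D) :
    BddBelow (Set.range fun W : Euc D ≃ₗᵢ[ℝ] Euc D => testT σ X fun k => W (Y k)) :=
  ⟨-2, Set.forall_mem_range.2 fun _ => neg_two_le_testT _ _⟩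

theorem abs_iInf_sub_iInf_le {ι : Type*} [Nonempty ι] {f g : ι → ℝ} (hf : BddBelow (Set.range f))
    (hg : BddBelow (Set.range g)) {ε : ℝ} (h : ∀ i, |f i - g i| ≤ ε) :
    |(⨅ i, f i) - ⨅ i, g i| ≤ ε := by
  have hgf : (⨅ i, g i) - ε ≤ ⨅ i, f i := le_ciInf fun i => by
    linarith [ciInf_le hg i, (abs_le.1 (h i)).1]
  have hfg : (⨅ i, f i) - ε ≤ ⨅ i, g i := le_ciInf fun i => by
    linarith [ciInf_le hf i, (abs_le.1 (h i)).2]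
  rw [abs_le]
  constructor <;> linarith

theorem alignedT_map (O O' : Euc D ≃ₗᵢ[ℝ] Euc D) (X : U → Euc D) (Y : V → Euc D) :
    alignedT σ (fun u => O (X u)) (fun v => O' (Y v)) = alignedT σ X Y := by
  refine Function.Surjective.iInf_congr (fun W => (O'.trans W).trans O.symm)
    (fun W => ⟨(O'.symm.trans W).trans O, by ext1; simp⟩) fun W => ?_
  rw [← testT_map O]
  simp

theorem abs_testT_sub_testT_map_le (hσ : 0 < σ) {X Xh : U → Euc D} {Y Yh : V → Euc D}
    {O O' : Euc D ≃ₗᵢ[ℝ] Euc D} {ε : ℝ} (hε : 0 ≤ ε) (hX : ∀ u, ‖Xh u - O (X u)‖ ≤ ε)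
    (hY : ∀ v, ‖Yh v - O' (Y v)‖ ≤ ε) :
    |testT σ Xh Yh - testT σ (fun u => O (X u)) (fun v => O' (Y v))| ≤ 8 / σ * ε :=
  (abs_testT_sub_testT_le (by positivity) (fun i j => abs_rbf_sub_rbf_le hσ (hX i) (hX j))
    (fun i j => abs_rbf_sub_rbf_le hσ (hX i) (hY j))
    fun i j => abs_rbf_sub_rbf_le hσ (hY i) (hY j)).trans_eq (by ring)

theorem abs_alignedT_sub_alignedT_le (hσ : 0 < σ) {X Xh : U → Euc D} {Y Yh : V → Euc D}
    {O O' : Euc D ≃ₗᵢ[ℝ] Euc D} {ε : ℝ} (hε : 0 ≤ ε) (hX : ∀ u, ‖Xh u - O (X u)‖ ≤ ε)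
    (hY : ∀ v, ‖Yh v - O' (Y v)‖ ≤ ε) :
    |alignedT σ Xh Yh - alignedT σ X Y| ≤ 8 / σ * ε := by
  rw [← alignedT_map O O' X Y]
  refine abs_iInf_sub_iInf_le (bddBelow_range_testT _ _) (bddBelow_range_testT _ _) fun W =>
    abs_testT_sub_testT_map_le (O' := O'.trans W) hσ hε hX fun v => ?_
  rw [LinearIsometryEquiv.trans_apply, ← map_sub, W.norm_map]
  exact hY v

end TestStatistic

/-! ### The Gaussian kernel -/

section GaussianKernel

variable {D : ℕ} {σ : ℝ}

theorem integrable_exp_neg_mul_sq_norm {a : ℝ} (ha : 0 < a) :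
    Integrable fun z : Euc D => Real.exp (-a * ‖z‖ ^ 2) := by
  refine .of_integral_ne_zero ?_
  rw [GaussianFourier.integral_rexp_neg_mul_sq_norm ha]
  positivity

/-- The feature map of the Gaussian kernel: up to a constant, `rbf σ x y` is the inner product in
`L²` of the Gaussian bumps `gaussianFeature σ x` and `gaussianFeature σ y`. -/
noncomputable def gaussianFeature (σ : ℝ) (x z : Euc D) : ℝ := Real.exp (-(2 * ‖x - z‖ ^ 2) / σ ^ 2)

theorem continuous_gaussianFeature (x : Euc D) : Continuous (gaussianFeature σ x) := by
  unfold gaussianFeature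
  fun_prop

theorem norm_sub_sq_add_norm_sub_sq {E : Type*} [NormedAddCommGroup E] [InnerProductSpace ℝ E]
    (x y z : E) : ‖x - z‖ ^ 2 + ‖y - z‖ ^ 2
      = 2 * ‖z - (1 / 2 : ℝ) • (x + y)‖ ^ 2 + ‖x - y‖ ^ 2 / 2 := by
  have hsum : z - x + (z - y) = (2 : ℝ) • (z - (1 / 2 : ℝ) • (x + y)) := by module
  have hdiff : z - x - (z - y) = y - x := by abel
  have hlaw := parallelogram_law_with_norm ℝ (z - x) (z - y)
  rw [hsum, hdiff, norm_smul, norm_sub_rev z x, norm_sub_rev z y, norm_sub_rev y x,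
    Real.norm_ofNat] at hlaw
  linarith

theorem gaussianFeature_mul (x y z : Euc D) : gaussianFeature σ x z * gaussianFeature σ y z
    = rbf σ x y * Real.exp (-(4 / σ ^ 2) * ‖z - (1 / 2 : ℝ) • (x + y)‖ ^ 2) := by
  rw [gaussianFeature, gaussianFeature, rbf, ← Real.exp_add, ← Real.exp_add]
  congr 1
  linear_combination -(2 / σ ^ 2) * norm_sub_sq_add_norm_sub_sq x y z

theorem integrable_gaussianFeature_mul (hσ : 0 < σ) (x y : Euc D) :
    Integrable fun z => gaussianFeature σ x z * gaussianFeature σ y z := by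
  simp_rw [gaussianFeature_mul]
  exact ((integrable_exp_neg_mul_sq_norm (by positivity)).comp_sub_right _).const_mul _

theorem integral_gaussianFeature_mul (hσ : 0 < σ) (x y : Euc D) :
    ∫ z, gaussianFeature σ x z * gaussianFeature σ y z
      = rbf σ x y * (Real.pi / (4 / σ ^ 2)) ^ ((Module.finrank ℝ (Euc D) : ℝ) / 2) := by
  simp_rw [gaussianFeature_mul]
  rw [integral_const_mul, integral_sub_right_eq_self (fun z => Real.exp (-(4 / σ ^ 2) * ‖z‖ ^ 2)),
    GaussianFourier.integral_rexp_neg_mul_sq_norm (by positivity)]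

/-- The character `z ↦ exp (4 ⟪x, z⟫ / σ²)` of the additive group `ℝ^D`, to which Dedekind's linear
independence of characters is applied. -/
noncomputable def expInnerHom (σ : ℝ) (x : Euc D) : Multiplicative (Euc D) →* ℝ where
  toFun z := Real.exp (4 / σ ^ 2 * inner ℝ x z.toAdd)
  map_one' := by simp
  map_mul' z w := by rw [toAdd_mul, inner_add_right, mul_add, Real.exp_add]

theorem expInnerHom_injective (hσ : 0 < σ) :
    Function.Injective (expInnerHom σ : Euc D → Multiplicative (Euc D) →* ℝ) := by
  intro x y h
  refine ext_inner_right ℝ fun z => ?_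
  have hexp : Real.exp (4 / σ ^ 2 * inner ℝ x z) = Real.exp (4 / σ ^ 2 * inner ℝ y z) :=
    DFunLike.congr_fun h (Multiplicative.ofAdd z)
  exact mul_left_cancel₀ (by positivity) (Real.exp_injective hexp)

theorem gaussianFeature_eq_mul_expInnerHom (x z : Euc D) :
    gaussianFeature σ x z = Real.exp (-(2 * ‖z‖ ^ 2) / σ ^ 2)
      * (Real.exp (-(2 * ‖x‖ ^ 2) / σ ^ 2) * expInnerHom σ x (Multiplicative.ofAdd z)) := by
  change _ = _ * (_ * Real.exp (4 / σ ^ 2 * inner ℝ x z))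
  rw [gaussianFeature, ← Real.exp_add, ← Real.exp_add, norm_sub_sq_real]
  congr 1
  ring

theorem linearIndependent_gaussianFeature (hσ : 0 < σ) :
    LinearIndependent ℝ (gaussianFeature σ : Euc D → Euc D → ℝ) := by
  rw [linearIndependent_iff']
  intro T c hc x hx
  have hli := (linearIndependent_monoidHom (Multiplicative (Euc D)) ℝ).comp _
    (expInnerHom_injective hσ)
  have hcomb : ∑ y ∈ T, (c y * Real.exp (-(2 * ‖y‖ ^ 2) / σ ^ 2)) •
      (expInnerHom σ y : Multiplicative (Euc D) → ℝ) = 0 := by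
    ext z
    have hz : Real.exp (-(2 * ‖z.toAdd‖ ^ 2) / σ ^ 2) * ∑ y ∈ T,
        c y * Real.exp (-(2 * ‖y‖ ^ 2) / σ ^ 2) * expInnerHom σ y z = 0 := by
      rw [Finset.mul_sum, ← Pi.zero_apply (M := fun _ => ℝ) z.toAdd, ← hc, Finset.sum_apply]
      exact Finset.sum_congr rfl fun y _ => by
        rw [Pi.smul_apply, gaussianFeature_eq_mul_expInnerHom, ofAdd_toAdd, smul_eq_mul]
        ring
    simpa [Finset.sum_apply] using (mul_eq_zero.1 hz).resolve_left (Real.exp_pos _).ne'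
  exact (mul_eq_zero.1 (linearIndependent_iff'.1 hli T _ hcomb x hx)).resolve_right
    (Real.exp_pos _).ne'

theorem sum_gaussianFeature_sq (T : Finset (Euc D)) (c : Euc D → ℝ) (z : Euc D) :
    (∑ x ∈ T, c x * gaussianFeature σ x z) ^ 2
      = ∑ x ∈ T, ∑ y ∈ T, c x * c y * (gaussianFeature σ x z * gaussianFeature σ y z) := by
  rw [sq, Finset.sum_mul_sum]
  exact Finset.sum_congr rfl fun x _ => Finset.sum_congr rfl fun y _ => by ring

theorem integrable_sum_gaussianFeature_sq (hσ : 0 < σ) (T : Finset (Euc D)) (c : Euc D → ℝ) :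
    Integrable fun z => (∑ x ∈ T, c x * gaussianFeature σ x z) ^ 2 := by
  simp_rw [sum_gaussianFeature_sq]
  exact integrable_finsetSum _ fun x _ => integrable_finsetSum _ fun y _ =>
    (integrable_gaussianFeature_mul hσ x y).const_mul _

theorem integral_sum_gaussianFeature_sq (hσ : 0 < σ) (T : Finset (Euc D)) (c : Euc D → ℝ) :
    ∫ z, (∑ x ∈ T, c x * gaussianFeature σ x z) ^ 2
      = (∑ x ∈ T, ∑ y ∈ T, c x * c y * rbf σ x y)
        * (Real.pi / (4 / σ ^ 2)) ^ ((Module.finrank ℝ (Euc D) : ℝ) / 2) := by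
  have hint : ∀ x y : Euc D, Integrable fun z =>
      c x * c y * (gaussianFeature σ x z * gaussianFeature σ y z) := fun x y =>
    (integrable_gaussianFeature_mul hσ x y).const_mul _
  simp_rw [sum_gaussianFeature_sq]
  rw [integral_finsetSum _ fun x _ => integrable_finsetSum _ fun y _ => hint x y]
  simp_rw [integral_finsetSum T fun y _ => hint _ y, integral_const_mul,
    integral_gaussianFeature_mul hσ, Finset.sum_mul, mul_assoc]

theorem sum_mul_rbf_pos (hσ : 0 < σ) {T : Finset (Euc D)} {c : Euc D → ℝ}
    (hc : ∃ x ∈ T, c x ≠ 0) : 0 < ∑ x ∈ T, ∑ y ∈ T, c x * c y * rbf σ x y := by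
  have hcont : Continuous fun z => ∑ x ∈ T, c x * gaussianFeature σ x z :=
    continuous_finsetSum _ fun x _ => (continuous_gaussianFeature x).const_mul _
  have hcomb : ∃ z, ∑ x ∈ T, c x * gaussianFeature σ x z ≠ 0 := by
    by_contra! hzero
    obtain ⟨x, hx, hcx⟩ := hc
    refine hcx (linearIndependent_iff'.1 (linearIndependent_gaussianFeature hσ) T c ?_ x hx)
    ext z
    simpa [Finset.sum_apply] using hzero z
  obtain ⟨z, hz⟩ := hcomb
  have hpos : 0 < ∫ z, (∑ x ∈ T, c x * gaussianFeature σ x z) ^ 2 :=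
    integral_pos_of_integrable_nonneg_nonzero (hcont.pow 2)
      (integrable_sum_gaussianFeature_sq hσ T c) (fun _ => sq_nonneg _) (pow_ne_zero 2 hz)
  rw [integral_sum_gaussianFeature_sq hσ] at hpos
  exact pos_of_mul_pos_left hpos (by positivity)

end GaussianKernel

/-! ### Finitely supported distributions and the maximum mean discrepancy -/

/-- A probability measure carried by the finite set `S`. -/
structure FinitelySupported {α : Type*} [MeasurableSpace α] (F : Measure α) (S : Finset α) :
    Prop where
  prob : IsProbabilityMeasure F
  compl : F (↑S)ᶜ = 0

namespace FinitelySupported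

variable {α β : Type*} [MeasurableSpace α] [MeasurableSpace β] {F G : Measure α} {S T : Finset α}

theorem mono (h : FinitelySupported F S) (hST : S ⊆ T) : FinitelySupported F T :=
  ⟨h.prob, measure_mono_null (Set.compl_subset_compl.2 (Finset.coe_subset.2 hST)) h.compl⟩

theorem restrict_eq (h : FinitelySupported F S) : F.restrict ↑S = F :=
  Measure.restrict_eq_self_of_ae_mem (mem_ae_iff.2 h.compl)

section Atoms

variable [MeasurableSingletonClass α]

theorem aestronglyMeasurable (h : FinitelySupported F S) (f : α → ℝ) :
    AEStronglyMeasurable f F := by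
  have := h.prob
  rw [← h.restrict_eq]
  exact (IntegrableOn.finset (f := f)).aestronglyMeasurable

theorem integral_eq (h : FinitelySupported F S) (f : α → ℝ) :
    ∫ x, f x ∂F = ∑ x ∈ S, F.real {x} * f x := by
  have := h.prob
  conv_lhs => rw [← h.restrict_eq]
  simp [setIntegral_finset _ IntegrableOn.finset]

theorem measure_eq (h : FinitelySupported F S) (A : Set α) :
    F A = ∑ x ∈ S.filter (· ∈ A), F {x} := by
  rw [sum_measure_singleton]
  refine measure_congr (Filter.eventuallyEq_set.2 ?_)
  filter_upwards [mem_ae_iff.2 h.compl] with x hx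
  simp [Finset.mem_coe.1 hx]

theorem ext (hF : FinitelySupported F S) (hG : FinitelySupported G S)
    (h : ∀ x ∈ S, F.real {x} = G.real {x}) : F = G := by
  have := hF.prob
  have := hG.prob
  ext A _
  rw [hF.measure_eq, hG.measure_eq]
  exact Finset.sum_congr rfl fun x hx =>
    (measureReal_eq_measureReal_iff).1 (h x (Finset.mem_filter.1 hx).1)

end Atoms

variable [MeasurableSingletonClass β]

theorem map (h : FinitelySupported F S) {L : α → β} (hL : Measurable L) :
    FinitelySupported (F.map L) (S.image L) := by
  have := h.prob
  refine ⟨Measure.isProbabilityMeasure_map hL.aemeasurable, ?_⟩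
  rw [Measure.map_apply hL (Finset.measurableSet _).compl]
  exact measure_mono_null
    (fun x hx hxS => hx (Finset.mem_coe.2 (Finset.mem_image_of_mem L hxS))) h.compl

theorem integral_map (h : FinitelySupported F S) {L : α → β} (hL : Measurable L) (f : β → ℝ) :
    ∫ x, f x ∂(F.map L) = ∫ x, f (L x) ∂F :=
  MeasureTheory.integral_map hL.aemeasurable ((h.map hL).aestronglyMeasurable f)

end FinitelySupported

section MaximumMeanDiscrepancy

variable {D : ℕ} {σ : ℝ}

/-- The squared maximum mean discrepancy of `F` and `G` for the Gaussian kernel: the population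
version of `testT`. -/
noncomputable def sqMMD (σ : ℝ) (F G : Measure (Euc D)) : ℝ :=
  (∫ x, ∫ y, rbf σ x y ∂F ∂F) - 2 * (∫ x, ∫ y, rbf σ x y ∂G ∂F) + ∫ x, ∫ y, rbf σ x y ∂G ∂G

theorem rbf_comm (x y : Euc D) : rbf σ x y = rbf σ y x := by rw [rbf, rbf, norm_sub_rev]

variable {F G : Measure (Euc D)} {S T : Finset (Euc D)}

theorem sqMMD_self (F : Measure (Euc D)) : sqMMD σ F F = 0 := by rw [sqMMD]; ring

theorem sqMMD_eq_sum (hF : FinitelySupported F S) (hG : FinitelySupported G S) :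
    sqMMD σ F G = ∑ x ∈ S, ∑ y ∈ S,
      (F.real {x} - G.real {x}) * (F.real {y} - G.real {y}) * rbf σ x y := by
  have hswap : ∑ x ∈ S, ∑ y ∈ S, G.real {x} * F.real {y} * rbf σ x y
      = ∑ x ∈ S, ∑ y ∈ S, F.real {x} * G.real {y} * rbf σ x y := by
    rw [Finset.sum_comm]
    exact Finset.sum_congr rfl fun x _ => Finset.sum_congr rfl fun y _ => by
      rw [rbf_comm, mul_comm (G.real _)]
  simp only [sqMMD, hF.integral_eq, hG.integral_eq, Finset.mul_sum, ← mul_assoc, sub_mul, mul_sub,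
    Finset.sum_sub_distrib, hswap]
  simp only [mul_assoc, ← Finset.mul_sum]
  ring

theorem sqMMD_pos (hσ : 0 < σ) (hF : FinitelySupported F S) (hG : FinitelySupported G T)
    (h : F ≠ G) : 0 < sqMMD σ F G := by
  have hF' := hF.mono (Finset.subset_union_left (s₂ := T))
  have hG' := hG.mono (Finset.subset_union_right (s₁ := S))
  rw [sqMMD_eq_sum hF' hG']
  refine sum_mul_rbf_pos hσ ?_
  by_contra! hzero
  exact h (hF'.ext hG' fun x hx => sub_eq_zero.1 (hzero x hx))

theorem continuous_sqMMD_map (hF : FinitelySupported F S) (hG : FinitelySupported G T) :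
    Continuous fun L : Euc D →L[ℝ] Euc D => sqMMD σ F (G.map L) := by
  have hint : ∀ (L : Euc D →L[ℝ] Euc D) (f : Euc D → ℝ),
      ∫ x, f x ∂(G.map L) = ∑ x ∈ T, G.real {x} * f (L x) := fun L f => by
    rw [hG.integral_map L.measurable, hG.integral_eq]
  simp only [sqMMD, hF.integral_eq, hint, rbf]
  fun_prop

theorem isCompact_setOf_norm_map_eq {E : Type*} [NormedAddCommGroup E] [NormedSpace ℝ E]
    [FiniteDimensional ℝ E] : IsCompact {L : E →L[ℝ] E | ∀ x, ‖L x‖ = ‖x‖} := by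
  refine Metric.isCompact_of_isClosed_isBounded ?_ ?_
  · simp only [Set.ofPred_forall]
    exact isClosed_iInter fun x => isClosed_eq (by fun_prop) continuous_const
  · refine (Metric.isBounded_closedBall (x := (0 : E →L[ℝ] E)) (r := 1)).subset fun L hL => ?_
    rw [mem_closedBall_zero_iff]
    exact L.opNorm_le_bound zero_le_one fun x => by rw [hL x, one_mul]

theorem exists_pos_le_sqMMD_map (hσ : 0 < σ) (hF : FinitelySupported F S)
    (hG : FinitelySupported G T) (h : ¬ SameMotif F G) :
    ∃ t : ℝ, 0 < t ∧ ∀ W : Euc D ≃ₗᵢ[ℝ] Euc D, t ≤ sqMMD σ F (G.map W) := by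
  obtain ⟨L, hL, hmin⟩ := isCompact_setOf_norm_map_eq.exists_isMinOn
    ⟨ContinuousLinearMap.id ℝ (Euc D), fun x => rfl⟩
    (continuous_sqMMD_map (σ := σ) hF hG).continuousOn
  let U : Euc D ≃ₗᵢ[ℝ] Euc D :=
    LinearIsometry.toLinearIsometryEquiv ⟨(L : Euc D →ₗ[ℝ] Euc D), hL⟩ rfl
  refine ⟨sqMMD σ F (G.map L), sqMMD_pos hσ hF (hG.map L.measurable) fun hFG => h ⟨U, hFG⟩,
    fun W => ?_⟩
  exact isMinOn_iff.1 hmin (W.toContinuousLinearEquiv : Euc D →L[ℝ] Euc D) W.norm_map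

end MaximumMeanDiscrepancy

/-! ### Convergence of the test statistic -/

section Sampling

open scoped BigOperators

variable {D : ℕ} {σ : ℝ} {U V : Type*} [Fintype U] [Fintype V]

theorem abs_expect_le [Nonempty U] {f : U → ℝ} {r : ℝ} (h : ∀ u, |f u| ≤ r) : |𝔼 u, f u| ≤ r :=
  (Finset.abs_expect_le _ _).trans (Finset.expect_le Finset.univ_nonempty fun u _ => h u)

/-- The point cloud `X` has approximately the distribution `F`, with error `e`: its points lie in
`S` and the total deviation of their frequencies from the weights of `F` is at most `e`. By `card`
the cloud is so large that averages over pairs of distinct points differ from averages over all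
pairs by at most `e`. -/
structure ApproxSample {α : Type*} [MeasurableSpace α] (F : Measure α) (S : Finset α) (X : U → α)
    (e : ℝ) : Prop where
  mem : ∀ u, X u ∈ S
  freq : ∑ x ∈ S, |(𝔼 u, if X u = x then (1 : ℝ) else 0) - F.real {x}| ≤ e
  card : 1 ≤ e * ((Fintype.card U : ℝ) - 1)

namespace ApproxSample

variable {α : Type*} [MeasurableSpace α] {F G : Measure α} {S T : Finset α} {X : U → α} {Y : V → α}
  {e : ℝ}

theorem nonneg (hX : ApproxSample F S X e) : 0 ≤ e :=
  (Finset.sum_nonneg fun _ _ => abs_nonneg _).trans hX.freq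

theorem one_lt_card (hX : ApproxSample F S X e) : (1 : ℝ) < Fintype.card U := by
  by_contra! hle
  linarith [hX.card, mul_nonpos_of_nonneg_of_nonpos hX.nonneg (sub_nonpos.2 hle)]

theorem nonempty (hX : ApproxSample F S X e) : Nonempty U :=
  Fintype.card_pos_iff.1 (by exact_mod_cast zero_lt_one.trans hX.one_lt_card)

theorem expect_eq_sum (hX : ApproxSample F S X e) (f : α → ℝ) :
    𝔼 u, f (X u) = ∑ x ∈ S, (𝔼 u, if X u = x then (1 : ℝ) else 0) * f x := by
  simp_rw [Finset.expect_mul, ← Finset.expect_sum_comm]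
  exact Finset.expect_congr rfl fun u _ => by simp [hX.mem u]

theorem map {β : Type*} [MeasurableSpace β] [MeasurableSingletonClass β]
    (hX : ApproxSample F S X e) {L : α → β} (hL : Measurable L) (hinj : Function.Injective L) :
    ApproxSample (F.map L) (S.image L) (fun u => L (X u)) e where
  mem u := Finset.mem_image_of_mem L (hX.mem u)
  freq := by
    have hatom : ∀ x, (F.map L).real {L x} = F.real {x} := fun x => by
      rw [map_measureReal_apply hL (measurableSet_singleton _), ← Set.image_singleton,
        hinj.preimage_image]
    simpa only [Finset.sum_image hinj.injOn, hinj.eq_iff, hatom] using hX.freq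
  card := hX.card

variable [MeasurableSingletonClass α]

theorem abs_expect_sub_integral_le (hX : ApproxSample F S X e) (hF : FinitelySupported F S)
    {f : α → ℝ} (hf : ∀ x, |f x| ≤ 1) : |(𝔼 u, f (X u)) - ∫ x, f x ∂F| ≤ e := by
  rw [hF.integral_eq, hX.expect_eq_sum, ← Finset.sum_sub_distrib]
  refine ((Finset.abs_sum_le_sum_abs _ _).trans (Finset.sum_le_sum fun x _ => ?_)).trans hX.freq
  rw [← sub_mul, abs_mul]
  exact mul_le_of_le_one_right (abs_nonneg _) (hf x)

theorem abs_expect_expect_sub_integral_le (hX : ApproxSample F S X e) (hY : ApproxSample G T Y e)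
    (hF : FinitelySupported F S) (hG : FinitelySupported G T) {k : α → α → ℝ}
    (hk : ∀ x y, |k x y| ≤ 1) :
    |(𝔼 u, 𝔼 v, k (X u) (Y v)) - ∫ x, ∫ y, k x y ∂G ∂F| ≤ 2 * e := by
  have := hG.prob
  have := hX.nonempty
  have hinner : |𝔼 u, ((𝔼 v, k (X u) (Y v)) - ∫ y, k (X u) y ∂G)| ≤ e :=
    abs_expect_le fun u => hY.abs_expect_sub_integral_le hG (hk _)
  have houter : |(𝔼 u, ∫ y, k (X u) y ∂G) - ∫ x, ∫ y, k x y ∂G ∂F| ≤ e :=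
    hX.abs_expect_sub_integral_le hF fun x => by
      simpa using norm_integral_le_of_norm_le_const (μ := G) (f := k x) (C := 1) (.of_forall (hk x))
  rw [Finset.expect_sub_distrib] at hinner
  linarith [abs_sub_le (𝔼 u, 𝔼 v, k (X u) (Y v)) (𝔼 u, ∫ y, k (X u) y ∂G)
    (∫ x, ∫ y, k x y ∂G ∂F)]

end ApproxSample

theorem sum_sum_ne_rbf (X : U → Euc D) :
    (∑ i, ∑ j, if j ≠ i then rbf σ (X i) (X j) else 0)
      = (∑ i, ∑ j, rbf σ (X i) (X j)) - Fintype.card U := by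
  have hterm : ∀ i j : U, (if j ≠ i then rbf σ (X i) (X j) else 0)
      = rbf σ (X i) (X j) - if j = i then 1 else 0 := fun i j => by
    by_cases hj : j = i
    · simp [hj, rbf]
    · simp [hj]
  simp [hterm, Finset.sum_sub_distrib]

theorem expect_expect_rbf_mem_Icc [Nonempty U] [Nonempty V] (X : U → Euc D) (Y : V → Euc D) :
    𝔼 u, 𝔼 v, rbf σ (X u) (Y v) ∈ Set.Icc (0 : ℝ) 1 :=
  ⟨Finset.expect_nonneg fun _ _ => Finset.expect_nonneg fun _ _ => rbf_nonneg _ _,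
    Finset.expect_le Finset.univ_nonempty fun _ _ =>
      Finset.expect_le Finset.univ_nonempty fun _ _ => rbf_le_one _ _⟩

theorem offDiag_average_sub_expect {X : U → Euc D} (hU : (1 : ℝ) < Fintype.card U) :
    1 / ((Fintype.card U : ℝ) * (Fintype.card U - 1)) *
        (∑ i, ∑ j, if j ≠ i then rbf σ (X i) (X j) else 0) - 𝔼 u, 𝔼 v, rbf σ (X u) (X v)
      = ((𝔼 u, 𝔼 v, rbf σ (X u) (X v)) - 1) / (Fintype.card U - 1) := by
  have hsub : (Fintype.card U : ℝ) - 1 ≠ 0 := by linarith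
  have hne : (Fintype.card U : ℝ) ≠ 0 := by linarith
  simp only [sum_sum_ne_rbf, Fintype.expect_eq_sum_div_card, ← Finset.sum_div]
  field_simp
  ring

theorem ApproxSample.abs_offDiag_average_sub_expect_le {F : Measure (Euc D)} {S : Finset (Euc D)}
    {X : U → Euc D} {e : ℝ} (hX : ApproxSample F S X e) :
    |1 / ((Fintype.card U : ℝ) * (Fintype.card U - 1)) *
        (∑ i, ∑ j, if j ≠ i then rbf σ (X i) (X j) else 0) - 𝔼 u, 𝔼 v, rbf σ (X u) (X v)| ≤ e := by
  have := hX.nonempty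
  have hcard := sub_pos.2 hX.one_lt_card
  obtain ⟨hmean₀, hmean₁⟩ := expect_expect_rbf_mem_Icc (σ := σ) X X
  rw [offDiag_average_sub_expect hX.one_lt_card, abs_div, abs_of_pos hcard, div_le_iff₀ hcard]
  refine le_trans ?_ hX.card
  rw [abs_le]
  constructor <;> linarith

theorem ApproxSample.abs_testT_sub_sqMMD_le {F G : Measure (Euc D)} {S T : Finset (Euc D)}
    {X : U → Euc D} {Y : V → Euc D} {e : ℝ} (hX : ApproxSample F S X e)
    (hY : ApproxSample G T Y e) (hF : FinitelySupported F S) (hG : FinitelySupported G T) :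
    |testT σ X Y - sqMMD σ F G| ≤ 10 * e := by
  have hrbf : ∀ x y : Euc D, |rbf σ x y| ≤ 1 := fun x y => by
    rw [abs_of_nonneg (rbf_nonneg _ _)]
    exact rbf_le_one _ _
  have hcross : 2 / ((Fintype.card V : ℝ) * Fintype.card U) * (∑ i, ∑ k, rbf σ (X i) (Y k))
      = 2 * 𝔼 u, 𝔼 v, rbf σ (X u) (Y v) := by
    simp only [Fintype.expect_eq_sum_div_card, ← Finset.sum_div]
    rw [div_div]
    ring
  have hXdiag := abs_le.1 (hX.abs_offDiag_average_sub_expect_le (σ := σ))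
  have hYdiag := abs_le.1 (hY.abs_offDiag_average_sub_expect_le (σ := σ))
  have hXX := abs_le.1 (hX.abs_expect_expect_sub_integral_le hX hF hF hrbf)
  have hXY := abs_le.1 (hX.abs_expect_expect_sub_integral_le hY hF hG hrbf)
  have hYY := abs_le.1 (hY.abs_expect_expect_sub_integral_le hY hG hG hrbf)
  simp only [testT, sqMMD]
  rw [hcross, abs_le]
  constructor <;> linarith [hXdiag.1, hXdiag.2, hYdiag.1, hYdiag.2, hXX.1, hXX.2, hXY.1, hXY.2,
    hYY.1, hYY.2]

variable {F G : Measure (Euc D)} {S T : Finset (Euc D)} {X : U → Euc D} {Y : V → Euc D} {e : ℝ}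

theorem ApproxSample.abs_testT_sub_sqMMD_map_le (hX : ApproxSample F S X e)
    (hY : ApproxSample G T Y e) (hF : FinitelySupported F S) (hG : FinitelySupported G T)
    (W : Euc D ≃ₗᵢ[ℝ] Euc D) :
    |testT σ X (fun v => W (Y v)) - sqMMD σ F (G.map W)| ≤ 10 * e :=
  hX.abs_testT_sub_sqMMD_le (hY.map W.continuous.measurable W.injective) hF
    (hG.map W.continuous.measurable)

theorem ApproxSample.alignedT_le_of_sameMotif (hX : ApproxSample F S X e)
    (hY : ApproxSample G T Y e) (hF : FinitelySupported F S) (hG : FinitelySupported G T)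
    (h : SameMotif F G) : alignedT σ X Y ≤ 10 * e := by
  obtain ⟨W, rfl⟩ := h
  have htest := (abs_le.1 (hX.abs_testT_sub_sqMMD_map_le (σ := σ) hY hF hG W)).2
  rw [sqMMD_self, sub_zero] at htest
  exact (ciInf_le (bddBelow_range_testT X Y) W).trans htest

theorem ApproxSample.sub_le_alignedT (hX : ApproxSample F S X e) (hY : ApproxSample G T Y e)
    (hF : FinitelySupported F S) (hG : FinitelySupported G T) {t : ℝ}
    (h : ∀ W : Euc D ≃ₗᵢ[ℝ] Euc D, t ≤ sqMMD σ F (G.map W)) : t - 10 * e ≤ alignedT σ X Y :=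
  le_ciInf fun W => by
    linarith [h W, (abs_le.1 (hX.abs_testT_sub_sqMMD_map_le (σ := σ) hY hF hG W)).1]

end Sampling

/-! ### Random graphs with independent edges -/

section Concentration

variable {Ω ι : Type*} [MeasurableSpace Ω] {ν : Measure Ω} [IsProbabilityMeasure ν] [Fintype ι]
  {Z : ι → Ω → ℝ} {n : ℕ} {ε : ℝ}

theorem measureReal_le_sum_sub_integral_le (hZ : iIndepFun Z ν) (hm : ∀ k, Measurable (Z k))
    {a b : ℝ} (hab : b - a = 1) (hZab : ∀ k ω, Z k ω ∈ Set.Icc a b) (hcard : Fintype.card ι ≤ n)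
    (hn : 0 < n) (hε : 0 < ε) :
    ν.real {ω | ε * n ≤ ∑ k, (Z k ω - ν[Z k])} ≤ Real.exp (-(2 * ε ^ 2) * n) := by
  have hn' : (0 : ℝ) < n := Nat.cast_pos.2 hn
  rcases isEmpty_or_nonempty ι with hι | hι
  · have hempty : {ω | ε * n ≤ ∑ k, (Z k ω - ν[Z k])} = ∅ :=
      Set.eq_empty_of_forall_notMem fun ω hω =>
        (mul_pos hε hn').not_ge (hω.trans_eq (by simp))
    simpa only [hempty, measureReal_empty] using (Real.exp_pos _).le
  have hind : iIndepFun (fun k ω => Z k ω - ν[Z k]) ν :=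
    hZ.comp (fun k z => z - ∫ ω, Z k ω ∂ν) fun k => by fun_prop
  refine (HasSubgaussianMGF.measure_sum_ge_le_of_iIndepFun hind (s := Finset.univ)
    (fun k _ => hasSubgaussianMGF_of_mem_Icc (hm k).aemeasurable (.of_forall (hZab k)))
    (ε := ε * n) (by positivity)).trans (Real.exp_le_exp.2 ?_)
  have : (0 : ℝ) < Fintype.card ι := Nat.cast_pos.2 Fintype.card_pos
  have hcard' : (Fintype.card ι : ℝ) ≤ n := Nat.cast_le.2 hcard
  simp only [hab, nnnorm_one, NNReal.coe_pow, NNReal.coe_div, NNReal.coe_one, NNReal.coe_ofNat,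
    Finset.sum_const, Finset.card_univ, nsmul_eq_mul, NNReal.coe_mul, NNReal.coe_natCast]
  rw [div_le_iff₀ (by positivity)]
  nlinarith [mul_le_mul_of_nonneg_left hcard' (show 0 ≤ ε ^ 2 * n by positivity)]

theorem measure_lt_abs_sum_sub_integral_le (hZ : iIndepFun Z ν) (hm : ∀ k, Measurable (Z k))
    (hZ01 : ∀ k ω, Z k ω ∈ Set.Icc (0 : ℝ) 1) (hcard : Fintype.card ι ≤ n) (hn : 0 < n)
    (hε : 0 < ε) :
    ν {ω | ε * n < |∑ k, (Z k ω - ν[Z k])|} ≤ ENNReal.ofReal (2 * Real.exp (-(2 * ε ^ 2) * n)) := by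
  have hupper := measureReal_le_sum_sub_integral_le hZ hm (sub_zero 1) hZ01 hcard hn hε
  have hlower := measureReal_le_sum_sub_integral_le (Z := fun k ω => -Z k ω)
    (hZ.comp (fun _ z => -z) fun _ => measurable_neg) (fun k => (hm k).neg)
    (a := -1) (b := 0) (by norm_num)
    (fun k ω => ⟨by linarith [(hZ01 k ω).2], by linarith [(hZ01 k ω).1]⟩) hcard hn hε
  have hsub : {ω | ε * n < |∑ k, (Z k ω - ν[Z k])|} ⊆ {ω | ε * n ≤ ∑ k, (Z k ω - ν[Z k])} ∪
      {ω | ε * n ≤ ∑ k, (-Z k ω - ∫ ω, -Z k ω ∂ν)} := fun ω hω => by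
    rw [Set.mem_ofPred_eq, lt_abs] at hω
    rcases hω with hlt | hlt
    · exact Or.inl hlt.le
    · exact Or.inr (by simpa only [Set.mem_ofPred_eq, integral_neg, ← neg_sub',
        Finset.sum_neg_distrib] using hlt.le)
  rw [← ofReal_measureReal]
  refine ENNReal.ofReal_le_ofReal ?_
  linarith [measureReal_mono (μ := ν) hsub, measureReal_union_le (μ := ν)
    {ω | ε * n ≤ ∑ k, (Z k ω - ν[Z k])} {ω | ε * n ≤ ∑ k, (-Z k ω - ∫ ω, -Z k ω ∂ν)}]

end Concentration

section EdgeLaw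

open scoped unitInterval

variable {V : Type*}

theorem fromEdgeSet_eq_iff (θ : Sym2 V → Bool) (a : SimpleGraph V) :
    SimpleGraph.fromEdgeSet {e | θ e} = a ↔ ∀ e, ¬e.IsDiag → (θ e ↔ e ∈ a.edgeSet) := by
  rw [← SimpleGraph.edgeSet_inj, SimpleGraph.edgeSet_fromEdgeSet, Set.ext_iff]
  refine forall_congr' fun e => ?_
  by_cases he : e.IsDiag
  · simp [he, SimpleGraph.not_mem_edgeSet_of_isDiag]
  · simp [he]

/-- The edges whose presence makes `k` a common neighbour of `i` and `j`. -/
noncomputable def cherryEdges (i j k : V) : Finset (Sym2 V) := {s(i, k), s(k, j)}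

theorem disjoint_cherryEdges {i j k l : V} (hki : k ≠ i) (hkj : k ≠ j) (hkl : k ≠ l) :
    Disjoint (cherryEdges i j k) (cherryEdges i j l) := by
  simp only [cherryEdges, Finset.disjoint_left, Finset.mem_insert, Finset.mem_singleton]
  rintro e (rfl | rfl) <;> simp only [Sym2.eq_iff] <;> grind

theorem bernoulliMeasure_true_false_singleton (q : I) (b : Bool) :
    bernoulliMeasure true false q {b} = ENNReal.ofReal (if b then (q : ℝ) else 1 - q) := by
  rw [← ofReal_measureReal]
  cases b <;> simp

variable [Fintype V] (p : Sym2 V → I)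

/-- The joint law of independent edge indicators, the edge `e` being present with probability
`p e`. The indicators on the diagonal of `Sym2 V` are there for uniformity only. -/
noncomputable def edgeLaw : Measure (Sym2 V → Bool) :=
  Measure.pi fun e => bernoulliMeasure true false (p e)

instance : IsProbabilityMeasure (edgeLaw p) := by
  unfold edgeLaw
  infer_instance

theorem edgeLaw_fromEdgeSet_eq (a : SimpleGraph V) :
    edgeLaw p {θ | SimpleGraph.fromEdgeSet {e | θ e} = a} =
      ENNReal.ofReal (∏ e with ¬e.IsDiag, if e ∈ a.edgeSet then (p e : ℝ) else 1 - p e) := by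
  have hpi : {θ : Sym2 V → Bool | SimpleGraph.fromEdgeSet {e | θ e} = a} =
      Set.univ.pi fun e => if e.IsDiag then Set.univ else {decide (e ∈ a.edgeSet)} := by
    ext θ
    rw [Set.mem_ofPred_eq, fromEdgeSet_eq_iff, Set.mem_univ_pi]
    refine forall_congr' fun e => ?_
    by_cases he : e.IsDiag <;> by_cases ha : e ∈ a.edgeSet <;> simp [he, ha]
  rw [hpi, edgeLaw, Measure.pi_pi, Finset.prod_filter, ENNReal.ofReal_prod_of_nonneg]
  · refine Finset.prod_congr rfl fun e _ => ?_
    by_cases he : e.IsDiag <;> simp [he, bernoulliMeasure_true_false_singleton]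
  · intro e _
    split_ifs
    exacts [zero_le_one, (p e).2.1, sub_nonneg.2 (p e).2.2]

theorem edgeLaw_forall_mem (s : Finset (Sym2 V)) :
    edgeLaw p {θ | ∀ e ∈ s, θ e} = ENNReal.ofReal (∏ e ∈ s, (p e : ℝ)) := by
  have hpi : {θ : Sym2 V → Bool | ∀ e ∈ s, θ e} =
      Set.univ.pi fun e => if e ∈ s then {true} else Set.univ := by
    ext θ
    rw [Set.mem_ofPred_eq, Set.mem_univ_pi]
    refine forall_congr' fun e => ?_
    by_cases he : e ∈ s <;> simp [he]
  rw [hpi, edgeLaw, Measure.pi_pi, ENNReal.ofReal_prod_of_nonneg fun e _ => (p e).2.1,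
    ← Finset.prod_subset s.subset_univ fun e _ he => by simp [he]]
  exact Finset.prod_congr rfl fun e he => by
    simp only [he, if_true, bernoulliMeasure_true_false_singleton]

theorem iIndepSet_forall_mem {κ : Type*} {B : κ → Finset (Sym2 V)}
    (hB : Pairwise fun k l => Disjoint (B k) (B l)) :
    iIndepSet (fun k => {θ | ∀ e ∈ B k, θ e}) (edgeLaw p) := by
  rw [iIndepSet_iff_meas_biInter fun k => (Set.toFinite _).measurableSet]
  intro s
  have hUnion : ⋂ k ∈ s, {θ : Sym2 V → Bool | ∀ e ∈ B k, θ e} =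
      {θ | ∀ e ∈ s.biUnion B, θ e} := by
    ext θ
    simp only [Set.mem_iInter, Set.mem_ofPred_eq, Finset.mem_biUnion]
    exact ⟨fun h e ⟨k, hk, he⟩ => h k hk e he, fun h k hk e he => h e ⟨k, hk, he⟩⟩
  simp_rw [hUnion, edgeLaw_forall_mem, Finset.prod_biUnion fun _ _ _ _ hkl => hB hkl]
  exact ENNReal.ofReal_prod_of_nonneg fun k _ => Finset.prod_nonneg fun e _ => (p e).2.1

theorem edgeLaw_real_forall_mem_cherryEdges {i j : V} (hij : i ≠ j) (k : V) :
    (edgeLaw p).real {θ | ∀ e ∈ cherryEdges i j k, θ e} = p s(i, k) * p s(k, j) := by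
  have hne : s(i, k) ≠ s(k, j) := fun h => by
    rw [Sym2.eq_iff] at h
    grind
  rw [measureReal_def, edgeLaw_forall_mem, cherryEdges, Finset.prod_pair hne,
    ENNReal.toReal_ofReal (mul_nonneg (p _).2.1 (p _).2.1)]

theorem edgeLaw_lt_abs_sum_commonNeighbors_sub_le {i j : V} (hij : i ≠ j) {K : Finset V}
    (hK : ∀ k ∈ K, k ≠ i ∧ k ≠ j) {ε : ℝ} (hε : 0 < ε) :
    edgeLaw p {θ | ε * Fintype.card V < |∑ k ∈ K,
      ((if (SimpleGraph.fromEdgeSet {e | θ e}).Adj i k ∧ (SimpleGraph.fromEdgeSet {e | θ e}).Adj k j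
        then (1 : ℝ) else 0) - p s(i, k) * p s(k, j))|} ≤
      ENNReal.ofReal (2 * Real.exp (-(2 * ε ^ 2) * Fintype.card V)) := by
  let E : K → Set (Sym2 V → Bool) := fun k => {θ | ∀ e ∈ cherryEdges i j ↑k, θ e}
  have hE : iIndepSet E (edgeLaw p) := iIndepSet_forall_mem p fun k _ hkl =>
    disjoint_cherryEdges (hK k k.2).1 (hK k k.2).2 (Subtype.coe_injective.ne hkl)
  have hmeas : ∀ k, MeasurableSet (E k) := fun k => (E k).toFinite.measurableSet
  have hmean : ∀ k : K, ∫ θ, (E k).indicator (fun _ => (1 : ℝ)) θ ∂edgeLaw p =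
      p s(i, ↑k) * p s(↑k, j) := fun k => by
    rw [integral_indicator_const _ (hmeas k), smul_eq_mul, mul_one,
      edgeLaw_real_forall_mem_cherryEdges p hij]
  refine (measure_mono fun θ hθ => ?_).trans (measure_lt_abs_sum_sub_integral_le
    (hE.iIndepFun_indicator (β := ℝ) (m := inferInstance))
    (fun k => measurable_const.indicator (hmeas k))
    (fun k θ => by by_cases hθ : θ ∈ E k <;> simp [hθ])
    (Fintype.card_coe K ▸ K.card_le_univ) (Fintype.card_pos_iff.2 ⟨i⟩) hε)
  rw [Set.mem_ofPred_eq, ← Finset.sum_coe_sort] at hθ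
  simp only [Set.mem_ofPred_eq, hmean]
  convert hθ using 7 with k
  simp [Set.indicator_apply, E, cherryEdges, (hK k k.2).1.symm, (hK k k.2).2]

end EdgeLaw

/-! ### Typical samples -/

section Typical

variable {D n : ℕ}

/-- The number of common neighbours of `i` and `j` among the vertices at the position `x`, minus its
conditional expectation given the positions `y`. The vertices `i` and `j` themselves are left out
because a loop is not present with probability `‖y i‖²`. -/
noncomputable def codegreeDeviation (y : Fin n → Euc D) (a : SimpleGraph (Fin n)) (x : Euc D)
    (i j : Fin n) : ℝ :=
  ∑ k with y k = x ∧ k ≠ i ∧ k ≠ j,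
    ((if a.Adj i k ∧ a.Adj k j then (1 : ℝ) else 0) - inner ℝ (y i) (y k) * inner ℝ (y k) (y j))

/-- A sample from the random dot product graph of `F` is typical up to `ε` if its positions are in
`S`, which stands for the set of atoms of `F`, and if the numbers of vertices at each atom, and the
numbers of common neighbours at each atom, are as expected up to `ε * n`. -/
structure IsTypical (F : Measure (Euc D)) (S : Finset (Euc D)) (ε : ℝ) (y : Fin n → Euc D)
    (a : SimpleGraph (Fin n)) : Prop where
  mem : ∀ v, y v ∈ S
  count : ∀ x ∈ S, |(({v | y v = x} : Finset (Fin n)).card : ℝ) - n * F.real {x}| ≤ ε * n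
  codegree : ∀ x ∈ S, ∀ i j, i ≠ j → |codegreeDeviation y a x i j| ≤ ε * n

theorem IsTypical.mono {F : Measure (Euc D)} {S : Finset (Euc D)} {ε ε' : ℝ} {y : Fin n → Euc D}
    {a : SimpleGraph (Fin n)} (h : IsTypical F S ε y a) (hε : ε ≤ ε') : IsTypical F S ε' y a where
  mem := h.mem
  count x hx := (h.count x hx).trans (by gcongr)
  codegree x hx i j hij := (h.codegree x hx i j hij).trans (by gcongr)

section EdgeProb

open scoped unitInterval

/-- The edge probabilities of the random dot product graph with positions `y`. -/
noncomputable def edgeProb {y : Fin n → Euc D}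
    (hy : ∀ i j, inner ℝ (y i) (y j) ∈ Set.Icc (0 : ℝ) 1) : Sym2 (Fin n) → I :=
  Sym2.lift ⟨fun i j => ⟨inner ℝ (y i) (y j), hy i j⟩, fun _ _ =>
    Subtype.ext (real_inner_comm _ _)⟩

theorem coe_edgeProb_mk {y : Fin n → Euc D}
    (hy : ∀ i j, inner ℝ (y i) (y j) ∈ Set.Icc (0 : ℝ) 1) (i j : Fin n) :
    (edgeProb hy s(i, j) : ℝ) = inner ℝ (y i) (y j) :=
  rfl

end EdgeProb

theorem prod_prod_Iio_eq_prod_sym2 {M : Type*} [CommMonoid M] (f : Sym2 (Fin n) → M) :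
    ∏ i, ∏ j ∈ Finset.Iio i, f s(i, j) = ∏ e with ¬e.IsDiag, f e := by
  rw [← Finset.sym2_univ]
  refine Eq.trans ?_ (Finset.sum_sym2_filter_not_isDiag (M := Additive M) Finset.univ f).symm
  refine Eq.trans ?_ (Finset.prod_finset_product_right (f := fun q : Fin n × Fin n => f s(q.1, q.2))
    _ Finset.univ Finset.Iio fun q => ?_).symm
  · simp only [Sym2.eq_swap]
  · simpa using ne_of_lt

variable {Ω : Type*} [MeasurableSpace Ω] {μ : Measure Ω}
  {F : Measure (Euc D)} {S : Finset (Euc D)} {X : Ω → Fin n → Euc D}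
  {A : Ω → SimpleGraph (Fin n)} {ε : ℝ}

theorem IsRDPG.measurable_apply (h : IsRDPG μ F X A) (i : Fin n) : Measurable fun ω => X ω i :=
  (measurable_pi_apply i).comp h.measurable_pos

theorem IsRDPG.measurableSet_eq (h : IsRDPG μ F X A) (y : Fin n → Euc D) :
    MeasurableSet {ω | X ω = y} :=
  h.measurable_pos (measurableSet_singleton y)

theorem IsRDPG.measure_exists_notMem (h : IsRDPG μ F X A) (hF : FinitelySupported F S) :
    μ {ω | ∃ v, X ω v ∉ S} = 0 := by
  have hUnion : {ω | ∃ v, X ω v ∉ S} = ⋃ v, (fun ω => X ω v) ⁻¹' (↑S)ᶜ := by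
    ext
    simp
  rw [hUnion, measure_iUnion_null_iff]
  intro v
  rw [← Measure.map_apply (h.measurable_apply v) S.measurableSet.compl, h.law, hF.compl]

theorem IsRDPG.measure_not_isTypical_le_add (h : IsRDPG μ F X A) (hF : FinitelySupported F S) :
    μ {ω | ¬IsTypical F S ε (X ω) (A ω)} ≤
      ∑ x ∈ S, μ {ω | ε * n < |(({v | X ω v = x} : Finset (Fin n)).card : ℝ) - n * F.real {x}|} +
      ∑ q ∈ S ×ˢ Finset.univ.offDiag, μ {ω | (∀ v, X ω v ∈ S) ∧
        ε * n < |codegreeDeviation (X ω) (A ω) q.1 q.2.1 q.2.2|} := by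
  set E₁ : Euc D → Set Ω := fun x =>
    {ω | ε * n < |(({v | X ω v = x} : Finset (Fin n)).card : ℝ) - n * F.real {x}|}
  set E₂ : Euc D × Fin n × Fin n → Set Ω := fun q => {ω | (∀ v, X ω v ∈ S) ∧
    ε * n < |codegreeDeviation (X ω) (A ω) q.1 q.2.1 q.2.2|}
  have hsub : {ω | ¬IsTypical F S ε (X ω) (A ω)} ⊆ {ω | ∃ v, X ω v ∉ S} ∪
      ((⋃ x ∈ S, E₁ x) ∪ ⋃ q ∈ S ×ˢ Finset.univ.offDiag, E₂ q) := by
    intro ω hω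
    by_contra hcon
    simp only [Set.mem_union, not_or, Set.mem_iUnion, not_exists, Set.mem_ofPred_eq, not_not]
      at hcon
    obtain ⟨hmem, hcount, hcodegree⟩ := hcon
    refine hω ⟨hmem, fun x hx => not_lt.1 (hcount x hx), fun x hx i j hij => not_lt.1 fun hlt => ?_⟩
    exact hcodegree (x, i, j) (by simpa using ⟨hx, hij⟩) ⟨hmem, hlt⟩
  refine (measure_mono hsub).trans ((measure_union_le _ _).trans ?_)
  rw [h.measure_exists_notMem hF, zero_add]
  exact (measure_union_le _ _).trans
    (add_le_add (measure_biUnion_finset_le _ _) (measure_biUnion_finset_le _ _))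

theorem IsRDPG.measure_eq_and_graph_eq (h : IsRDPG μ F X A) {y : Fin n → Euc D}
    (hy : ∀ i j, inner ℝ (y i) (y j) ∈ Set.Icc (0 : ℝ) 1) (a : SimpleGraph (Fin n)) :
    μ {ω | X ω = y ∧ A ω = a} =
      μ {ω | X ω = y} * edgeLaw (edgeProb hy) {θ | SimpleGraph.fromEdgeSet {e | θ e} = a} := by
  have hcond := h.cond a {y} (measurableSet_singleton y)
  simp only [Set.mem_singleton_iff] at hcond
  rw [hcond, edgeLaw_fromEdgeSet_eq, mul_comm, ← setLIntegral_const]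
  refine setLIntegral_congr_fun (h.measurableSet_eq y) fun ω (hω : X ω = y) =>
    congrArg ENNReal.ofReal ?_
  have hprod := prod_prod_Iio_eq_prod_sym2 fun e =>
    if e ∈ a.edgeSet then (edgeProb hy e : ℝ) else 1 - edgeProb hy e
  simp only [SimpleGraph.mem_edgeSet, coe_edgeProb_mk] at hprod
  simp only [hω]
  convert hprod

theorem IsRDPG.measure_eq_and_graph_le (h : IsRDPG μ F X A) {y : Fin n → Euc D}
    (hy : ∀ i j, inner ℝ (y i) (y j) ∈ Set.Icc (0 : ℝ) 1) (P : SimpleGraph (Fin n) → Prop) :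
    μ {ω | X ω = y ∧ P (A ω)} ≤
      μ {ω | X ω = y} * edgeLaw (edgeProb hy) {θ | P (SimpleGraph.fromEdgeSet {e | θ e})} := by
  calc μ {ω | X ω = y ∧ P (A ω)}
      ≤ μ (⋃ a ∈ Finset.univ.filter P, {ω | X ω = y ∧ A ω = a}) := by
        refine measure_mono fun ω hω => ?_
        exact Set.mem_biUnion ((Finset.mem_filter_univ _).2 hω.2) ⟨hω.1, rfl⟩
    _ ≤ ∑ a with P a, μ {ω | X ω = y ∧ A ω = a} := measure_biUnion_finset_le _ _
    _ = μ {ω | X ω = y} * ∑ a with P a,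
          edgeLaw (edgeProb hy) {θ | SimpleGraph.fromEdgeSet {e | θ e} = a} := by
        rw [Finset.mul_sum]
        exact Finset.sum_congr rfl fun a _ => h.measure_eq_and_graph_eq hy a
    _ = _ := by
        rw [← measure_biUnion_finset]
        · congr 2
          ext θ
          simp
        · exact fun a _ b _ hab => Set.disjoint_left.2 fun θ ha hb => hab (Eq.trans (Eq.symm ha) hb)
        · exact fun a _ => (Set.toFinite _).measurableSet

theorem IsRDPG.measure_eq_and_lt_abs_codegreeDeviation_le (h : IsRDPG μ F X A)
    {y : Fin n → Euc D} (hy : ∀ i j, inner ℝ (y i) (y j) ∈ Set.Icc (0 : ℝ) 1) (hε : 0 < ε)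
    (x : Euc D) {i j : Fin n} (hij : i ≠ j) :
    μ {ω | X ω = y ∧ ε * n < |codegreeDeviation y (A ω) x i j|} ≤
      μ {ω | X ω = y} * ENNReal.ofReal (2 * Real.exp (-(2 * ε ^ 2) * n)) := by
  refine (h.measure_eq_and_graph_le hy fun a => ε * n < |codegreeDeviation y a x i j|).trans
    (mul_le_mul_right ?_ _)
  have hdev := edgeLaw_lt_abs_sum_commonNeighbors_sub_le (edgeProb hy) hij
    (K := {k | y k = x ∧ k ≠ i ∧ k ≠ j}) (fun k hk => (Finset.mem_filter_univ k).1 hk |>.2) hε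
  simp only [Fintype.card_fin, coe_edgeProb_mk] at hdev
  refine (measure_mono fun θ hθ => ?_).trans hdev
  rw [Set.mem_ofPred_eq] at hθ ⊢
  rw [codegreeDeviation] at hθ
  convert hθ

variable [IsProbabilityMeasure μ]

theorem IsRDPG.measure_lt_abs_card_sub_le (h : IsRDPG μ F X A) (hn : 0 < n) (hε : 0 < ε)
    (x : Euc D) :
    μ {ω | ε * n < |(({v | X ω v = x} : Finset (Fin n)).card : ℝ) - n * F.real {x}|} ≤
      ENNReal.ofReal (2 * Real.exp (-(2 * ε ^ 2) * n)) := by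
  let f : Euc D → ℝ := ({x} : Set (Euc D)).indicator 1
  have hf : Measurable f := measurable_one.indicator (measurableSet_singleton x)
  have hmean (i : Fin n) : ∫ ω, f (X ω i) ∂μ = F.real {x} := by
    rw [← integral_map (h.measurable_apply i).aemeasurable hf.aestronglyMeasurable, h.law]
    exact integral_indicator_one (measurableSet_singleton x)
  have hsum (ω : Ω) : ∑ i, (f (X ω i) - ∫ ω, f (X ω i) ∂μ) =
      (({v | X ω v = x} : Finset (Fin n)).card : ℝ) - n * F.real {x} := by
    rw [Finset.sum_sub_distrib, Finset.sum_congr rfl fun i _ => hmean i]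
    simp only [f, Set.indicator_apply, Set.mem_singleton_iff, Pi.one_apply, Finset.sum_boole,
      Finset.sum_const, Finset.card_fin, nsmul_eq_mul]
  simp_rw [← hsum]
  refine measure_lt_abs_sum_sub_integral_le (h.indep.comp (fun _ => f) fun _ => hf)
    (fun i => hf.comp (h.measurable_apply i)) (fun i ω => ?_) (Fintype.card_fin n).le hn hε
  by_cases hx : X ω i = x <;> simp [f, hx]

theorem IsRDPG.measure_lt_abs_codegreeDeviation_le (h : IsRDPG μ F X A)
    (h01 : ∀ x ∈ S, ∀ y ∈ S, inner ℝ x y ∈ Set.Icc (0 : ℝ) 1) (hε : 0 < ε) (x : Euc D)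
    {i j : Fin n} (hij : i ≠ j) :
    μ {ω | (∀ v, X ω v ∈ S) ∧ ε * n < |codegreeDeviation (X ω) (A ω) x i j|} ≤
      ENNReal.ofReal (2 * Real.exp (-(2 * ε ^ 2) * n)) := by
  set r := ENNReal.ofReal (2 * Real.exp (-(2 * ε ^ 2) * n))
  let Y : Finset (Fin n → Euc D) := Fintype.piFinset fun _ => S
  calc _ ≤ μ (⋃ y ∈ Y, {ω | X ω = y ∧ ε * n < |codegreeDeviation y (A ω) x i j|}) := by
        refine measure_mono fun ω hω => ?_
        exact Set.mem_biUnion (Fintype.mem_piFinset.2 hω.1) ⟨rfl, hω.2⟩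
    _ ≤ ∑ y ∈ Y, μ {ω | X ω = y ∧ ε * n < |codegreeDeviation y (A ω) x i j|} :=
        measure_biUnion_finset_le _ _
    _ ≤ ∑ y ∈ Y, μ {ω | X ω = y} * r := Finset.sum_le_sum fun y hy =>
        have hyS := Fintype.mem_piFinset.1 hy
        h.measure_eq_and_lt_abs_codegreeDeviation_le
          (fun i j => h01 _ (hyS i) _ (hyS j)) hε x hij
    _ = μ (⋃ y ∈ Y, {ω | X ω = y}) * r := by
        rw [← Finset.sum_mul, measure_biUnion_finset]
        · exact fun a _ b _ hab => Set.disjoint_left.2 fun θ ha hb => hab (Eq.trans (Eq.symm ha) hb)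
        · exact fun y _ => h.measurableSet_eq y
    _ ≤ r := mul_le_of_le_one_left' prob_le_one

theorem IsRDPG.measure_not_isTypical_le (h : IsRDPG μ F X A) (hF : FinitelySupported F S)
    (h01 : ∀ x ∈ S, ∀ y ∈ S, inner ℝ x y ∈ Set.Icc (0 : ℝ) 1) (hn : 0 < n) (hε : 0 < ε) :
    μ {ω | ¬IsTypical F S ε (X ω) (A ω)} ≤
      ENNReal.ofReal (4 * S.card * (n : ℝ) ^ 2 * Real.exp (-(2 * ε ^ 2) * n)) := by
  set e := Real.exp (-(2 * ε ^ 2) * n)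
  set Q := S ×ˢ (Finset.univ : Finset (Fin n)).offDiag
  have hn1 : (1 : ℝ) ≤ (n : ℝ) ^ 2 := one_le_pow₀ (Nat.one_le_cast.2 hn)
  have hQ : (Q.card : ℝ) ≤ S.card * (n : ℝ) ^ 2 := by
    norm_cast
    rw [Finset.card_product, Finset.offDiag_card, Finset.card_fin, sq]
    exact Nat.mul_le_mul_left _ (Nat.sub_le _ _)
  calc _ ≤ ∑ x ∈ S, ENNReal.ofReal (2 * e) + ∑ q ∈ Q, ENNReal.ofReal (2 * e) :=
        (h.measure_not_isTypical_le_add hF).trans <| add_le_add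
          (Finset.sum_le_sum fun x _ => h.measure_lt_abs_card_sub_le hn hε x)
          (Finset.sum_le_sum fun q hq => h.measure_lt_abs_codegreeDeviation_le h01 hε q.1
            (Finset.mem_offDiag.1 (Finset.mem_product.1 hq).2).2.2)
    _ = ENNReal.ofReal (S.card * (2 * e) + Q.card * (2 * e)) := by
        rw [ENNReal.ofReal_add (by positivity) (by positivity)]
        simp only [Finset.sum_const, nsmul_eq_mul, ENNReal.ofReal_mul (Nat.cast_nonneg _),
          ENNReal.ofReal_natCast]
    _ ≤ _ := ENNReal.ofReal_le_ofReal (by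
        have he : 0 < e := Real.exp_pos _
        have hS : (S.card : ℝ) ≤ S.card * (n : ℝ) ^ 2 :=
          le_mul_of_one_le_right (Nat.cast_nonneg _) hn1
        nlinarith)

theorem eventually_mul_sq_mul_exp_lt_rpow_neg (C : ℝ) {b : ℝ} (hb : 0 < b) (c : ℝ) :
    ∀ᶠ n : ℕ in Filter.atTop, C * (n : ℝ) ^ 2 * Real.exp (-b * n) < (n : ℝ) ^ (-c) := by
  have hlim : Filter.Tendsto (fun x : ℝ => C * (x ^ (2 + c) * Real.exp (-b * x)))
      Filter.atTop (nhds 0) := by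
    simpa using (tendsto_rpow_mul_exp_neg_mul_atTop_nhds_zero (2 + c) b hb).const_mul C
  filter_upwards [(hlim.comp tendsto_natCast_atTop_atTop).eventually (gt_mem_nhds one_pos),
    Filter.eventually_gt_atTop 0] with n hlt hn
  have hn' : (0 : ℝ) < n := Nat.cast_pos.2 hn
  rw [Real.rpow_neg hn'.le, ← one_div, lt_div_iff₀ (Real.rpow_pos_of_pos hn' _)]
  refine (le_of_eq ?_).trans_lt hlt
  simp only [Function.comp_apply, Real.rpow_add hn', Real.rpow_two]
  ring

theorem IsRDPG.aas_of_isTypical {Ω : ℕ → Type*} [∀ n, MeasurableSpace (Ω n)]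
    {μ : ∀ n, Measure (Ω n)} [∀ n, IsProbabilityMeasure (μ n)]
    {X : ∀ n, Ω n → Fin n → Euc D} {A : ∀ n, Ω n → SimpleGraph (Fin n)}
    (hXA : ∀ n, IsRDPG (μ n) F (X n) (A n)) (hF : FinitelySupported F S)
    (h01 : ∀ x ∈ S, ∀ y ∈ S, inner ℝ x y ∈ Set.Icc (0 : ℝ) 1) (hε : 0 < ε) {E : ∀ n, Set (Ω n)}
    (hE : ∀ᶠ n in Filter.atTop, ∀ ω, IsTypical F S ε (X n ω) (A n ω) → ω ∈ E n) : AAS μ E := by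
  intro c _
  obtain ⟨n₀, hn₀⟩ := Filter.eventually_atTop.1 ((hE.and (Filter.eventually_gt_atTop 0)).and
    (eventually_mul_sq_mul_exp_lt_rpow_neg (4 * S.card) (b := 2 * ε ^ 2) (by positivity) c))
  refine ⟨n₀, fun n hn η hη _ => ?_⟩
  obtain ⟨⟨hEn, hn0⟩, hbound⟩ := hn₀ n hn.le
  have hη0 : 0 ≤ η := (Real.rpow_nonneg (Nat.cast_nonneg n) _).trans hη.le
  have hcover : (1 : ENNReal) ≤ μ n (E n) + μ n {ω | ¬IsTypical F S ε (X n ω) (A n ω)} := by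
    rw [← measure_univ (μ := μ n)]
    refine (measure_mono fun ω _ => ?_).trans (measure_union_le _ _)
    exact (em _).imp (hEn ω) id
  rw [ENNReal.ofReal_sub _ hη0, ENNReal.ofReal_one, tsub_le_iff_right]
  refine hcover.trans (add_le_add_right ?_ _)
  exact ((hXA n).measure_not_isTypical_le hF h01 hn0 hε).trans
    (ENNReal.ofReal_le_ofReal (hbound.trans hη).le)

end Typical

section TypicalSamples

variable {D : ℕ}

/-- A graph whose vertices have positions in `ℝ^D`. -/
structure Sample (D : ℕ) where
  size : ℕ
  pos : Fin size → Euc D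
  graph : SimpleGraph (Fin size)

/-- The filter of the large samples that are typical of the random dot product graph of `F`, with
the set of atoms `S`: a property is eventually true if for some `ε > 0` and `N` all samples of size
at least `N` that are typical up to `ε` have it. -/
noncomputable def typicalSamples (F : Measure (Euc D)) (S : Finset (Euc D)) : Filter (Sample D) :=
  Filter.comap Sample.size Filter.atTop ⊓
    ⨅ ε : Set.Ioi (0 : ℝ), Filter.principal {s | IsTypical F S ε s.pos s.graph}

variable {F : Measure (Euc D)} {S : Finset (Euc D)}

theorem tendsto_size_typicalSamples :
    Filter.Tendsto Sample.size (typicalSamples F S) Filter.atTop :=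
  Filter.tendsto_comap.mono_left inf_le_left

theorem eventually_isTypical {ε : ℝ} (hε : 0 < ε) :
    ∀ᶠ s in typicalSamples F S, IsTypical F S ε s.pos s.graph :=
  Filter.mem_inf_of_right (Filter.mem_iInf_of_mem ⟨ε, hε⟩ (Filter.mem_principal_self _))

theorem exists_eventually_forall_isTypical {P : Sample D → Prop}
    (h : ∀ᶠ s in typicalSamples F S, P s) :
    ∃ ε : ℝ, 0 < ε ∧ ∀ᶠ n in Filter.atTop, ∀ (y : Fin n → Euc D) (a : SimpleGraph (Fin n)),
      IsTypical F S ε y a → P ⟨n, y, a⟩ := by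
  obtain ⟨U, hU, V, hV, hP⟩ := Filter.mem_inf_iff.1 h
  rw [Filter.mem_iInf_of_directed] at hV
  · obtain ⟨ε, hε⟩ := hV
    obtain ⟨W, hW, hWU⟩ := hU
    refine ⟨ε, ε.2, ?_⟩
    filter_upwards [hW] with n hn y a ha
    have : (⟨n, y, a⟩ : Sample D) ∈ U ∩ V := ⟨hWU hn, Filter.mem_principal.1 hε ha⟩
    rwa [← hP] at this
  · exact Monotone.directed_ge fun ε ε' hε => Filter.principal_mono.2 fun s hs => hs.mono hε

theorem IsRDPG.aas_of_eventually_typicalSamples {Ω : ℕ → Type*} [∀ n, MeasurableSpace (Ω n)]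
    {μ : ∀ n, Measure (Ω n)} [∀ n, IsProbabilityMeasure (μ n)]
    {X : ∀ n, Ω n → Fin n → Euc D} {A : ∀ n, Ω n → SimpleGraph (Fin n)}
    (hXA : ∀ n, IsRDPG (μ n) F (X n) (A n)) (hF : FinitelySupported F S)
    (h01 : ∀ x ∈ S, ∀ y ∈ S, inner ℝ x y ∈ Set.Icc (0 : ℝ) 1) {P : Sample D → Prop}
    (hP : ∀ᶠ s in typicalSamples F S, P s) : AAS μ fun n => {ω | P ⟨n, X n ω, A n ω⟩} := by
  obtain ⟨ε, hε, hEventually⟩ := exists_eventually_forall_isTypical hP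
  refine IsRDPG.aas_of_isTypical hXA hF h01 hε ?_
  filter_upwards [hEventually] with n hn ω hω
  exact hn _ _ hω

end TypicalSamples

/-! ### Laws of hierarchical blockmodels -/

section Mixture

variable {α ι : Type*} [MeasurableSpace α] [Fintype ι] {S : Finset α}

theorem FinitelySupported.dirac [MeasurableSingletonClass α] {x : α} (hx : x ∈ S) :
    FinitelySupported (Measure.dirac x) S := by
  refine ⟨inferInstance, ?_⟩
  rw [Measure.dirac_apply' _ S.measurableSet.compl]
  simpa using hx

theorem FinitelySupported.sum_smul {w : ι → ℝ} {F : ι → Measure α} (hw : ∀ i, 0 ≤ w i)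
    (hsum : ∑ i, w i = 1) (hF : ∀ i, FinitelySupported (F i) S) :
    FinitelySupported (∑ i, ENNReal.ofReal (w i) • F i) S := by
  have hmass : ∀ i, F i Set.univ = 1 := fun i => (hF i).prob.measure_univ
  refine ⟨⟨?_⟩, by simp [fun i => (hF i).compl]⟩
  simp only [Measure.coe_finsetSum, Finset.sum_apply, Measure.smul_apply, hmass, smul_eq_mul,
    mul_one]
  rw [← ENNReal.ofReal_sum_of_nonneg fun i _ => hw i, hsum, ENNReal.ofReal_one]

theorem sum_smul_apply_pos {w : ι → ℝ} {F : ι → Measure α} {B : Set α} {i : ι} (hw : 0 < w i)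
    (hF : 0 < F i B) : 0 < (∑ j, ENNReal.ofReal (w j) • F j) B := by
  simp only [Measure.coe_finsetSum, Finset.sum_apply, Measure.smul_apply, smul_eq_mul]
  exact (ENNReal.mul_pos (ENNReal.ofReal_pos.2 hw).ne' hF.ne').trans_le
    (Finset.single_le_sum (f := fun j => ENNReal.ofReal (w j) * F j B) (fun _ _ => zero_le)
      (Finset.mem_univ i))

end Mixture

namespace HSBM

variable {D R ℓ : ℕ} {G : HSBM D} {w : Fin R → ℝ} {H : Fin R → HSBM D} {x : Euc D}

theorem positions_mix (w : Fin R → ℝ) (H : Fin R → HSBM D) :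
    (mix R w H).positions = ⋃ r, (H r).positions :=
  rfl

theorem positions_subset_positions_mix (w : Fin R → ℝ) (H : Fin R → HSBM D) (r : Fin R) :
    (H r).positions ⊆ (mix R w H).positions :=
  Set.subset_iUnion (fun i => (H i).positions) r

theorem positions_finite : ∀ G : HSBM D, G.positions.Finite
  | sbm _ _ ξ => Set.finite_range ξ
  | mix _ _ H => Set.finite_iUnion fun i => positions_finite (H i)

/-- `positions` as a `Finset`. -/
noncomputable def atoms (G : HSBM D) : Finset (Euc D) :=
  G.positions_finite.toFinset

theorem mem_atoms : x ∈ G.atoms ↔ x ∈ G.positions :=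
  G.positions_finite.mem_toFinset

theorem coe_atoms (G : HSBM D) : (G.atoms : Set (Euc D)) = G.positions :=
  G.positions_finite.coe_toFinset

theorem IsLevel.exists_component (h : (mix R w H).IsLevel ℓ) (r : Fin R) :
    ∃ k, (H r).IsLevel k :=
  let ⟨k, _, hk⟩ := h.2.2.2.1 r
  ⟨k, hk⟩

theorem IsLevel.finitelySupported (h : G.IsLevel ℓ) : FinitelySupported G.law G.atoms := by
  induction G generalizing ℓ with
  | sbm K w ξ =>
    obtain ⟨-, hw, hsum⟩ := h
    exact .sum_smul (fun k => (hw k).le) hsum fun k => .dirac (mem_atoms.2 ⟨k, rfl⟩)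
  | mix R w H ih =>
    refine .sum_smul (fun r => (h.2.1 r).1.le) h.2.2.1 fun r => ?_
    obtain ⟨k, hk⟩ := h.exists_component r
    exact (ih r hk).mono fun x hx =>
      mem_atoms.2 (positions_subset_positions_mix w H r (mem_atoms.1 hx))

theorem IsLevel.law_singleton_pos (h : G.IsLevel ℓ) (hx : x ∈ G.positions) : 0 < G.law {x} := by
  induction G generalizing ℓ with
  | sbm K w ξ =>
    obtain ⟨k, rfl⟩ := hx
    exact sum_smul_apply_pos (h.2.1 k) (by simp)
  | mix R w H ih =>
    obtain ⟨r, hr⟩ := Set.mem_iUnion.1 hx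
    obtain ⟨k, hk⟩ := h.exists_component r
    exact sum_smul_apply_pos (h.2.1 r).1 (ih r hk hr)

theorem IsLevel.law_real_singleton_pos (h : G.IsLevel ℓ) (hx : x ∈ G.positions) :
    0 < G.law.real {x} :=
  have := h.finitelySupported.prob
  ENNReal.toReal_pos (h.law_singleton_pos hx).ne' (measure_ne_top _ _)

theorem IsLevel.positions_nonempty (h : G.IsLevel ℓ) : G.positions.Nonempty := by
  by_contra hne
  have hF := h.finitelySupported
  have hcompl := hF.compl
  rw [coe_atoms, Set.not_nonempty_iff_eq_empty.1 hne, Set.compl_empty, hF.prob.measure_univ]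
    at hcompl
  exact one_ne_zero hcompl

/-- A square root of the second moment matrix, with one row for each latent position. -/
noncomputable def weightedPositions (G : HSBM D) : Matrix G.atoms (Fin D) ℝ :=
  Matrix.of fun x a => √(G.law.real {(x : Euc D)}) * (x : Euc D) a

theorem IsLevel.secondMoment_eq (h : G.IsLevel ℓ) :
    G.secondMoment = G.weightedPositions.transpose * G.weightedPositions := by
  ext a b
  rw [secondMoment, h.finitelySupported.integral_eq, Matrix.mul_apply,
    ← Finset.sum_coe_sort G.atoms]
  refine Finset.sum_congr rfl fun x _ => ?_
  simp only [Matrix.transpose_apply, weightedPositions, Matrix.of_apply]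
  rw [mul_mul_mul_comm, Real.mul_self_sqrt measureReal_nonneg]

theorem IsLevel.span_range_row_weightedPositions (h : G.IsLevel ℓ) :
    Submodule.span ℝ (Set.range G.weightedPositions.row) =
      (Submodule.span ℝ G.positions).map (WithLp.linearEquiv 2 ℝ (Fin D → ℝ)).toLinearMap := by
  have hrow : ∀ x : G.atoms, G.weightedPositions.row x = √(G.law.real {(x : Euc D)}) •
      (WithLp.linearEquiv 2 ℝ (Fin D → ℝ)).toLinearMap (x : Euc D) := fun _ => rfl
  rw [Submodule.map_span]
  apply le_antisymm <;> rw [Submodule.span_le]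
  · rintro _ ⟨x, rfl⟩
    rw [hrow]
    exact Submodule.smul_mem _ _ (Submodule.subset_span ⟨x, mem_atoms.1 x.2, rfl⟩)
  · rintro _ ⟨x, hx, rfl⟩
    have hne : √(G.law.real {x}) ≠ 0 := (Real.sqrt_pos.2 (h.law_real_singleton_pos hx)).ne'
    have hmem := Submodule.smul_mem (Submodule.span ℝ (Set.range G.weightedPositions.row))
      (√(G.law.real {x}))⁻¹ (Submodule.subset_span ⟨⟨x, mem_atoms.2 hx⟩, rfl⟩)
    rwa [hrow, inv_smul_smul₀ hne] at hmem

theorem IsLevel.dim_eq (h : G.IsLevel ℓ) :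
    G.dim = Module.finrank ℝ (Submodule.span ℝ G.positions) := by
  rw [dim, h.secondMoment_eq, Matrix.rank_transpose_mul_self, Matrix.rank_eq_finrank_span_row,
    h.span_range_row_weightedPositions]
  exact LinearEquiv.finrank_map_eq _ _

theorem dim_le (G : HSBM D) : G.dim ≤ D := by
  simpa [dim] using G.secondMoment.rank_le_width

end HSBM

/-! ### Spectral embeddings of submodels -/

theorem exists_pos_forall_mul_norm_sq_le_sum_inner_sq {E : Type*} [NormedAddCommGroup E]
    [InnerProductSpace ℝ E] (T : Finset E) :
    ∃ c > 0, ∀ y ∈ Submodule.span ℝ (T : Set E), c * ‖y‖ ^ 2 ≤ ∑ x ∈ T, inner ℝ x y ^ 2 := by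
  let f : Submodule.span ℝ (T : Set E) →ₗ[ℝ] EuclideanSpace ℝ T :=
    (WithLp.linearEquiv 2 ℝ (T → ℝ)).symm.toLinearMap.comp
      (LinearMap.pi fun x : T => (innerₛₗ ℝ (x : E)).comp (Submodule.subtype _))
  have hf : ∀ y (x : T), f y x = inner ℝ (x : E) (y : E) := fun _ _ => rfl
  have hker : LinearMap.ker f = ⊥ := by
    refine LinearMap.ker_eq_bot'.2 fun y hy => ?_
    have horth : Submodule.span ℝ (T : Set E) ≤ (Submodule.span ℝ {(y : E)})ᗮ := by
      refine Submodule.span_le.2 fun x hx => Submodule.mem_orthogonal_singleton_iff_inner_left.2 ?_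
      simpa [hy] using (hf y ⟨x, hx⟩).symm
    exact Subtype.ext (inner_self_eq_zero.1
      (Submodule.mem_orthogonal_singleton_iff_inner_left.1 (horth y.2)))
  obtain ⟨K, hK, hanti⟩ := f.exists_antilipschitzWith hker
  refine ⟨((K : ℝ) ^ 2)⁻¹, by positivity, fun y hy => ?_⟩
  have hbound : ‖y‖ ≤ K * ‖f ⟨y, hy⟩‖ := by simpa using hanti.le_mul_dist ⟨y, hy⟩ 0
  have hnorm : ‖f ⟨y, hy⟩‖ ^ 2 = ∑ x ∈ T, inner ℝ x y ^ 2 := by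
    rw [EuclideanSpace.norm_sq_eq, ← Finset.sum_coe_sort T]
    exact Finset.sum_congr rfl fun x _ => by rw [hf, Real.norm_eq_abs, sq_abs]
  rw [← hnorm, inv_mul_le_iff₀ (by positivity), ← mul_pow]
  exact pow_le_pow_left₀ (norm_nonneg _) hbound 2

theorem transpose_mul_adjOn_apply {n : ℕ} (a : SimpleGraph (Fin n)) (V : Finset (Fin n))
    (u v : V) :
    ((adjOn a V).transpose * adjOn a V) u v =
      ∑ k ∈ V, if a.Adj u k ∧ a.Adj k v then (1 : ℝ) else 0 := by
  rw [Matrix.mul_apply, ← Finset.sum_coe_sort V]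
  refine Finset.sum_congr rfl fun k _ => ?_
  simp only [Matrix.transpose_apply, adjOn, a.adj_comm k u, ite_and, ite_mul, one_mul, zero_mul]

theorem transpose_mul_adjOn_apply_mem_Icc {n : ℕ} (a : SimpleGraph (Fin n)) (V : Finset (Fin n))
    (u v : V) : ((adjOn a V).transpose * adjOn a V) u v ∈ Set.Icc (0 : ℝ) n := by
  rw [transpose_mul_adjOn_apply, Finset.sum_boole]
  refine ⟨Nat.cast_nonneg _, Nat.cast_le.2 ?_⟩
  simpa using Finset.card_le_univ (V.filter fun k => a.Adj u k ∧ a.Adj k v)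

namespace HSBM

variable {D : ℕ}

section Vertices

variable {n R : ℕ} {G : HSBM D} {X : Fin n → Euc D}

/-- The vertex set of the subgraph of `G` in the whole graph. -/
noncomputable def vertices (G : HSBM D) (X : Fin n → Euc D) : Finset (Fin n) :=
  G.members X Finset.univ

theorem mem_vertices {v : Fin n} : v ∈ G.vertices X ↔ X v ∈ G.positions := by
  simp [vertices, members]

theorem vertices_eq_univ (hX : ∀ v, X v ∈ G.positions) : G.vertices X = Finset.univ :=
  Finset.eq_univ_of_forall fun v => mem_vertices.2 (hX v)

theorem members_vertices_mix (w : Fin R → ℝ) (H : Fin R → HSBM D) (r : Fin R)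
    (X : Fin n → Euc D) : (H r).members X ((mix R w H).vertices X) = (H r).vertices X := by
  ext v
  rw [members, Finset.mem_filter, mem_vertices, mem_vertices]
  exact and_iff_right_of_imp fun hv => positions_subset_positions_mix w H r hv

theorem range_pos_vertices (hX : G.positions ⊆ Set.range X) :
    Set.range (fun v : G.vertices X => X v) = G.positions := by
  refine Set.Subset.antisymm (Set.range_subset_iff.2 fun v => mem_vertices.1 v.2) fun x hx => ?_
  obtain ⟨v, rfl⟩ := hX hx
  exact ⟨⟨v, mem_vertices.2 hx⟩, rfl⟩

theorem vertices_filter_eq {x : Euc D} (hx : x ∈ G.positions) (X : Fin n → Euc D) :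
    (G.vertices X).filter (fun v => X v = x) = Finset.univ.filter fun v => X v = x := by
  ext v
  rw [Finset.mem_filter, Finset.mem_filter_univ, mem_vertices]
  exact and_iff_right_of_imp fun hv => hv ▸ hx

theorem sum_vertices_eq_sum_atoms (G : HSBM D) (X : Fin n → Euc D) (f : Euc D → ℝ) :
    ∑ v : G.vertices X, f (X v) =
      ∑ x ∈ G.atoms, (({v | X v = x} : Finset (Fin n)).card : ℝ) * f x := by
  rw [Finset.sum_coe_sort (G.vertices X) fun v => f (X v),
    ← Finset.sum_fiberwise_of_maps_to fun v hv => mem_atoms.2 (mem_vertices.1 hv)]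
  refine Finset.sum_congr rfl fun x hx => ?_
  rw [vertices_filter_eq (mem_atoms.1 hx), ← nsmul_eq_mul]
  exact Finset.sum_eq_card_nsmul fun v hv => by rw [(Finset.mem_filter_univ v).1 hv]

theorem sum_codegreeDeviation_atoms (G : HSBM D) (X : Fin n → Euc D) (a : SimpleGraph (Fin n))
    (u v : Fin n) :
    ∑ x ∈ G.atoms, codegreeDeviation X a x u v =
      ∑ k ∈ G.vertices X with k ≠ u ∧ k ≠ v,
        ((if a.Adj u k ∧ a.Adj k v then (1 : ℝ) else 0) -
          inner ℝ (X u) (X k) * inner ℝ (X k) (X v)) := by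
  rw [← Finset.sum_fiberwise_of_maps_to
    fun k hk => mem_atoms.2 (mem_vertices.1 (Finset.mem_filter.1 hk).1)]
  refine Finset.sum_congr rfl fun x hx => ?_
  rw [Finset.filter_comm, vertices_filter_eq (mem_atoms.1 hx), Finset.filter_filter,
    codegreeDeviation]

end Vertices

/-- `G` is a submodel of a model with law `F` and latent positions in `S`. Only the consequences of
occurring in the hierarchy are recorded that concern the subgraph of `G`; the last one says that `F`
is proportional to the law of `G` on the positions of `G`. -/
structure IsSubmodel (F : Measure (Euc D)) (S : Finset (Euc D)) (G : HSBM D) : Prop where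
  level : ∃ ℓ, G.IsLevel ℓ
  affinity : G.Affinity
  positions_subset : G.positions ⊆ S
  inner_mem : ∀ x ∈ S, ∀ y ∈ S, inner ℝ x y ∈ Set.Icc (0 : ℝ) 1
  mass : ∃ β : ℝ, 0 < β ∧ ∀ x ∈ G.positions, F.real {x} = β * G.law.real {x}

variable {F : Measure (Euc D)} {S : Finset (Euc D)} {G : HSBM D}

theorem IsLevel.isSubmodel_self {ℓ : ℕ} (hG : G.IsLevel ℓ) (hA : G.Affinity)
    (h01 : ∃ B : Set (Euc D), G.law Bᶜ = 0 ∧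
      ∀ x ∈ B, ∀ y ∈ B, inner ℝ x y ∈ Set.Icc (0 : ℝ) 1) :
    IsSubmodel G.law G.atoms G := by
  obtain ⟨B, hB, h01⟩ := h01
  have hsub : ∀ x ∈ G.atoms, x ∈ B := fun x hx => by
    by_contra hxB
    exact (hG.law_singleton_pos (mem_atoms.1 hx)).ne'
      (measure_mono_null (Set.singleton_subset_iff.2 hxB) hB)
  exact ⟨⟨ℓ, hG⟩, hA, G.coe_atoms.ge, fun x hx y hy => h01 x (hsub x hx) y (hsub y hy),
    1, one_pos, fun x _ => (one_mul _).symm⟩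

section Components

variable {R : ℕ} {w : Fin R → ℝ} {H : Fin R → HSBM D}

theorem Affinity.eq_of_mem_positions (hA : (mix R w H).Affinity) {x : Euc D} {i j : Fin R}
    (hi : x ∈ (H i).positions) (hj : x ∈ (H j).positions) : i = j := by
  by_contra hij
  exact lt_irrefl _ (hA.1 i j hij x hi x hj i x hi x hi)

theorem IsLevel.law_mix_real_singleton {ℓ : ℕ} (h : (mix R w H).IsLevel ℓ)
    (hA : (mix R w H).Affinity) {r : Fin R} {x : Euc D} (hx : x ∈ (H r).positions) :
    (mix R w H).law.real {x} = w r * (H r).law.real {x} := by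
  have hother : ∀ j, j ≠ r → (H j).law {x} = 0 := fun j hj => by
    obtain ⟨k, hk⟩ := h.exists_component j
    refine measure_mono_null (Set.singleton_subset_iff.2 fun hxj => ?_) hk.finitelySupported.compl
    exact hj (hA.eq_of_mem_positions (mem_atoms.1 hxj) hx)
  simp only [measureReal_def, law, Measure.coe_finsetSum, Finset.sum_apply, Measure.smul_apply,
    smul_eq_mul]
  rw [Finset.sum_eq_single_of_mem r (Finset.mem_univ r) fun j _ hj => by rw [hother j hj, mul_zero],
    ENNReal.toReal_mul, ENNReal.toReal_ofReal (h.2.1 r).1.le]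

theorem IsSubmodel.component (h : IsSubmodel F S (mix R w H)) (r : Fin R) :
    IsSubmodel F S (H r) := by
  obtain ⟨ℓ, hℓ⟩ := h.level
  obtain ⟨β, hβ, hmass⟩ := h.mass
  have hsub := positions_subset_positions_mix w H r
  refine ⟨hℓ.exists_component r, h.affinity.2 r, hsub.trans h.positions_subset, h.inner_mem,
    β * w r, mul_pos hβ (hℓ.2.1 r).1, fun x hx => ?_⟩
  rw [hmass x (hsub hx), hℓ.law_mix_real_singleton h.affinity hx, mul_assoc]

end Components

theorem tendsto_card_div_size {x : Euc D} (hx : x ∈ S) :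
    Filter.Tendsto (fun s => (({v | s.pos v = x} : Finset (Fin s.size)).card : ℝ) / s.size)
      (typicalSamples F S) (nhds (F.real {x})) := by
  refine Metric.tendsto_nhds.2 fun ε hε => ?_
  filter_upwards [eventually_isTypical (half_pos hε),
    tendsto_size_typicalSamples.eventually_gt_atTop 0] with s hs hsize
  have hn : (0 : ℝ) < s.size := Nat.cast_pos.2 hsize
  refine lt_of_le_of_lt ?_ (half_lt_self hε)
  rw [Real.dist_eq, div_sub' hn.ne', abs_div, abs_of_pos hn, div_le_iff₀ hn]
  exact hs.count x hx

theorem IsSubmodel.exists_eventually_le_card (h : IsSubmodel F S G) :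
    ∃ κ > 0, ∀ᶠ s in typicalSamples F S, ∀ x ∈ G.positions,
      κ * s.size ≤ (({v | s.pos v = x} : Finset (Fin s.size)).card : ℝ) := by
  obtain ⟨ℓ, hℓ⟩ := h.level
  obtain ⟨β, hβ, hmass⟩ := h.mass
  have hpos : ∀ x : G.atoms, 0 < F.real {(x : Euc D)} := fun x => by
    rw [hmass x (mem_atoms.1 x.2)]
    exact mul_pos hβ (hℓ.law_real_singleton_pos (mem_atoms.1 x.2))
  obtain ⟨κ, hκ, hκ0⟩ := ((Filter.eventually_all.2 fun x : G.atoms =>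
    Ioo_mem_nhdsGT (hpos x)).and self_mem_nhdsWithin).exists
  refine ⟨κ, hκ0, ?_⟩
  filter_upwards [Filter.eventually_all.2 fun x : G.atoms =>
      (tendsto_card_div_size (h.positions_subset (mem_atoms.1 x.2))).eventually_const_lt (hκ x).2,
    tendsto_size_typicalSamples.eventually_gt_atTop 0] with s hs hsize x hx
  exact ((lt_div_iff₀ (Nat.cast_pos.2 hsize)).1 (hs ⟨x, mem_atoms.2 hx⟩)).le

theorem IsSubmodel.eventually_positions_subset_range (h : IsSubmodel F S G) :
    ∀ᶠ s in typicalSamples F S, G.positions ⊆ Set.range s.pos := by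
  obtain ⟨κ, hκ, hcount⟩ := h.exists_eventually_le_card
  filter_upwards [hcount, tendsto_size_typicalSamples.eventually_gt_atTop 0] with s hs hsize x hx
  have hcard := (mul_pos hκ (Nat.cast_pos.2 hsize)).trans_le (hs x hx)
  obtain ⟨v, hv⟩ := Finset.card_pos.1 (Nat.cast_pos.1 hcard)
  exact ⟨v, (Finset.mem_filter_univ v).1 hv⟩

theorem IsSubmodel.abs_transpose_mul_adjOn_sub_le (h : IsSubmodel F S G) {n : ℕ}
    {X : Fin n → Euc D} {a : SimpleGraph (Fin n)} {ε : ℝ} (hX : IsTypical F S ε X a)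
    {u v : G.vertices X} (huv : u ≠ v) :
    |((adjOn a (G.vertices X)).transpose * adjOn a (G.vertices X)) u v -
      ∑ k : G.vertices X, inner ℝ (X u) (X k) * inner ℝ (X k) (X v)| ≤
        G.atoms.card * (ε * n) + 2 := by
  have h01 : ∀ i j, inner ℝ (X i) (X j) ∈ Set.Icc (0 : ℝ) 1 := fun i j =>
    h.inner_mem _ (hX.mem i) _ (hX.mem j)
  rw [transpose_mul_adjOn_apply,
    Finset.sum_coe_sort (G.vertices X) fun k => inner ℝ (X u) (X k) * inner ℝ (X k) (X v),
    ← Finset.sum_sub_distrib,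
    ← Finset.sum_filter_add_sum_filter_not (G.vertices X) fun k => k ≠ (u : Fin n) ∧ k ≠ v,
    ← sum_codegreeDeviation_atoms]
  refine (abs_add_le _ _).trans (add_le_add ?_ ?_)
  · rw [← nsmul_eq_mul]
    refine (Finset.abs_sum_le_sum_abs _ _).trans (Finset.sum_le_card_nsmul _ _ _ fun x hx => ?_)
    exact hX.codegree x (h.positions_subset (mem_atoms.1 hx)) u v (Subtype.coe_ne_coe.2 huv)
  · have hsub : (G.vertices X).filter (fun k => ¬(k ≠ (u : Fin n) ∧ k ≠ v)) ⊆ {↑u, ↑v} :=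
      fun k hk => by
        rw [Finset.mem_insert, Finset.mem_singleton, or_iff_not_and_not]
        exact (Finset.mem_filter.1 hk).2
    refine (Finset.abs_sum_le_sum_abs _ _).trans
      ((Finset.sum_le_card_nsmul _ _ 1 fun k _ => ?_).trans ?_)
    · have hprod := unitInterval.mul_mem (h01 u k) (h01 k v)
      refine abs_sub_le_of_le_of_le (by split_ifs <;> norm_num) (by split_ifs <;> norm_num)
        hprod.1 hprod.2 |>.trans_eq (sub_zero 1)
    · rw [nsmul_one]
      exact_mod_cast (Finset.card_le_card hsub).trans Finset.card_le_two

theorem IsSubmodel.eventually_abs_inner_ase_sub_le (h : IsSubmodel F S G) {δ : ℝ} (hδ : 0 < δ) :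
    ∀ᶠ s in typicalSamples F S, ∀ Xh : G.vertices s.pos → Euc G.dim,
      IsASE (adjOn s.graph (G.vertices s.pos)) Xh →
        ∀ u v, |inner ℝ (Xh u) (Xh v) - inner ℝ (s.pos u) (s.pos v)| ≤ δ := by
  obtain ⟨ℓ, hℓ⟩ := h.level
  obtain ⟨κ, hκ, hcount⟩ := h.exists_eventually_le_card
  obtain ⟨c, hc, hcoercive⟩ := exists_pos_forall_mul_norm_sq_le_sum_inner_sq G.atoms
  rw [coe_atoms] at hcoercive
  obtain ⟨η, hη, hase⟩ := exists_abs_inner_ase_sub_le (mul_pos hκ hc) hδ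
  have hsize : ∀ᶠ s in typicalSamples F S, max (1 / η) (4 / η) ≤ s.size :=
    (tendsto_natCast_atTop_atTop.comp tendsto_size_typicalSamples).eventually_ge_atTop _
  filter_upwards [hcount, h.eventually_positions_subset_range, hsize,
    eventually_isTypical (show 0 < η / (2 * (G.atoms.card + 1)) by positivity)]
    with s hcard hrange hn hs Xh hXh
  have hn1 : 1 ≤ η * s.size := (div_le_iff₀' hη).1 ((le_max_left _ _).trans hn)
  have hn4 : 4 ≤ η * s.size := (div_le_iff₀' hη).1 ((le_max_right _ _).trans hn)
  have hspan := range_pos_vertices hrange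
  refine hase (X := fun v : G.vertices s.pos => s.pos v) hXh
    (by simpa using Finset.card_le_univ (G.vertices s.pos)) hn1
    (fun u v => h.inner_mem _ (hs.mem u) _ (hs.mem v)) (by rw [hspan, hℓ.dim_eq]) ?_
    (transpose_mul_adjOn_apply_mem_Icc _ _) fun u v huv =>
      (h.abs_transpose_mul_adjOn_sub_le hs huv).trans ?_
  · intro y hy
    rw [hspan] at hy
    rw [sum_vertices_eq_sum_atoms G s.pos fun x => inner ℝ x y ^ 2]
    calc κ * c * s.size * ‖y‖ ^ 2 = κ * s.size * (c * ‖y‖ ^ 2) := by ring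
      _ ≤ κ * s.size * ∑ x ∈ G.atoms, inner ℝ x y ^ 2 := by gcongr; exact hcoercive y hy
      _ = ∑ x ∈ G.atoms, κ * s.size * inner ℝ x y ^ 2 := Finset.mul_sum _ _ _
      _ ≤ _ := Finset.sum_le_sum fun x hx => by gcongr; exact hcard x (mem_atoms.1 hx)
  · calc G.atoms.card * (η / (2 * (G.atoms.card + 1)) * s.size) + 2
        = G.atoms.card / (G.atoms.card + 1) * (η * s.size / 2) + 2 := by field_simp
      _ ≤ 1 * (η * s.size / 2) + 2 := by
          gcongr
          exact div_le_one_of_le₀ (by linarith) (by positivity)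
      _ ≤ η * s.size := by linarith

end HSBM

/-! ### Rounds of the procedure -/

namespace HSBM

variable {D R : ℕ} {F : Measure (Euc D)} {S : Finset (Euc D)} {G : HSBM D} {w : Fin R → ℝ}
  {H : Fin R → HSBM D} {σ : ℝ}

theorem Affinity.exists_between (hA : (mix R w H).Affinity) : ∃ θ : ℝ,
    (∀ i, ∀ x ∈ (H i).positions, ∀ y ∈ (H i).positions, θ < inner ℝ x y) ∧
    ∀ j k, j ≠ k → ∀ x ∈ (H j).positions, ∀ y ∈ (H k).positions, inner ℝ x y < θ := by
  let B := Finset.univ.offDiag.biUnion fun q : Fin R × Fin R =>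
    Finset.image₂ (inner ℝ) (H q.1).atoms (H q.2).atoms
  let I := Finset.univ.biUnion fun i : Fin R => Finset.image₂ (inner ℝ) (H i).atoms (H i).atoms
  have hB : ∀ {b}, b ∈ B ↔ ∃ j k, j ≠ k ∧ ∃ x ∈ (H j).positions, ∃ y ∈ (H k).positions,
      inner ℝ x y = b := by simp [B, mem_atoms]
  have hI : ∀ {c}, c ∈ I ↔ ∃ i, ∃ x ∈ (H i).positions, ∃ y ∈ (H i).positions,
      inner ℝ x y = c := by simp [I, mem_atoms]
  obtain ⟨θ, hθB, hθI⟩ := Order.exists_between_finsets B I fun b hb c hc => by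
    obtain ⟨j, k, hjk, u, hu, v, hv, rfl⟩ := hB.1 hb
    obtain ⟨i, x, hx, y, hy, rfl⟩ := hI.1 hc
    exact hA.1 j k hjk u hu v hv i x hx y hy
  exact ⟨θ, fun i x hx y hy => hθI _ (hI.2 ⟨i, x, hx, y, hy, rfl⟩),
    fun j k hjk x hx y hy => hθB _ (hB.2 ⟨j, k, hjk, x, hx, y, hy, rfl⟩)⟩

theorem Affinity.exists_isAffinityThreshold (hA : (mix R w H).Affinity) :
    ∃ θ δ : ℝ, 0 < δ ∧ ∀ {V : Type} {d : ℕ} {X : V → Euc D} {Xh : V → Euc d} {comp : V → Fin R},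
      (∀ v, X v ∈ (H (comp v)).positions) →
      (∀ u v, |inner ℝ (Xh u) (Xh v) - inner ℝ (X u) (X v)| ≤ δ) →
        IsAffinityThreshold Xh comp θ := by
  obtain ⟨θ, hwithin, hbetween⟩ := hA.exists_between
  have hgap : ∀ᶠ δ in nhdsWithin (0 : ℝ) (Set.Ioi 0), ∀ x y : (mix R w H).atoms,
      inner ℝ (x : Euc D) y ≠ θ → δ < |inner ℝ (x : Euc D) y - θ| := by
    refine Filter.eventually_all.2 fun x => Filter.eventually_all.2 fun y =>
      Filter.eventually_imp_distrib_left.2 fun hxy => ?_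
    filter_upwards [Ioo_mem_nhdsGT (abs_pos.2 (sub_ne_zero.2 hxy))] with δ hδ using hδ.2
  obtain ⟨δ, hgap, hδ⟩ := (hgap.and self_mem_nhdsWithin).exists
  refine ⟨θ, δ, hδ, fun {V d X Xh comp} hX hclose u v => ?_⟩
  have hmem : ∀ v, X v ∈ (mix R w H).atoms := fun v =>
    mem_atoms.2 (positions_subset_positions_mix w H _ (hX v))
  have hgap := hgap ⟨X u, hmem u⟩ ⟨X v, hmem v⟩
  have huv := abs_le.1 (hclose u v)
  refine ⟨fun hcomp => ?_, fun hcomp => ?_⟩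
  · have hlt := hwithin _ (X u) (hcomp ▸ hX u) (X v) (hX v)
    have hgap := hgap hlt.ne'
    rw [abs_of_pos (sub_pos.2 hlt)] at hgap
    linarith
  · have hlt := hbetween _ _ hcomp (X u) (hX u) (X v) (hX v)
    have hgap := hgap hlt.ne
    rw [abs_of_neg (sub_neg.2 hlt)] at hgap
    linarith

theorem IsSubmodel.eventually_recovery (h : IsSubmodel F S (mix R w H)) :
    ∀ᶠ s in typicalSamples F S, ∀ C,
      EmbedAndCluster s.graph ((mix R w H).vertices s.pos) (mix R w H).dim C →
        ∃ e : Equiv.Perm (Fin R), ∀ r, C (e r) = (H r).vertices s.pos := by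
  obtain ⟨θ, δ, hδ, hthreshold⟩ := h.affinity.exists_isAffinityThreshold
  filter_upwards [h.eventually_abs_inner_ase_sub_le hδ, h.eventually_positions_subset_range]
    with s hinner hrange Hh hHh
  obtain ⟨Xh, C, hXh, hC, hCH⟩ := hHh
  have hexists (v : (mix R w H).vertices s.pos) : ∃ r, s.pos v ∈ (H r).positions :=
    Set.mem_iUnion.1 (positions_mix w H ▸ mem_vertices.1 v.2)
  choose comp hcomp using hexists
  have hcomp_eq_iff (v r) : comp v = r ↔ s.pos v ∈ (H r).positions :=
    ⟨fun hv => hv ▸ hcomp v, h.affinity.eq_of_mem_positions (hcomp v)⟩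
  have hsurj : Function.Surjective comp := fun r => by
    obtain ⟨_, hlevel⟩ := (h.component r).level
    obtain ⟨x, hx⟩ := hlevel.positions_nonempty
    have hxmix := positions_subset_positions_mix w H r hx
    obtain ⟨v, rfl⟩ := hrange hxmix
    exact ⟨⟨v, mem_vertices.2 hxmix⟩, (hcomp_eq_iff _ r).2 hx⟩
  obtain ⟨e, he⟩ := hC.exact_recovery (hthreshold hcomp (hinner Xh hXh)) hsurj
  refine ⟨e, fun r => Finset.ext fun v => ?_⟩
  rw [hCH, he, Finset.mem_map, mem_vertices]
  constructor
  · rintro ⟨u, hu, rfl⟩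
    exact (hcomp_eq_iff u r).1 ((Finset.mem_filter_univ u).1 hu)
  · intro hv
    refine ⟨⟨v, mem_vertices.2 (positions_subset_positions_mix w H r hv)⟩, ?_, rfl⟩
    exact (Finset.mem_filter_univ _).2 ((hcomp_eq_iff _ r).2 hv)

theorem IsSubmodel.eventually_alignment (h : IsSubmodel F S G) {ε : ℝ} (hε : 0 < ε) :
    ∀ᶠ s in typicalSamples F S, ∀ Xh : G.vertices s.pos → Euc G.dim,
      IsASE (adjOn s.graph (G.vertices s.pos)) Xh →
        ∃ O : Euc D ≃ₗᵢ[ℝ] Euc D, ∀ v, ‖pad D (Xh v) - O (s.pos v)‖ ≤ ε := by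
  obtain ⟨δ, hδ, halign⟩ :=
    exists_linearIsometryEquiv_norm_sub_comp_le (fun x : G.atoms => (x : Euc D)) hε
  filter_upwards [h.eventually_abs_inner_ase_sub_le hδ, h.eventually_positions_subset_range]
    with s hinner hrange Xh hXh
  let k (v : G.vertices s.pos) : G.atoms := ⟨s.pos v, mem_atoms.2 (mem_vertices.1 v.2)⟩
  refine halign (k := k) ?_ fun u v => ?_
  · rintro ⟨x, hx⟩
    obtain ⟨v, rfl⟩ := hrange (mem_atoms.1 hx)
    exact ⟨⟨v, mem_vertices.2 (mem_atoms.1 hx)⟩, rfl⟩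
  · rw [inner_pad G.dim_le]
    exact hinner Xh hXh u v

theorem IsSubmodel.eventually_consistent (h : IsSubmodel F S (mix R w H)) (hσ : 0 < σ) {ε : ℝ}
    (hε : 0 < ε) : ∀ᶠ s in typicalSamples F S,
      Consistent σ ε s.pos s.graph R H fun r => (H r).vertices s.pos := by
  set ε' := ε * σ / 8
  have hε' : 0 < ε' := by positivity
  have heq : 8 / σ * ε' = ε := by simp only [ε']; field_simp
  filter_upwards [Filter.eventually_all.2 fun r => (h.component r).eventually_alignment hε']
    with s halign Xh hXh
  choose O hO using fun r => halign r (Xh r) (hXh r)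
  exact ⟨⟨O, fun i j => (abs_testT_sub_testT_map_le hσ hε'.le (hO i) (hO j)).trans_eq heq⟩,
    fun i j => (abs_alignedT_sub_alignedT_le hσ hε'.le (hO i) (hO j)).trans_eq heq⟩

end HSBM

namespace HSBM

variable {D R : ℕ} {F : Measure (Euc D)} {S : Finset (Euc D)} {G : HSBM D} {w : Fin R → ℝ}
  {H : Fin R → HSBM D} {σ : ℝ}

theorem IsLevel.sum_real_singleton {ℓ : ℕ} (h : G.IsLevel ℓ) {β : ℝ}
    (hβ : ∀ x ∈ G.positions, F.real {x} = β * G.law.real {x}) :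
    ∑ x ∈ G.atoms, F.real {x} = β := by
  have := h.finitelySupported.prob
  have hlaw : ∑ x ∈ G.atoms, G.law.real {x} = 1 := by
    simpa using (h.finitelySupported.integral_eq fun _ => 1).symm
  rw [Finset.sum_congr rfl fun x hx => hβ x (mem_atoms.1 hx), ← Finset.mul_sum, hlaw, mul_one]

section Sampling

open scoped BigOperators

theorem expect_vertices_eq_card_div {n : ℕ} {x : Euc D} (hx : x ∈ G.positions)
    (X : Fin n → Euc D) :
    𝔼 v : G.vertices X, (if X v = x then (1 : ℝ) else 0) =
      (({v | X v = x} : Finset (Fin n)).card : ℝ) / (G.vertices X).card := by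
  rw [Fintype.expect_eq_sum_div_card, Fintype.card_coe,
    Finset.sum_coe_sort (G.vertices X) fun v => if X v = x then (1 : ℝ) else 0, Finset.sum_boole,
    vertices_filter_eq hx]

theorem tendsto_card_vertices_div_size (G : HSBM D) (hG : G.positions ⊆ S) :
    Filter.Tendsto (fun s : Sample D => ((G.vertices s.pos).card : ℝ) / s.size)
      (typicalSamples F S) (nhds (∑ x ∈ G.atoms, F.real {x})) := by
  refine (tendsto_finsetSum G.atoms fun x hx =>
    tendsto_card_div_size (hG (mem_atoms.1 hx))).congr fun s => ?_
  have hcard := sum_vertices_eq_sum_atoms G s.pos fun _ => 1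
  simp only [Finset.sum_const, Finset.card_univ, Fintype.card_coe, nsmul_eq_mul, mul_one] at hcard
  rw [hcard, Finset.sum_div]

theorem IsSubmodel.tendsto_card_vertices (h : IsSubmodel F S G) :
    Filter.Tendsto (fun s : Sample D => ((G.vertices s.pos).card : ℝ)) (typicalSamples F S)
      Filter.atTop := by
  obtain ⟨ℓ, hℓ⟩ := h.level
  obtain ⟨β, hβ, hmass⟩ := h.mass
  have hratio := tendsto_card_vertices_div_size (F := F) G h.positions_subset
  rw [hℓ.sum_real_singleton hmass] at hratio
  refine (hratio.pos_mul_atTop hβ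
    (tendsto_natCast_atTop_atTop.comp tendsto_size_typicalSamples)).congr' ?_
  filter_upwards [tendsto_size_typicalSamples.eventually_gt_atTop 0] with s hs
  exact div_mul_cancel₀ _ (Nat.cast_pos.2 hs).ne'

theorem IsSubmodel.tendsto_expect_vertices (h : IsSubmodel F S G) {x : Euc D}
    (hx : x ∈ G.positions) :
    Filter.Tendsto (fun s => 𝔼 v : G.vertices s.pos, (if s.pos v = x then (1 : ℝ) else 0))
      (typicalSamples F S) (nhds (G.law.real {x})) := by
  obtain ⟨ℓ, hℓ⟩ := h.level
  obtain ⟨β, hβ, hmass⟩ := h.mass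
  have hden := tendsto_card_vertices_div_size (F := F) G h.positions_subset
  rw [hℓ.sum_real_singleton hmass] at hden
  have hratio := (tendsto_card_div_size (h.positions_subset hx)).div hden hβ.ne'
  rw [hmass x hx, mul_div_cancel_left₀ _ hβ.ne'] at hratio
  refine hratio.congr' ?_
  filter_upwards [tendsto_size_typicalSamples.eventually_gt_atTop 0] with s hs
  rw [expect_vertices_eq_card_div hx]
  exact div_div_div_cancel_right₀ (Nat.cast_pos.2 hs).ne' _ _

theorem IsSubmodel.eventually_approxSample (h : IsSubmodel F S G) {e : ℝ} (he : 0 < e) :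
    ∀ᶠ s in typicalSamples F S,
      ApproxSample G.law G.atoms (fun v : G.vertices s.pos => s.pos v) e := by
  have hfreq := tendsto_finsetSum G.atoms fun x hx =>
    ((h.tendsto_expect_vertices (mem_atoms.1 hx)).sub_const (G.law.real {x})).abs
  simp only [sub_self, abs_zero, Finset.sum_const_zero] at hfreq
  filter_upwards [hfreq.eventually_le_const he,
    h.tendsto_card_vertices.eventually_ge_atTop (1 / e + 1)] with s hs hcard
  refine ⟨fun v => mem_atoms.2 (mem_vertices.1 v.2),
    (Finset.sum_congr rfl fun _ _ => by congr!).trans_le hs, ?_⟩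
  rw [Fintype.card_coe, ← div_le_iff₀' he]
  linarith

end Sampling

theorem IsSubmodel.eventually_motifsDetected (h : IsSubmodel F S (mix R w H)) (hσ : 0 < σ) :
    ∀ᶠ t in nhdsWithin (0 : ℝ) (Set.Ioi 0), ∀ᶠ s in typicalSamples F S,
      MotifsDetected σ t s.graph R H fun r => (H r).vertices s.pos := by
  have hfin (r) : FinitelySupported (H r).law (H r).atoms :=
    (h.component r).level.elim fun _ hr => hr.finitelySupported
  have hsep : ∀ᶠ t in nhdsWithin (0 : ℝ) (Set.Ioi 0), ∀ i j,
      ¬SameMotif (H i).law (H j).law → ∀ W : Euc D ≃ₗᵢ[ℝ] Euc D,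
        2 * t ≤ sqMMD σ (H i).law ((H j).law.map W) := by
    refine Filter.eventually_all.2 fun i => Filter.eventually_all.2 fun j =>
      Filter.eventually_imp_distrib_left.2 fun hij => ?_
    obtain ⟨t₁, ht₁, hle⟩ := exists_pos_le_sqMMD_map hσ (hfin i) (hfin j) hij
    filter_upwards [Ioo_mem_nhdsGT (half_pos ht₁)] with t ht W
    linarith [hle W, ht.2]
  filter_upwards [hsep, self_mem_nhdsWithin] with t hsep (ht : 0 < t)
  filter_upwards [h.eventually_consistent hσ (show 0 < t / 4 by positivity),
    Filter.eventually_all.2 fun r =>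
      (h.component r).eventually_approxSample (show 0 < t / 40 by positivity)]
    with s hcons happrox Xh hXh i j
  have hclose := abs_le.1 ((hcons Xh hXh).2 i j)
  refine ⟨fun hlt => ?_, fun hsame => ?_⟩
  · by_contra hne
    have hle := (happrox i).sub_le_alignedT (happrox j) (hfin i) (hfin j) (hsep i j hne)
    linarith [hclose.1]
  · have hle := (happrox i).alignedT_le_of_sameMotif (σ := σ) (happrox j) (hfin i) (hfin j) hsame
    linarith [hclose.2]

section PerfectRun

variable {α : Type*} {l : Filter α} {Q : α → (s : Sample D) → RoundProp D s.size}

theorem IsSubmodel.eventually_perfectRun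
    (hQ : ∀ (R : ℕ) (w : Fin R → ℝ) (H : Fin R → HSBM D), IsSubmodel F S (mix R w H) →
      ∀ᶠ t in l, ∀ᶠ s in typicalSamples F S, Q t s R H fun r => (H r).vertices s.pos)
    {G : HSBM D} (hG : IsSubmodel F S G) :
    ∀ᶠ t in l, ∀ᶠ s in typicalSamples F S,
      PerfectRun (Q t s) s.pos s.graph G (G.vertices s.pos) := by
  induction G with
  | sbm => exact .of_forall fun _ => .of_forall fun _ => trivial
  | mix R w H ih =>
    filter_upwards [hQ R w H hG, Filter.eventually_all.2 fun r => ih r (hG.component r)]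
      with t hround hruns
    filter_upwards [hG.eventually_recovery, hround, Filter.eventually_all.2 hruns]
      with s hrecovery hround hruns C hC
    obtain ⟨e, he⟩ := hrecovery C hC
    refine ⟨e, fun r => (he r).trans (members_vertices_mix w H r s.pos).symm, ?_, fun r => ?_⟩
    · rwa [funext he]
    · rw [he]
      exact hruns r

theorem IsLevel.eventually_aas_perfectRun {ℓ : ℕ} (hG : G.IsLevel ℓ) (hA : G.Affinity)
    {Ω : ℕ → Type*} [∀ n, MeasurableSpace (Ω n)] {μ : ∀ n, Measure (Ω n)}
    [∀ n, IsProbabilityMeasure (μ n)]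
    {X : ∀ n, Ω n → Fin n → Euc D} {A : ∀ n, Ω n → SimpleGraph (Fin n)}
    (hXA : ∀ n, IsRDPG (μ n) G.law (X n) (A n))
    (hQ : ∀ (R : ℕ) (w : Fin R → ℝ) (H : Fin R → HSBM D), IsSubmodel G.law G.atoms (mix R w H) →
      ∀ᶠ t in l, ∀ᶠ s in typicalSamples G.law G.atoms,
        Q t s R H fun r => (H r).vertices s.pos) :
    ∀ᶠ t in l, AAS μ fun n =>
      {ω | PerfectRun (Q t ⟨n, X n ω, A n ω⟩) (X n ω) (A n ω) G Finset.univ} := by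
  have hself := hG.isSubmodel_self hA (hXA 0).inner_mem
  filter_upwards [hself.eventually_perfectRun hQ] with t hrun
  refine IsRDPG.aas_of_eventually_typicalSamples hXA hG.finitelySupported hself.inner_mem
    (P := fun s => PerfectRun (Q t s) s.pos s.graph G Finset.univ) ?_
  filter_upwards [hrun, eventually_isTypical one_pos] with s hrun hs
  rwa [vertices_eq_univ fun v => mem_atoms.1 (hs.mem v)] at hrun

end PerfectRun

end HSBM

theorem mainTheorem8 {D ℓ : ℕ} (hℓ : 2 ≤ ℓ) (G : HSBM D) (hG : G.IsLevel ℓ) (hA : G.Affinity)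
    (σ : ℝ) (hσ : 0 < σ)
    {Ω : ℕ → Type*} [∀ n, MeasurableSpace (Ω n)] (μ : ∀ n, Measure (Ω n))
    [∀ n, IsProbabilityMeasure (μ n)]
    (X : ∀ n, Ω n → Fin n → Euc D) (A : ∀ n, Ω n → SimpleGraph (Fin n))
    (hXA : ∀ n, IsRDPG (μ n) G.law (X n) (A n)) :
    -- perfect recovery of all subgraphs of all levels simultaneously
    AAS μ (fun n => {ω |
      HSBM.PerfectRun (fun _ _ _ => True) (X n ω) (A n ω) G Finset.univ}) ∧
    -- consistency of all dissimilarity matrices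
    (∀ ε : ℝ, 0 < ε → AAS μ (fun n => {ω |
      HSBM.PerfectRun (HSBM.Consistent σ ε (X n ω) (A n ω)) (X n ω) (A n ω) G Finset.univ})) ∧
    -- perfect detection of the motifs
    (∃ t₀ : ℝ, 0 < t₀ ∧ ∀ t : ℝ, 0 < t → t < t₀ → AAS μ (fun n => {ω |
      HSBM.PerfectRun (HSBM.MotifsDetected σ t (A n ω)) (X n ω) (A n ω) G Finset.univ})) := by
  refine ⟨?_, fun ε hε => ?_, ?_⟩
  · exact Filter.eventually_pure.1 (hG.eventually_aas_perfectRun hA hXA (l := pure ())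
      (Q := fun _ _ _ _ _ => True) fun R w H _ => .of_forall fun _ => .of_forall fun _ => trivial)
  · exact Filter.eventually_pure.1 (hG.eventually_aas_perfectRun hA hXA (l := pure ())
      (Q := fun _ s => HSBM.Consistent σ ε s.pos s.graph) fun R w H h =>
        Filter.eventually_pure.2 (h.eventually_consistent hσ hε))
  · obtain ⟨t₀, ht₀, hsubset⟩ := mem_nhdsGT_iff_exists_Ioo_subset.1
      (hG.eventually_aas_perfectRun hA hXA (l := nhdsWithin (0 : ℝ) (Set.Ioi 0))
        (Q := fun t s => HSBM.MotifsDetected σ t s.graph)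
        fun R w H h => h.eventually_motifsDetected hσ)
    exact ⟨t₀, ht₀, fun t ht htt₀ => hsubset ⟨ht, htt₀⟩⟩
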